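/- Let $L>0$, let $d_+,d_-\in C^1([0,L])$ satisfy $d_-(x)<0<d_+(x)$ on $[0,L]$, put $D=\mathrm{diag}(d_+,d_-)$, let $M:[0,L]\to\mathbb R^{2\times 2}$ be continuous and $\eta_0\le 0$. For real $\mu_\pm$ put $E(x)=\mathrm{diag}(e^{-\mu_+x},e^{\mu_-x})$. Assume that there exist $\mu_+,\mu_->0$ and $\nu_a<0$ with $$\sup_{v^\top E(x)v=1}v^\top\Big[\tfrac{d}{dx}(E(x)D(x))-|\eta_0|\,(E(x)M(x)+M(x)^\top E(x))\Big]v\le\nu_a\quad\text{for all }x\in[0,L],$$ and that there exist $\mu_+,\mu_-<0$ and $\nu_0>0$ with $$\inf_{v^\top E(x)v=1}v^\top\Big[E'(x)D(x)-E(x)D'(x)+|\eta_0|\,(E(x)M(x)+M(x)^\top E(x))\Big]v\ge\nu_0\quad\text{for all }x\in[0,L].$$ For $T>0$ and a control $u=(u_+,u_-)\in L^2(0,T)^2$ let $r=(r_+,r_-)$ be the state, that is, the $L^2$ solution (in the sense of integration along the characteristics) of $$r_t+Dr_x=\eta_0Mr\ \text{ on }(0,T)\times(0,L),\quad r(0,\cdot)=0,\quad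 r_+(t,0)=u_+(t),\quad r_-(t,L)=u_-(t).$$ Let $\lambda\in(0,1)$, $R^b=(R^b_+,R^b_-)\in\mathbb R^2$, let $\mathcal F$ be a finite set of integers with $0\in\mathcal F$, and let $$\nu>(1-\lambda)\|R^b\|_{\mathbb R^2}^2 .$$ The dynamic problem on $[0,T]$ is to minimize $$\int_0^T(1-\lambda)\left\|\begin{pmatrix}r_+(t,L)-R^b_+\\ r_-(t,0)-R^b_-\end{pmatrix}\right\|_{\mathbb R^2}^2+\lambda\,\|u(t)\|_{\mathbb R^2}^2\,dt+\nu\,T\,\mathrm{Var}(u_+)$$ over all $u\in L^2(0,T)^2$ with $u_+(t)\in\mathcal F$ for almost every $t\in(0,T)$, where $r$ is the state generated by $u$ and $\mathrm{Var}(u_+)=\sup\sum_i|u_+(t_{i+1})-u_+(t_i)|$, the supremum being taken over all finite partitions of $[0,T]$. The static problem is to minimize $$(1-\lambda)\left\|\begin{pmatrix}R_+(L)-R^b_+\\ R_-(0)-R^b_-\end{pmatrix}\right\|_{\mathbb R^2}^2+\lambda\,\|v\|_{\mathbb R^2}^2$$ over all $v=(v_+,v_-)\in\mathcal F\times\mathbb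 R$, where $R=(R_+,R_-)$ solves $DR'=\eta_0MR$ on $(0,L)$, $R_+(0)=v_+$, $R_-(L)=v_-$. Then there exist constants $\bar C>0$, $\tilde D>0$ and $T_0>0$, all independent of $T$, such that for every $T\ge T_0$ and every solution $u^{(\delta,T)}$ of the dynamic problem on $[0,T]$, with state $r^{(\delta,T)}$, there exists a solution $u^{(\sigma)}$ of the static problem, with state $r^{(\sigma)}$, such that $$u_+^{(\delta,T)}(t)=u_+^{(\sigma)}\ \text{ for all }t\in[0,T],\qquad \frac1T\int_0^T\big\|u^{(\delta,T)}(t)-u^{(\sigma)}\big\|_{\mathbb R^2}^2\,dt\le\frac{\bar C}{T},$$ $$\int_0^T\int_0^L\big\|r^{(\delta,T)}(t,x)-r^{(\sigma)}(x)\big\|_{\mathbb R^2}^2\,dx\,dt\le\tilde D .$$ -/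

import Mathlib

open MeasureTheory Set Filter
open scoped Matrix ENNReal

noncomputable section

/-- The plane with its Euclidean norm. Coordinate `0` is the plus-component, coordinate `1` the
minus-component. -/
abbrev Plane : Type := EuclideanSpace ℝ (Fin 2)

/-- The data of the `2 × 2` hyperbolic system `r_t + D r_x = η₀ M r` on `[0, L]` with
`D = diag(d₊, d₋)` and `d₋ < 0 < d₊`. -/
structure HyperbolicSystem where
  L : ℝ
  L_pos : 0 < L
  dPlus : ℝ → ℝ
  dMinus : ℝ → ℝ
  dPlus_contDiff : ContDiffOn ℝ 1 dPlus (Icc 0 L)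
  dMinus_contDiff : ContDiffOn ℝ 1 dMinus (Icc 0 L)
  dPlus_pos : ∀ x ∈ Icc 0 L, 0 < dPlus x
  dMinus_neg : ∀ x ∈ Icc 0 L, dMinus x < 0
  M : ℝ → Matrix (Fin 2) (Fin 2) ℝ
  M_continuous : ContinuousOn M (Icc 0 L)
  η₀ : ℝ
  η₀_nonpos : η₀ ≤ 0

namespace HyperbolicSystem

variable (S : HyperbolicSystem)

/-- `D(x) = diag(d₊(x), d₋(x))`. -/
def D (x : ℝ) : Matrix (Fin 2) (Fin 2) ℝ := Matrix.diagonal ![S.dPlus x, S.dMinus x]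

/-- The derivative on `[0, L]` of a matrix-valued function, entry by entry. -/
def matrixDeriv (A : ℝ → Matrix (Fin 2) (Fin 2) ℝ) (x : ℝ) : Matrix (Fin 2) (Fin 2) ℝ :=
  Matrix.of fun i j => derivWithin (fun y => A y i j) (Icc 0 S.L) x

end HyperbolicSystem

/-- The weight `E(x) = diag(exp(-μ₊ x), exp(μ₋ x))`. -/
def expWeight (μp μm : ℝ) (x : ℝ) : Matrix (Fin 2) (Fin 2) ℝ :=
  Matrix.diagonal ![Real.exp (-μp * x), Real.exp (μm * x)]

namespace HyperbolicSystem

variable (S : HyperbolicSystem)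

/-- There are `μ₊, μ₋ > 0` and `ν_a < 0` with
`sup_{vᵀEv = 1} vᵀ [(E D)' - |η₀| (E M + Mᵀ E)] v ≤ ν_a` on `[0, L]`. -/
def ForwardDissipative : Prop :=
  ∃ μp > 0, ∃ μm > 0, ∃ νa < 0, ∀ x ∈ Icc 0 S.L, ∀ v : Fin 2 → ℝ,
    v ⬝ᵥ (expWeight μp μm x *ᵥ v) = 1 →
    v ⬝ᵥ ((S.matrixDeriv (fun y => expWeight μp μm y * S.D y) x
      - |S.η₀| • (expWeight μp μm x * S.M x + (S.M x)ᵀ * expWeight μp μm x)) *ᵥ v) ≤ νa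

/-- There are `μ₊, μ₋ < 0` and `ν_0 > 0` with
`inf_{vᵀEv = 1} vᵀ [E' D - E D' + |η₀| (E M + Mᵀ E)] v ≥ ν_0` on `[0, L]`. -/
def BackwardDissipative : Prop :=
  ∃ μp < 0, ∃ μm < 0, ∃ ν₀ > 0, ∀ x ∈ Icc 0 S.L, ∀ v : Fin 2 → ℝ,
    v ⬝ᵥ (expWeight μp μm x *ᵥ v) = 1 →
    ν₀ ≤ v ⬝ᵥ ((S.matrixDeriv (expWeight μp μm) x * S.D x
      - expWeight μp μm x * S.matrixDeriv S.D x
      + |S.η₀| • (expWeight μp μm x * S.M x + (S.M x)ᵀ * expWeight μp μm x)) *ᵥ v)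

/-- The time in which the plus-characteristic `dx/dt = d₊(x)` travels from `0` to `x`. -/
def timePlus (x : ℝ) : ℝ := ∫ y in (0 : ℝ)..x, 1 / S.dPlus y

/-- The time in which the minus-characteristic `dx/dt = d₋(x)` travels from `L` to `x`. -/
def timeMinus (x : ℝ) : ℝ := ∫ y in x..S.L, 1 / |S.dMinus y|

/-- The equation for `r₊`, integrated along the plus-characteristic through `(t, x)` from the
point where it enters `(0, ∞) × (0, L)`: either through `x = 0`, where `r₊ = u₊`, or through
`t = 0`, where `r₊ = 0`. The characteristic passes through `y ≤ x` at the time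
`t - (timePlus x - timePlus y)`. -/
def alongPlus (u : ℝ → Plane) (r : ℝ → ℝ → Plane) (t x : ℝ) : ℝ :=
  (if S.timePlus x < t then u (t - S.timePlus x) 0 else 0)
  + ∫ y in (0 : ℝ)..x,
      if S.timePlus x - S.timePlus y < t then
        S.η₀ * (S.M y *ᵥ (r (t - (S.timePlus x - S.timePlus y)) y).ofLp) 0 / S.dPlus y
      else 0

/-- The equation for `r₋`, integrated along the minus-characteristic through `(t, x)` from the
point where it enters `(0, ∞) × (0, L)`: either through `x = L`, where `r₋ = u₋`, or through
`t = 0`, where `r₋ = 0`. The characteristic passes through `y ≥ x` at the time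
`t - (timeMinus x - timeMinus y)`. -/
def alongMinus (u : ℝ → Plane) (r : ℝ → ℝ → Plane) (t x : ℝ) : ℝ :=
  (if S.timeMinus x < t then u (t - S.timeMinus x) 1 else 0)
  + ∫ y in x..S.L,
      if S.timeMinus x - S.timeMinus y < t then
        S.η₀ * (S.M y *ᵥ (r (t - (S.timeMinus x - S.timeMinus y)) y).ofLp) 1 / |S.dMinus y|
      else 0

/-- `r(t, x)` is the `L²` (broad) solution on `(0, T) × (0, L)` of
`r_t + D r_x = η₀ M r`, `r(0, ·) = 0`, `r₊(t, 0) = u₊(t)`, `r₋(t, L) = u₋(t)`: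
it is square integrable and satisfies the equations integrated along the characteristics,
which contain the initial and the boundary conditions. -/
structure IsState (T : ℝ) (u : ℝ → Plane) (r : ℝ → ℝ → Plane) : Prop where
  memLp : MemLp (fun p : ℝ × ℝ => r p.1 p.2) 2
    ((volume.restrict (Ioo 0 T)).prod (volume.restrict (Ioo 0 S.L)))
  plus : ∀ᵐ p : ℝ × ℝ ∂((volume.restrict (Ioo 0 T)).prod (volume.restrict (Ioo 0 S.L))),
    r p.1 p.2 0 = S.alongPlus u r p.1 p.2
  minus : ∀ᵐ p : ℝ × ℝ ∂((volume.restrict (Ioo 0 T)).prod (volume.restrict (Ioo 0 S.L))),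
    r p.1 p.2 1 = S.alongMinus u r p.1 p.2

/-- The boundary traces `(r₊(t, L), r₋(t, 0))` of the state `r` with the control `u`: the values
that are transported along the characteristics to the outflow boundaries. -/
def outflowTrace (u : ℝ → Plane) (r : ℝ → ℝ → Plane) (t : ℝ) : Plane :=
  !₂[S.alongPlus u r t S.L, S.alongMinus u r t 0]

/-- The tracking cost
`∫_0^T (1 - lam) ‖(r₊(t, L), r₋(t, 0)) - Rb‖² + lam ‖u(t)‖² dt`. -/
def trackingCost (lam : ℝ) (Rb : Plane) (T : ℝ) (u : ℝ → Plane) (r : ℝ → ℝ → Plane) : ℝ :=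
  ∫ t in (0 : ℝ)..T, ((1 - lam) * ‖S.outflowTrace u r t - Rb‖ ^ 2 + lam * ‖u t‖ ^ 2)

/-- The tracking cost plus the switching cost `ν T Var(u₊)`, where `Var` is the total variation on
`[0, T]`, which may be infinite. (The tracking cost is nonnegative for `0 ≤ lam ≤ 1`.) -/
def switchingCost (lam ν : ℝ) (Rb : Plane) (T : ℝ) (u : ℝ → Plane) (r : ℝ → ℝ → Plane) : ℝ≥0∞ :=
  ENNReal.ofReal (S.trackingCost lam Rb T u r)
    + ENNReal.ofReal (ν * T) * eVariationOn (fun t => u t 0) (Icc 0 T)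

/-- `u ∈ L²(0, T)²` has a plus-component with values in `F` almost everywhere, and `r` is the
state that it generates. -/
structure IsDynamicFeasible (F : Finset ℤ) (T : ℝ) (u : ℝ → Plane) (r : ℝ → ℝ → Plane) :
    Prop where
  memLp : MemLp u 2 (volume.restrict (Ioo 0 T))
  integer : ∀ᵐ t ∂(volume.restrict (Ioo 0 T)), ∃ k ∈ F, u t 0 = (k : ℝ)
  state : S.IsState T u r

/-- `u`, with the state `r`, solves the dynamic optimal control problem with the integer
constraint and the switching cost. -/
def IsDynamicOptimal (F : Finset ℤ) (lam ν : ℝ) (Rb : Plane) (T : ℝ)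
    (u : ℝ → Plane) (r : ℝ → ℝ → Plane) : Prop :=
  S.IsDynamicFeasible F T u r ∧
    ∀ (v : ℝ → Plane) (s : ℝ → ℝ → Plane), S.IsDynamicFeasible F T v s →
      S.switchingCost lam ν Rb T u r ≤ S.switchingCost lam ν Rb T v s

/-- `R` solves `D R' = η₀ M R` on `(0, L)`, `R₊(0) = v₊`, `R₋(L) = v₋`. -/
structure IsStaticState (v : Plane) (R : ℝ → Plane) : Prop where
  continuousOn : ContinuousOn R (Icc 0 S.L)
  ode : ∀ x ∈ Ioo 0 S.L, ∃ R' : Plane, HasDerivAt R R' x ∧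
    S.D x *ᵥ R'.ofLp = S.η₀ • (S.M x *ᵥ (R x).ofLp)
  plus : R 0 0 = v 0
  minus : R S.L 1 = v 1

/-- `(1 - lam) ‖(R₊(L), R₋(0)) - Rb‖² + lam ‖v‖²`. -/
def staticCost (lam : ℝ) (Rb : Plane) (v : Plane) (R : ℝ → Plane) : ℝ :=
  (1 - lam) * ‖!₂[R S.L 0, R 0 1] - Rb‖ ^ 2 + lam * ‖v‖ ^ 2

/-- `v`, with the static state `R`, solves the static optimal control problem with the integer
constraint `v₊ ∈ F`. -/
def IsStaticOptimal (F : Finset ℤ) (lam : ℝ) (Rb : Plane) (v : Plane) (R : ℝ → Plane) : Prop :=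
  ((∃ k ∈ F, v 0 = (k : ℝ)) ∧ S.IsStaticState v R) ∧
    ∀ (w : Plane) (Q : ℝ → Plane), (∃ k ∈ F, w 0 = (k : ℝ)) → S.IsStaticState w Q →
      S.staticCost lam Rb v R ≤ S.staticCost lam Rb w Q

end HyperbolicSystem

end

/-! The switching cost freezes the integer component. The zero control is admissible and costs `T (1
- lam) ‖Rb‖² < ν T`, so an optimal control has `Var(u₊) < 1`. Since `u₊` takes integer values almost
everywhere, it is almost everywhere a constant `k ∈ F`. Putting this constant everywhere changes
neither the state nor the tracking cost, so optimality forces `Var(u₊) = 0`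
(`IsDynamicOptimal.plus_constant`). What remains is one quadratic problem in `u₋` for each of
finitely many integers.

Fix `k`, and let `v`, with state `R` and cost `c k`, minimise the static cost under `v₊ = k`.
Expanding the tracking cost around `(v, R)` gives `T * c k`, nonnegative quadratic terms, and linear
terms that involve only the time integrals of the outflow and of the control
(`trackingCost_expansion`). These time integrals solve the static two-point problem up to what is
still travelling through the domain at the end. Stability of that problem therefore yields `∫
outflow = H ∫ u + error`, with an error at most `C + δ ∫ ‖u - v‖²` for any prescribed `δ > 0`
(`exists_mean_outflow`). The first-order condition for `v` cancels the linear terms up to this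
error, and the control term of the cost absorbs the part with `δ`. Thus `T * c k + lam / 2 * ∫ ‖u -
v‖²` is at most the tracking cost plus a constant, while the constant control `v` costs at most `T *
c k` plus a constant (`exists_partial_turnpike`).

Comparing the optimal control with the constant control of a best integer `m` gives `T (c k - c m) +
lam / 2 * ∫ ‖u - v k‖² ≤ 2 B`. Both terms are nonnegative. As `F` is finite, a large `T` excludes `c
k > c m`, so `v k` is optimal for the static problem; the integral is bounded in any case. The state
then follows the control by `exists_deviation_estimate`.

Uniformity in `T` comes from dissipativity, through a weighted energy identity integrated along
characteristics (`exists_energy`). To keep zero initial values, a state is compared with a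
stationary profile that is switched on smoothly. The same identity in one variable gives
`exists_static_stability`, hence solvability of the static problem (`exists_static`). The states of
constant controls, needed as competitors, come from a Neumann series (`exists_state`). -/

/-! ### Energy identity for primitives and the Cauchy–Schwarz inequality. -/

/-- The primitive `c + ∫_0^x G` satisfies the weighted energy identity. -/
theorem integral_weighted_sq {a G : ℝ → ℝ} {b c L : ℝ} (hb : 0 ≤ b) (hbL : b ≤ L)
    (ha : ContDiffOn ℝ 1 a (Icc 0 L)) (hG : IntervalIntegrable G volume 0 b) :
    ∫ x in (0 : ℝ)..b, (derivWithin a (Icc 0 L) x * (c + ∫ y in (0 : ℝ)..x, G y) ^ 2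
      + 2 * a x * (c + ∫ y in (0 : ℝ)..x, G y) * G x)
      = a b * (c + ∫ y in (0 : ℝ)..b, G y) ^ 2 - a 0 * c ^ 2 := by
  set Z : ℝ → ℝ := fun x => c + ∫ y in (0 : ℝ)..x, G y with hZ
  -- `G` is only integrable, so the product rule is integrated by means of absolute continuity.
  have hconst : AbsolutelyContinuousOnInterval (fun _ : ℝ => c) 0 b :=
    (LipschitzWith.const c).lipschitzOnWith.absolutelyContinuousOnInterval
  have hZac : AbsolutelyContinuousOnInterval Z 0 b :=
    hconst.add (hG.absolutelyContinuousOnInterval_intervalIntegral (c := 0) (by simp))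
  have haac : AbsolutelyContinuousOnInterval a 0 b :=
    ContDiffOn.absolutelyContinuousOnInterval
      (ha.mono (by rw [uIcc_of_le hb]; exact Icc_subset_Icc_right hbL))
  have hZ2 : AbsolutelyContinuousOnInterval (fun x => Z x * Z x) 0 b := hZac.fun_mul hZac
  have key := haac.integral_deriv_mul_eq_sub hZ2
  have e0 : Z 0 = c := by simp [hZ]
  rw [e0] at key
  rw [show a b * (Z b) ^ 2 - a 0 * c ^ 2 = a b * (Z b * Z b) - a 0 * (c * c) by ring, ← key]
  apply intervalIntegral.integral_congr_ae
  have hne : ∀ᵐ x : ℝ, x ≠ b := by simp [ae_iff, measure_singleton]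
  filter_upwards [hG.ae_hasDerivAt_integral, hne] with x hx hxb hxm
  rw [uIoc_of_le hb] at hxm
  have hx' := hx (by rw [uIcc_of_le hb]; exact ⟨hxm.1.le, hxm.2⟩) 0 (by simp)
  have hZd : HasDerivAt Z (G x) x := by simpa [hZ] using hx'.const_add c
  have hlt : x < b := lt_of_le_of_ne hxm.2 hxb
  have had : derivWithin a (Icc 0 L) x = deriv a x :=
    derivWithin_of_mem_nhds (Icc_mem_nhds hxm.1 (hlt.trans_le hbL))
  have := (hZd.mul hZd).deriv
  have h2 : deriv (fun x => Z x * Z x) x = G x * Z x + Z x * G x := this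
  rw [h2, had]
  ring

/-- The Cauchy–Schwarz inequality for the integral of a function on an interval. -/
theorem sq_intervalIntegral_le {f : ℝ → ℝ} {a b : ℝ} (hab : a ≤ b)
    (hf : IntervalIntegrable f volume a b) (hf2 : IntervalIntegrable (fun x => f x ^ 2) volume a b) :
    (∫ x in a..b, f x) ^ 2 ≤ (b - a) * ∫ x in a..b, f x ^ 2 := by
  rcases hab.eq_or_lt with rfl | hlt
  · simp
  set I := ∫ x in a..b, f x with hI
  set m := I / (b - a) with hm
  have hpos : 0 < b - a := sub_pos.2 hlt
  -- The integrand is the square of the deviation of `f` from its mean `m`.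
  have h0 : 0 ≤ ∫ x in a..b, (f x ^ 2 - 2 * m * f x + m ^ 2) :=
    intervalIntegral.integral_nonneg hab fun x _ => by nlinarith [sq_nonneg (f x - m)]
  rw [intervalIntegral.integral_add (hf2.sub (hf.const_mul _)) (by simp),
    intervalIntegral.integral_sub hf2 (hf.const_mul _), intervalIntegral.integral_const_mul,
    intervalIntegral.integral_const, smul_eq_mul, ← hI] at h0
  have hmI : m * (b - a) = I := by rw [hm]; field_simp
  have : 0 ≤ (b - a) * ((∫ x in a..b, f x ^ 2) - 2 * m * I + (b - a) * m ^ 2) :=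
    mul_nonneg hpos.le h0
  nlinarith [this]

/-! ### Scalar transport in the coordinates (entry time, position). -/

/-- The solution formula for the scalar transport equation with travel time `τ`, inflow `w`,
zero initial values and source `g`. -/
noncomputable def broad (τ w : ℝ → ℝ) (g : ℝ → ℝ → ℝ) (t x : ℝ) : ℝ :=
  (if τ x < t then w (t - τ x) else 0)
    + ∫ y in (0 : ℝ)..x, if τ x - τ y < t then g (t - (τ x - τ y)) y else 0

/-- The space-time rectangle measure on `(0, T) × (0, L)`. -/
noncomputable abbrev rectMeasure (T L : ℝ) : Measure (ℝ × ℝ) :=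
  (volume.restrict (Ioo 0 T)).prod (volume.restrict (Ioo 0 L))

/-- The set `(0, T) × (0, L)`. -/
abbrev rect (T L : ℝ) : Set (ℝ × ℝ) := Ioo 0 T ×ˢ Ioo 0 L

theorem rectMeasure_eq (T L : ℝ) : rectMeasure T L = (volume.prod volume).restrict (rect T L) :=
  Measure.prod_restrict _ _

theorem measurableSet_rect (T L : ℝ) : MeasurableSet (rect T L) :=
  measurableSet_Ioo.prod measurableSet_Ioo

/-- The passage from (entry time, position) to (time, position). -/
noncomputable def shear (τ : ℝ → ℝ) (p : ℝ × ℝ) : ℝ × ℝ := (p.1 + τ p.2, p.2)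

/-- At each fixed position the map is a translation in time. The swaps put the position first, as a
skew product requires. -/
theorem measurePreserving_shear {τ : ℝ → ℝ} (hτ : Measurable τ) :
    MeasurePreserving (shear τ) (volume.prod volume) (volume.prod volume) := by
  have h1 : MeasurePreserving (fun p : ℝ × ℝ => (p.1, p.2 + τ p.1)) (volume.prod volume)
      (volume.prod volume) :=
    MeasurePreserving.skew_product (g := fun a c => c + τ a) (MeasurePreserving.id volume)
      (by simp only [Function.uncurry_def]; fun_prop)
      (ae_of_all _ fun a => (measurePreserving_add_right volume (τ a)).map_eq)
  exact Measure.measurePreserving_swap.comp (h1.comp Measure.measurePreserving_swap)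

/-- A function on the rectangle, extended by zero, in the coordinates (entry time, position). -/
noncomputable def entry (T L : ℝ) (τ : ℝ → ℝ) (h : ℝ → ℝ → ℝ) (s y : ℝ) : ℝ :=
  (rect T L).indicator (Function.uncurry h) (shear τ (s, y))

section entry
variable {T L : ℝ} {τ : ℝ → ℝ} {h : ℝ → ℝ → ℝ}

theorem entry_eq (s y : ℝ) : entry T L τ h s y =
    if (0 < s + τ y ∧ s + τ y < T) ∧ 0 < y ∧ y < L then h (s + τ y) y else 0 := by
  simp [entry, indicator, shear, Function.uncurry]

theorem integrable_entry (hτ : Measurable τ)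
    (hh : Integrable (Function.uncurry h) (rectMeasure T L)) :
    Integrable (Function.uncurry (entry T L τ h)) (volume.prod volume) := by
  rw [rectMeasure_eq] at hh
  exact (measurePreserving_shear hτ).integrable_comp_of_integrable
    ((integrable_indicator_iff (measurableSet_rect T L)).2 hh)

theorem integral_entry (hτ : Measurable τ)
    (hh : Integrable (Function.uncurry h) (rectMeasure T L)) :
    ∫ p, Function.uncurry (entry T L τ h) p ∂(volume.prod volume)
      = ∫ p, Function.uncurry h p ∂(rectMeasure T L) := by
  rw [rectMeasure_eq] at hh ⊢
  rw [← integral_indicator (measurableSet_rect T L)]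
  have hm : AEStronglyMeasurable ((rect T L).indicator (Function.uncurry h))
      (volume.prod volume) :=
    ((integrable_indicator_iff (measurableSet_rect T L)).2 hh).1
  have := (measurePreserving_shear hτ).map_eq
  conv_rhs => rw [← this]
  rw [integral_map (measurePreserving_shear hτ).measurable.aemeasurable (by rwa [this])]
  rfl

/-- Preimages of null sets under the shear are null, and Fubini slices them by entry time: what
holds almost everywhere on the rectangle holds along almost every characteristic. -/
theorem entry_ae (hτ : Measurable τ) {P : ℝ → ℝ → Prop}
    (hP : ∀ᵐ p : ℝ × ℝ ∂(rectMeasure T L), P p.1 p.2) :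
    ∀ᵐ s : ℝ, ∀ᵐ y : ℝ, (0 < s + τ y ∧ s + τ y < T) ∧ 0 < y ∧ y < L → P (s + τ y) y := by
  rw [rectMeasure_eq, ae_restrict_iff' (measurableSet_rect T L)] at hP
  have h1 := (measurePreserving_shear hτ).quasiMeasurePreserving.ae hP
  have h2 := Measure.ae_ae_of_ae_prod h1
  filter_upwards [h2] with s hs
  filter_upwards [hs] with y hy hh
  exact hy (by simpa [shear] using hh)

end entry

/-- The value along the characteristic that enters at time `s`, at the position `x`. -/
noncomputable def alongEntry (T L : ℝ) (τ w : ℝ → ℝ) (g : ℝ → ℝ → ℝ) (s x : ℝ) : ℝ :=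
  (Ioo 0 T).indicator w s + ∫ y in (0 : ℝ)..x, entry T L τ g s y

theorem entry_sq {T L : ℝ} {τ : ℝ → ℝ} {g : ℝ → ℝ → ℝ} (s y : ℝ) :
    entry T L τ (fun t y => g t y ^ 2) s y = entry T L τ g s y ^ 2 := by
  rw [entry_eq, entry_eq]
  split_ifs <;> simp

theorem prod_restrict_right (A : Set ℝ) :
    (volume : Measure ℝ).prod ((volume : Measure ℝ).restrict A)
      = (volume.prod volume).restrict (univ ×ˢ A) := by
  rw [← Measure.prod_restrict, Measure.restrict_univ]

theorem integrable_setIntegral_right {f : ℝ → ℝ → ℝ}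
    (hf : Integrable (Function.uncurry f) (volume.prod volume)) (A : Set ℝ) :
    Integrable (fun s => ∫ y in A, f s y) := by
  have h : Integrable (Function.uncurry f) (volume.prod (volume.restrict A)) := by
    rw [prod_restrict_right]; exact hf.restrict
  exact h.integral_prod_left

/-- A travel time on `[0, L]`. -/
structure IsTravelTime (L : ℝ) (τ : ℝ → ℝ) : Prop where
  continuous : Continuous τ
  monotoneOn : MonotoneOn τ (Icc 0 L)
  zero : τ 0 = 0

namespace IsTravelTime
variable {T L : ℝ} {τ w : ℝ → ℝ} {g : ℝ → ℝ → ℝ}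

theorem nonneg (hτ : IsTravelTime L τ) {x : ℝ} (hx : x ∈ Icc 0 L) : 0 ≤ τ x := by
  rw [← hτ.zero]
  exact hτ.monotoneOn ⟨le_rfl, hx.1.trans hx.2⟩ hx hx.1

/-- Extending the data by zero outside the rectangle is harmless: the formula at a time before `T`
uses earlier data only, nonpositive times contribute nothing on either side, and the excluded
endpoint `y = L` is a null set. -/
theorem broad_eq (hτ : IsTravelTime L τ) {t x : ℝ} (hx : x ∈ Icc 0 L) (ht : t < T) :
    broad τ w g t x = alongEntry T L τ w g (t - τ x) x := by
  have h0 := hτ.nonneg hx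
  unfold broad alongEntry
  congr 1
  · by_cases h : τ x < t
    · rw [if_pos h, indicator_of_mem]
      exact ⟨by linarith, by linarith⟩
    · rw [if_neg h, indicator_of_notMem]
      exact fun h' => h (by linarith [h'.1])
  · apply intervalIntegral.integral_congr_ae
    have hne : ∀ᵐ y : ℝ, y ≠ L := by simp [ae_iff, measure_singleton]
    filter_upwards [hne] with y hyL hy
    rw [uIoc_of_le hx.1] at hy
    have hyx : τ y ≤ τ x := hτ.monotoneOn ⟨hy.1.le, hy.2.trans hx.2⟩ hx hy.2
    rw [entry_eq]
    have e : t - τ x + τ y = t - (τ x - τ y) := by ring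
    rw [e]
    refine if_congr ⟨fun h => ⟨⟨by linarith, by linarith⟩, hy.1, ?_⟩, fun h => by linarith [h.1.1]⟩
      rfl rfl
    exact lt_of_le_of_ne (hy.2.trans hx.2) hyL

theorem entry_eq_zero (_hτ : IsTravelTime L τ) {s x : ℝ} (h : s + τ x ≤ 0) :
    entry T L τ g s x = 0 := by
  rw [entry_eq, if_neg]
  intro h'
  linarith [h'.1.1]

/-- By monotonicity of `τ`, a characteristic that has not reached positive time at `x` has met
neither inflow nor source. This is where the zero initial values enter. -/
theorem alongEntry_eq_zero (hτ : IsTravelTime L τ) {s x : ℝ} (hx : x ∈ Icc 0 L)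
    (h : s + τ x ≤ 0) : alongEntry T L τ w g s x = 0 := by
  unfold alongEntry
  rw [indicator_of_notMem (fun h' => by linarith [h'.1, hτ.nonneg hx]), zero_add]
  rw [intervalIntegral.integral_of_le hx.1]
  apply setIntegral_eq_zero_of_forall_eq_zero
  intro y hy
  have : τ y ≤ τ x := hτ.monotoneOn ⟨hy.1.le, hy.2.trans hx.2⟩ hx hy.2
  exact hτ.entry_eq_zero (by linarith)

theorem integrable_alongEntry (hτ : IsTravelTime L τ) {x : ℝ} (hx : x ∈ Icc 0 L)
    (hw : IntegrableOn w (Ioo 0 T)) (hg : Integrable (Function.uncurry g) (rectMeasure T L)) :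
    Integrable (fun s => alongEntry T L τ w g s x) := by
  unfold alongEntry
  simp_rw [intervalIntegral.integral_of_le hx.1]
  exact (hw.integrable_indicator measurableSet_Ioo).add
    (integrable_setIntegral_right (integrable_entry hτ.continuous.measurable hg) _)

/-- Cauchy–Schwarz in the position dominates the square by the squares of the inflow and of the
source, both integrable in the entry time. -/
theorem integrable_sq_alongEntry (hτ : IsTravelTime L τ) {x : ℝ} (hx : x ∈ Icc 0 L)
    (hw : MemLp w 2 (volume.restrict (Ioo 0 T)))
    (hg : MemLp (Function.uncurry g) 2 (rectMeasure T L)) :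
    Integrable (fun s => alongEntry T L τ w g s x ^ 2) := by
  have hw1 : IntegrableOn w (Ioo 0 T) := hw.integrable one_le_two
  have hg1 := hg.integrable one_le_two
  have hwi : Integrable (fun s => (Ioo 0 T).indicator w s ^ 2) := by
    have h : IntegrableOn (fun s => w s ^ 2) (Ioo 0 T) := hw.integrable_sq
    convert! h.integrable_indicator measurableSet_Ioo using 2 with s
    by_cases hs : s ∈ Ioo 0 T <;> simp [indicator, hs]
  have hg2 : Integrable (Function.uncurry fun s y => entry T L τ g s y ^ 2)
      (volume.prod volume) := by
    have := integrable_entry (h := fun t y => g t y ^ 2) hτ.continuous.measurable hg.integrable_sq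
    convert! this using 3 with s
    funext y
    exact (entry_sq _ _).symm
  have hgE := integrable_entry hτ.continuous.measurable hg1
  have hdom : Integrable (fun s => 2 * (Ioo 0 T).indicator w s ^ 2
      + 2 * (L * ∫ y in Ioc 0 x, entry T L τ g s y ^ 2)) :=
    (hwi.const_mul 2).add (((integrable_setIntegral_right hg2 _).const_mul L).const_mul 2)
  refine hdom.mono' ((hτ.integrable_alongEntry hx hw1 hg1).aestronglyMeasurable.pow 2) ?_
  filter_upwards [hg2.prod_right_ae, hgE.prod_right_ae] with s h2 h1
  rw [Real.norm_eq_abs, abs_of_nonneg (sq_nonneg _)]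
  have hcs := sq_intervalIntegral_le (f := fun y => entry T L τ g s y) hx.1
    h1.intervalIntegrable h2.intervalIntegrable
  have hnn : 0 ≤ ∫ y in (0:ℝ)..x, entry T L τ g s y ^ 2 :=
    intervalIntegral.integral_nonneg hx.1 fun _ _ => sq_nonneg _
  rw [intervalIntegral.integral_of_le hx.1 (f := fun y => entry T L τ g s y ^ 2)] at hcs hnn
  unfold alongEntry
  have h3 : (x - 0) * ∫ y in Ioc 0 x, entry T L τ g s y ^ 2
      ≤ L * ∫ y in Ioc 0 x, entry T L τ g s y ^ 2 :=
    mul_le_mul_of_nonneg_right (by linarith [hx.2]) hnn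
  nlinarith [sq_nonneg ((Ioo 0 T).indicator w s - ∫ y in (0:ℝ)..x, entry T L τ g s y)]

/-- The outflow of a square integrable solution is square integrable. -/
theorem integrable_sq_broad (hτ : IsTravelTime L τ) {x : ℝ} (hx : x ∈ Icc 0 L)
    (hw : MemLp w 2 (volume.restrict (Ioo 0 T)))
    (hg : MemLp (Function.uncurry g) 2 (rectMeasure T L)) :
    MemLp (fun t => broad τ w g t x) 2 (volume.restrict (Ioo 0 T)) := by
  have e : ∀ t ∈ Ioo 0 T, alongEntry T L τ w g (t - τ x) x = broad τ w g t x :=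
    fun t ht => (hτ.broad_eq hx ht.2).symm
  have h1 := (hτ.integrable_alongEntry hx (hw.integrable one_le_two)
    (hg.integrable one_le_two)).comp_sub_right (τ x)
  have h2 := (hτ.integrable_sq_alongEntry hx hw hg).comp_sub_right (τ x)
  have h3 : MemLp (fun t => alongEntry T L τ w g (t - τ x) x) 2 volume :=
    (memLp_two_iff_integrable_sq h1.aestronglyMeasurable).2 h2
  exact (h3.restrict _).ae_eq ((ae_restrict_iff' measurableSet_Ioo).2 (ae_of_all _ e))

/-- The position at which the characteristic entering at time `s` is at time `T`. -/
theorem exists_exit (hτ : IsTravelTime L τ) (hL : 0 ≤ L) (s : ℝ) :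
    ∃ b ∈ Icc 0 L, (∀ x ∈ Ico 0 b, s + τ x < T) ∧ (∀ x ∈ Ioo b L, T ≤ s + τ x) ∧
      (s + τ L < T → b = L) := by
  by_cases h : s + τ L < T
  · refine ⟨L, ⟨hL, le_rfl⟩, fun x hx => ?_, fun x hx => absurd (hx.1.trans hx.2) (lt_irrefl _),
      fun _ => rfl⟩
    linarith [hτ.monotoneOn ⟨hx.1, hx.2.le⟩ (right_mem_Icc.2 hL) hx.2.le]
  -- The exit position is the smallest position that is not reached before `T`.
  · set A : Set ℝ := Icc 0 L ∩ {x | T ≤ s + τ x} with hA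
    have hAc : IsClosed A :=
      isClosed_Icc.inter (isClosed_le continuous_const (continuous_const.add hτ.continuous))
    have hAne : A.Nonempty := ⟨L, right_mem_Icc.2 hL, not_lt.1 h⟩
    have hbdd : BddBelow A := ⟨0, fun x hx => hx.1.1⟩
    have hmem : sInf A ∈ A := hAc.csInf_mem hAne hbdd
    refine ⟨sInf A, hmem.1, fun x hx => ?_, fun x hx => ?_, fun h' => absurd h' h⟩
    · by_contra hc
      have : x ∈ A := ⟨⟨hx.1, hx.2.le.trans hmem.1.2⟩, not_lt.1 hc⟩
      exact absurd (csInf_le hbdd this) (not_le.2 hx.2)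
    · have hm : T ≤ s + τ (sInf A) := hmem.2
      linarith [hτ.monotoneOn hmem.1 ⟨hmem.1.1.trans hx.1.le, hx.2.le⟩ hx.1.le]

end IsTravelTime

/-! ### Energy inequality and time integrals for the scalar equation. -/

theorem integrable_mul_of_continuousOn {T L : ℝ} {a : ℝ → ℝ} {h : ℝ → ℝ → ℝ}
    (ha : ContinuousOn a (Icc 0 L)) (hh : Integrable (Function.uncurry h) (rectMeasure T L)) :
    Integrable (Function.uncurry fun t x => a x * h t x) (rectMeasure T L) := by
  obtain ⟨C, hC⟩ := isCompact_Icc.exists_bound_of_continuousOn ha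
  have hm : AEStronglyMeasurable a (volume.restrict (Ioo 0 L)) :=
    (ha.mono Ioo_subset_Icc_self).aestronglyMeasurable measurableSet_Ioo
  have hm2 : AEStronglyMeasurable (fun p : ℝ × ℝ => a p.2) (rectMeasure T L) := hm.comp_snd
  refine Integrable.bdd_mul (c := C) hh hm2 ?_
  rw [rectMeasure_eq, ae_restrict_iff' (measurableSet_rect T L)]
  exact ae_of_all _ fun p hp => hC _ (Ioo_subset_Icc_self hp.2)

/-- The weighted energy inequality for the scalar transport equation. -/
theorem IsTravelTime.energy {T L : ℝ} {τ w a : ℝ → ℝ} {g z : ℝ → ℝ → ℝ}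
    (hτ : IsTravelTime L τ) (hL : 0 ≤ L)
    (ha : ContDiffOn ℝ 1 a (Icc 0 L)) (ha0 : ∀ x ∈ Icc 0 L, 0 ≤ a x)
    (ha' : ContinuousOn (derivWithin a (Icc 0 L)) (Icc 0 L))
    (hw : MemLp w 2 (volume.restrict (Ioo 0 T)))
    (hg : MemLp (Function.uncurry g) 2 (rectMeasure T L))
    (hz : MemLp (Function.uncurry z) 2 (rectMeasure T L))
    (hzb : ∀ᵐ p : ℝ × ℝ ∂(rectMeasure T L), z p.1 p.2 = broad τ w g p.1 p.2) :
    Integrable (Function.uncurry fun t x =>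
        derivWithin a (Icc 0 L) x * z t x ^ 2 + 2 * a x * z t x * g t x) (rectMeasure T L) ∧
    a L * ∫ t in Ioo 0 T, broad τ w g t L ^ 2 ≤ a 0 * (∫ t in Ioo 0 T, w t ^ 2)
      + ∫ p, (Function.uncurry fun t x =>
        derivWithin a (Icc 0 L) x * z t x ^ 2 + 2 * a x * z t x * g t x) p ∂(rectMeasure T L) := by
  set h : ℝ → ℝ → ℝ := fun t x =>
    derivWithin a (Icc 0 L) x * z t x ^ 2 + 2 * a x * z t x * g t x with hh
  have hint : Integrable (Function.uncurry h) (rectMeasure T L) := by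
    have h1 := integrable_mul_of_continuousOn (h := fun t x => z t x ^ 2) ha' hz.integrable_sq
    have h2 := integrable_mul_of_continuousOn (h := fun t x => z t x * g t x)
      (a := fun x => 2 * a x) (continuousOn_const.mul ha.continuousOn) (hz.integrable_mul hg)
    refine (h1.add h2).congr (ae_of_all _ fun p => ?_)
    simp only [Pi.add_apply, Function.uncurry, hh]
    ring
  refine ⟨hint, ?_⟩
  have hLm : L ∈ Icc 0 L := right_mem_Icc.2 hL
  set Z := alongEntry T L τ w g with hZ
  set wb := (Ioo 0 T).indicator w with hwb
  have hwi : IntegrableOn (fun s => w s ^ 2) (Ioo 0 T) := hw.integrable_sq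
  have hwbsq : (fun s => wb s ^ 2) = (Ioo 0 T).indicator (fun s => w s ^ 2) := by
    funext s
    by_cases hs : s ∈ Ioo 0 T <;> simp [hwb, indicator, hs]
  have hZL := hτ.integrable_sq_alongEntry hLm hw hg
  -- Only the characteristics that reach `L` before `T` are kept; the terminal energy of the others
  -- is nonnegative and is dropped.
  set Φ : ℝ → ℝ := (Iio (T - τ L)).indicator (fun s => Z s L ^ 2) with hΦ
  have hΦi : Integrable Φ := hZL.indicator measurableSet_Iio
  have hΦ0 : ∀ s, 0 ≤ Φ s := fun s => indicator_nonneg (fun _ _ => sq_nonneg _) s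
  have hwbi : Integrable (fun s => wb s ^ 2) := by
    rw [hwbsq]; exact hwi.integrable_indicator measurableSet_Ioo
  have hgE := integrable_entry hτ.continuous.measurable (hg.integrable one_le_two)
  have hhE := integrable_entry hτ.continuous.measurable hint
  -- The energy identity is applied on each characteristic up to the position `b` at which it leaves
  -- either the domain or the time interval.
  have pointwise : ∀ᵐ s : ℝ, a L * Φ s - a 0 * wb s ^ 2 ≤ ∫ y, entry T L τ h s y := by
    filter_upwards [hgE.prod_right_ae, entry_ae
      (P := fun t x => z t x = broad τ w g t x) hτ.continuous.measurable hzb] with s hgs hzs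
    obtain ⟨b, hb, hb1, hb2, hb3⟩ := hτ.exists_exit (T := T) hL s
    have hgs' : Integrable (fun y => entry T L τ g s y) := hgs
    have key := integral_weighted_sq (c := wb s) hb.1 hb.2 ha
      (hgs'.intervalIntegrable (a := 0) (b := b))
    have e1 : ∫ y, entry T L τ h s y = a b * Z s b ^ 2 - a 0 * wb s ^ 2 := by
      rw [show Z s b = wb s + ∫ y in (0:ℝ)..b, entry T L τ g s y from rfl, ← key]
      rw [intervalIntegral.integral_of_le hb.1]
      rw [← setIntegral_eq_integral_of_forall_compl_eq_zero (s := Ioc 0 b)]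
      · apply setIntegral_congr_ae measurableSet_Ioc
        have hne : ∀ᵐ y : ℝ, y ≠ b := by simp [ae_iff, measure_singleton]
        filter_upwards [hzs, hne] with y hy hyb hym
        have hylt : y < b := lt_of_le_of_ne hym.2 hyb
        have hyI : y ∈ Icc 0 L := ⟨hym.1.le, hym.2.trans hb.2⟩
        have hyT : s + τ y < T := hb1 y ⟨hym.1.le, hylt⟩
        by_cases hpos : 0 < s + τ y
        · have hcond : (0 < s + τ y ∧ s + τ y < T) ∧ 0 < y ∧ y < L :=
            ⟨⟨hpos, hyT⟩, hym.1, hylt.trans_le hb.2⟩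
          rw [entry_eq, entry_eq, if_pos hcond, if_pos hcond]
          have hzy : z (s + τ y) y = Z s y := by
            rw [hy hcond, hτ.broad_eq hyI hyT, add_sub_cancel_right]
          simp only [hh]
          rw [hzy]
          rfl
        -- At nonpositive times the source and the accumulated value both vanish, so both integrands
        -- are zero.
        · have hle : s + τ y ≤ 0 := not_lt.1 hpos
          have h0 : wb s + ∫ y in (0:ℝ)..y, entry T L τ g s y = 0 :=
            hτ.alongEntry_eq_zero hyI hle
          rw [hτ.entry_eq_zero hle, h0]
          ring
      · intro y hy
        rw [entry_eq, if_neg]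
        rintro ⟨⟨_, h2⟩, h3, h4⟩
        have : b < y := by
          by_contra hc
          exact hy ⟨h3, not_lt.1 hc⟩
        linarith [hb2 y ⟨this, h4⟩]
    rw [e1]
    have : a L * Φ s ≤ a b * Z s b ^ 2 := by
      by_cases hs : s + τ L < T
      · rw [hb3 hs, hΦ, indicator_of_mem (show s ∈ Iio (T - τ L) from by
          simp only [mem_Iio]; linarith)]
      · rw [hΦ, indicator_of_notMem (show s ∉ Iio (T - τ L) from by
          simp only [mem_Iio]; intro h'; exact hs (by linarith)), mul_zero]
        exact mul_nonneg (ha0 b hb) (sq_nonneg _)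
    linarith
  have hmono := integral_mono_ae ((hΦi.const_mul (a L)).sub (hwbi.const_mul (a 0)))
    hhE.integral_prod_left pointwise
  have e2 : ∫ s, ∫ y, entry T L τ h s y
      = ∫ p, Function.uncurry h p ∂(rectMeasure T L) := by
    rw [← integral_entry hτ.continuous.measurable hint, integral_prod _ hhE]
    rfl
  have e3 : ∫ s, wb s ^ 2 = ∫ t in Ioo 0 T, w t ^ 2 := by
    rw [hwbsq, integral_indicator measurableSet_Ioo]
  have e4 : ∫ t in Ioo 0 T, broad τ w g t L ^ 2 ≤ ∫ s, Φ s := by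
    rw [← integral_sub_right_eq_self Φ (τ L)]
    calc ∫ t in Ioo 0 T, broad τ w g t L ^ 2 = ∫ t in Ioo 0 T, Φ (t - τ L) := by
          apply setIntegral_congr_fun measurableSet_Ioo
          intro t ht
          simp only [hΦ]
          rw [indicator_of_mem (show t - τ L ∈ Iio (T - τ L) from by
            simp only [mem_Iio]; linarith [ht.2]), hτ.broad_eq hLm ht.2]
      _ ≤ ∫ t, Φ (t - τ L) :=
          setIntegral_le_integral (hΦi.comp_sub_right (τ L)) (ae_of_all _ fun t => hΦ0 _)
  rw [← e2, ← e3]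
  have e5 := integral_sub (hΦi.const_mul (a L)) (hwbi.const_mul (a 0))
  have e6 : ∫ s, (a L * Φ s - a 0 * wb s ^ 2) = a L * (∫ s, Φ s) - a 0 * ∫ s, wb s ^ 2 := by
    rw [e5, integral_const_mul, integral_const_mul]
  have e7 : ∫ s, (a L * Φ s - a 0 * wb s ^ 2) ≤ ∫ s, ∫ y, entry T L τ h s y := hmono
  rw [e6] at e7
  have := mul_le_mul_of_nonneg_left e4 (ha0 L hLm)
  linarith

/-- Integrating the solution formula in time reproduces the stationary formula for the time
integrals, up to what is still travelling through the domain at the end. -/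
theorem IsTravelTime.abs_integral_broad_sub_le {T L : ℝ} {τ w : ℝ → ℝ} {g : ℝ → ℝ → ℝ}
    (hτ : IsTravelTime L τ) (hL : 0 ≤ L) {x : ℝ} (hx : x ∈ Icc 0 L)
    (hw : IntegrableOn w (Ioo 0 T)) (hg : Integrable (Function.uncurry g) (rectMeasure T L)) :
    |(∫ t in Ioo 0 T, broad τ w g t x)
        - ((∫ t in Ioo 0 T, w t) + ∫ y in (0 : ℝ)..x, ∫ t in Ioo 0 T, g t y)|
      ≤ (∫ t in Ioo 0 T, (Ici (T - τ L)).indicator (fun t => |w t|) t)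
        + ∫ p, (Function.uncurry fun t y => (Ici (T - τ L)).indicator (fun t => |g t y|) t) p
          ∂(rectMeasure T L) := by
  have hτm := hτ.continuous.measurable
  have hLm : L ∈ Icc 0 L := right_mem_Icc.2 hL
  have hgE := integrable_entry hτm hg
  have hGx : Integrable fun s => ∫ y in Ioc 0 x, entry T L τ g s y :=
    integrable_setIntegral_right hgE _
  have hwb := hw.integrable_indicator (measurableSet_Ioo (a := (0 : ℝ)) (b := T))
  have hZ := hτ.integrable_alongEntry hx hw hg
  -- Time is replaced by entry time. Nonpositive times contribute nothing, so the entry times may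
  -- run over a half-line.
  have e1 : ∫ t in Ioo 0 T, broad τ w g t x
      = ∫ s in Iio (T - τ x), alongEntry T L τ w g s x := by
    have h1 : ∫ t in Ioo 0 T, broad τ w g t x
        = ∫ t in Ioo 0 T, alongEntry T L τ w g (t - τ x) x :=
      setIntegral_congr_fun measurableSet_Ioo fun t ht => hτ.broad_eq hx ht.2
    have h2 : ∫ t in Ioo 0 T, alongEntry T L τ w g (t - τ x) x
        = ∫ t in Iio T, alongEntry T L τ w g (t - τ x) x := by
      symm
      apply setIntegral_eq_of_subset_of_forall_sdiff_eq_zero measurableSet_Iio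
        (fun t ht => ht.2)
      intro t ht
      apply hτ.alongEntry_eq_zero hx
      have : ¬ 0 < t := fun h => ht.2 ⟨h, ht.1⟩
      linarith
    rw [h1, h2, ← integral_indicator measurableSet_Iio, ← integral_indicator measurableSet_Iio,
      ← integral_sub_right_eq_self
        ((Iio (T - τ x)).indicator fun s => alongEntry T L τ w g s x) (τ x)]
    congr 1
    funext t
    have : t ∈ Iio T ↔ t - τ x ∈ Iio (T - τ x) := by simp
    by_cases ht : t ∈ Iio T
    · rw [indicator_of_mem ht, indicator_of_mem (this.1 ht)]
    · rw [indicator_of_notMem ht, indicator_of_notMem (fun h => ht (this.2 h))]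
  -- Over all entry times the formula integrates exactly to the stationary one, by Fubini and
  -- translation in time.
  have e2 : ∫ s, alongEntry T L τ w g s x
      = (∫ t in Ioo 0 T, w t) + ∫ y in (0 : ℝ)..x, ∫ t in Ioo 0 T, g t y := by
    unfold alongEntry
    simp_rw [intervalIntegral.integral_of_le hx.1]
    rw [integral_add hwb hGx, integral_indicator measurableSet_Ioo]
    congr 1
    have hI : Integrable (Function.uncurry (entry T L τ g))
        (volume.prod (volume.restrict (Ioc 0 x))) := by
      rw [prod_restrict_right]; exact hgE.restrict
    rw [integral_integral_swap hI]
    apply setIntegral_congr_ae measurableSet_Ioc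
    have hne : ∀ᵐ y : ℝ, y ≠ L := by simp [ae_iff, measure_singleton]
    filter_upwards [hne] with y hyL hy
    have hy' : 0 < y ∧ y < L := ⟨hy.1, lt_of_le_of_ne (hy.2.trans hx.2) hyL⟩
    rw [← integral_indicator measurableSet_Ioo, ← integral_add_right_eq_self
      ((Ioo 0 T).indicator fun t => g t y) (τ y)]
    congr 1
    funext s
    rw [entry_eq]
    by_cases hs : s + τ y ∈ Ioo 0 T
    · rw [indicator_of_mem hs, if_pos ⟨hs, hy'⟩]
    · rw [indicator_of_notMem hs, if_neg fun h => hs h.1]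
  -- The defect is the part with entry times at least `T - τ x`; these characteristics only carry
  -- data from times at least `T - τ L`.
  have e3 := integral_add_compl (measurableSet_Iio (a := T - τ x)) hZ
  rw [compl_Iio] at e3
  rw [e1, ← e2, ← e3, sub_add_cancel_left, abs_neg]
  have hk : Integrable (Function.uncurry fun t y =>
      (Ici (T - τ L)).indicator (fun t => |g t y|) t) (rectMeasure T L) := by
    have := hg.abs.indicator (measurableSet_Ici.prod MeasurableSet.univ :
      MeasurableSet (Ici (T - τ L) ×ˢ (univ : Set ℝ)))
    refine this.congr (ae_of_all _ fun p => ?_)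
    by_cases hp : T - τ L ≤ p.1 <;> simp [indicator, Function.uncurry, hp]
  have hkE := integrable_entry hτm hk
  rw [← integral_entry hτm hk, integral_prod _ hkE]
  have hwI : IntegrableOn ((Ici (T - τ L)).indicator fun t => |w t|) (Ioo 0 T) :=
    Integrable.indicator hw.abs measurableSet_Ici
  have hwI' := hwI.integrable_indicator (measurableSet_Ioo (a := (0 : ℝ)) (b := T))
  rw [← integral_indicator measurableSet_Ioo, ← integral_add hwI' hkE.integral_prod_left]
  refine (abs_integral_le_integral_abs).trans ?_
  rw [← integral_indicator measurableSet_Ici]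
  apply integral_mono_ae (hZ.abs.indicator measurableSet_Ici) (hwI'.add hkE.integral_prod_left)
  filter_upwards [hgE.prod_right_ae, hkE.prod_right_ae] with s hs hks
  have hks' : Integrable (fun y => entry T L τ
    (fun t y => (Ici (T - τ L)).indicator (fun t => |g t y|) t) s y) := hks
  have hs' : Integrable (fun y => entry T L τ g s y) := hs
  have hknn : ∀ y, 0 ≤ entry T L τ
      (fun t y => (Ici (T - τ L)).indicator (fun t => |g t y|) t) s y := by
    intro y
    rw [entry_eq]
    split_ifs
    · exact indicator_nonneg (fun _ _ => abs_nonneg _) _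
    · exact le_rfl
  have hwnn : 0 ≤ (Ioo 0 T).indicator ((Ici (T - τ L)).indicator fun t => |w t|) s :=
    indicator_nonneg (fun _ _ => indicator_nonneg (fun _ _ => abs_nonneg _) _) _
  simp only [Pi.add_apply, Function.uncurry_apply_pair]
  by_cases hsI : s ∈ Ici (T - τ x)
  swap
  · rw [indicator_of_notMem hsI]
    exact add_nonneg hwnn (integral_nonneg hknn)
  rw [indicator_of_mem hsI]
  have hxL : τ x ≤ τ L := hτ.monotoneOn hx hLm hx.2
  have hsI' : T - τ x ≤ s := hsI
  unfold alongEntry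
  refine (abs_add_le _ _).trans (add_le_add ?_ ?_)
  · by_cases h : s ∈ Ioo 0 T
    · rw [indicator_of_mem h, indicator_of_mem h, indicator_of_mem]
      simp only [mem_Ici]; linarith
    · rw [indicator_of_notMem h, indicator_of_notMem h, abs_zero]
  · rw [intervalIntegral.integral_of_le hx.1]
    refine (abs_integral_le_integral_abs).trans ?_
    refine le_trans ?_ (setIntegral_le_integral (s := Ioc 0 x) hks' (ae_of_all _ hknn))
    apply setIntegral_mono_on hs'.abs.integrableOn hks'.integrableOn measurableSet_Ioc
    intro y hy
    have hy0 := hτ.nonneg (x := y) ⟨hy.1.le, hy.2.trans hx.2⟩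
    rw [entry_eq, entry_eq]
    split_ifs with h
    · rw [indicator_of_mem]
      simp only [mem_Ici]; linarith
    · simp

/-! ### Dissipativity as a pointwise inequality between quadratic forms. -/

namespace HyperbolicSystem
variable (S : HyperbolicSystem)

/-- The coupling term in the equation of the plus-component along its characteristics. -/
noncomputable def couplePlus (x a b : ℝ) : ℝ :=
  S.η₀ * (S.M x 0 0 * a + S.M x 0 1 * b) / S.dPlus x

/-- The coupling term in the equation of the minus-component along its characteristics. -/
noncomputable def coupleMinus (x a b : ℝ) : ℝ :=
  S.η₀ * (S.M x 1 0 * a + S.M x 1 1 * b) / |S.dMinus x|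

theorem L_nonneg : 0 ≤ S.L := S.L_pos.le

theorem uniqueDiffOn : UniqueDiffOn ℝ (Icc 0 S.L) := uniqueDiffOn_Icc S.L_pos

/-- Both sides are homogeneous of degree two, so the normalised hypothesis extends to all vectors by
scaling. Multiplying the coupling by weight and speed cancels the division by the speed, and `|η₀| =
-η₀` and `|d₋| = -d₋` settle the signs. -/
theorem forward_quadratic {μp μm νa x : ℝ}
    (hx : x ∈ Icc 0 S.L)
    (h : ∀ v : Fin 2 → ℝ, v ⬝ᵥ (expWeight μp μm x *ᵥ v) = 1 →
      v ⬝ᵥ ((S.matrixDeriv (fun y => expWeight μp μm y * S.D y) x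
        - |S.η₀| • (expWeight μp μm x * S.M x + (S.M x)ᵀ * expWeight μp μm x)) *ᵥ v) ≤ νa)
    (a b : ℝ) :
    derivWithin (fun y => Real.exp (-μp * y) * S.dPlus y) (Icc 0 S.L) x * a ^ 2
      + 2 * (Real.exp (-μp * x) * S.dPlus x) * a * S.couplePlus x a b
      + (-derivWithin (fun y => Real.exp (μm * y) * |S.dMinus y|) (Icc 0 S.L) x * b ^ 2
        + 2 * (Real.exp (μm * x) * |S.dMinus x|) * b * S.coupleMinus x a b)
      ≤ νa * (Real.exp (-μp * x) * a ^ 2 + Real.exp (μm * x) * b ^ 2) := by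
  set e1 := Real.exp (-μp * x) with he1
  set e2 := Real.exp (μm * x) with he2
  have he1p : 0 < e1 := Real.exp_pos _
  have he2p : 0 < e2 := Real.exp_pos _
  have hd1 := S.dPlus_pos x hx
  have hd2 := S.dMinus_neg x hx
  have hη : |S.η₀| = -S.η₀ := abs_of_nonpos S.η₀_nonpos
  have hm : derivWithin (fun y => Real.exp (μm * y) * |S.dMinus y|) (Icc 0 S.L) x
      = - derivWithin (fun y => Real.exp (μm * y) * S.dMinus y) (Icc 0 S.L) x := by
    rw [← derivWithin.fun_neg]
    apply derivWithin_congr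
    · intro y hy
      simp only [abs_of_neg (S.dMinus_neg y hy)]
      ring
    · simp only [abs_of_neg hd2]
      ring
  rw [hm]
  set p' := derivWithin (fun y => Real.exp (-μp * y) * S.dPlus y) (Icc 0 S.L) x with hp'
  set m' := derivWithin (fun y => Real.exp (μm * y) * S.dMinus y) (Icc 0 S.L) x with hm'
  have quad : ∀ v : Fin 2 → ℝ, v ⬝ᵥ ((S.matrixDeriv (fun y => expWeight μp μm y * S.D y) x
        - |S.η₀| • (expWeight μp μm x * S.M x + (S.M x)ᵀ * expWeight μp μm x)) *ᵥ v)
      = p' * v 0 ^ 2 + m' * v 1 ^ 2 - |S.η₀| * (2 * e1 * S.M x 0 0 * v 0 ^ 2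
        + 2 * (e1 * S.M x 0 1 + e2 * S.M x 1 0) * v 0 * v 1 + 2 * e2 * S.M x 1 1 * v 1 ^ 2) := by
    intro v
    have h00 : S.matrixDeriv (fun y => expWeight μp μm y * S.D y) x 0 0 = p' := by
      simp [matrixDeriv, expWeight, D, hp']
    have h11 : S.matrixDeriv (fun y => expWeight μp μm y * S.D y) x 1 1 = m' := by
      simp [matrixDeriv, expWeight, D, hm']
    have h01 : S.matrixDeriv (fun y => expWeight μp μm y * S.D y) x 0 1 = 0 := by
      simp [matrixDeriv, expWeight, D]
    have h10 : S.matrixDeriv (fun y => expWeight μp μm y * S.D y) x 1 0 = 0 := by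
      simp [matrixDeriv, expWeight, D]
    generalize S.matrixDeriv (fun y => expWeight μp μm y * S.D y) x = A at h00 h11 h01 h10 ⊢
    simp only [dotProduct, Matrix.mulVec, Fin.sum_univ_two, Matrix.sub_apply, Matrix.smul_apply,
      Matrix.add_apply, Matrix.mul_apply, Matrix.transpose_apply, h00, h01, h10, h11,
      expWeight, Matrix.diagonal_apply, smul_eq_mul]
    simp only [Matrix.cons_val_zero, Matrix.cons_val_one, if_true, zero_ne_one, one_ne_zero,
      if_false, ← he1, ← he2]
    ring
  have quadE : ∀ v : Fin 2 → ℝ, v ⬝ᵥ (expWeight μp μm x *ᵥ v)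
      = e1 * v 0 ^ 2 + e2 * v 1 ^ 2 := by
    intro v
    simp only [dotProduct, Matrix.mulVec, Fin.sum_univ_two, expWeight, Matrix.diagonal_apply]
    simp only [Matrix.cons_val_zero, Matrix.cons_val_one, if_true, zero_ne_one, one_ne_zero,
      if_false, ← he1, ← he2]
    ring
  have main : p' * a ^ 2 + m' * b ^ 2 - |S.η₀| * (2 * e1 * S.M x 0 0 * a ^ 2
        + 2 * (e1 * S.M x 0 1 + e2 * S.M x 1 0) * a * b + 2 * e2 * S.M x 1 1 * b ^ 2)
      ≤ νa * (e1 * a ^ 2 + e2 * b ^ 2) := by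
    set N := e1 * a ^ 2 + e2 * b ^ 2 with hN
    by_cases h0 : N = 0
    · have ha : a = 0 := by
        by_contra hne
        have : 0 < a ^ 2 := by positivity
        nlinarith [mul_pos he1p this, mul_nonneg he2p.le (sq_nonneg b)]
      have hb : b = 0 := by
        by_contra hne
        have : 0 < b ^ 2 := by positivity
        nlinarith [mul_pos he2p this, mul_nonneg he1p.le (sq_nonneg a)]
      rw [h0, ha, hb]
      simp
    · have hNp : 0 < N := lt_of_le_of_ne (by positivity) (Ne.symm h0)
      set k := (Real.sqrt N)⁻¹ with hk
      have hk2 : k ^ 2 = N⁻¹ := by rw [hk, inv_pow, Real.sq_sqrt hNp.le]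
      have h1 := h ![k * a, k * b] (by
        rw [quadE]
        simp only [Matrix.cons_val_zero, Matrix.cons_val_one]
        rw [show e1 * (k * a) ^ 2 + e2 * (k * b) ^ 2 = k ^ 2 * N by rw [hN]; ring, hk2]
        field_simp)
      rw [quad] at h1
      simp only [Matrix.cons_val_zero, Matrix.cons_val_one] at h1
      have h2 : p' * (k * a) ^ 2 + m' * (k * b) ^ 2 - |S.η₀| * (2 * e1 * S.M x 0 0 * (k * a) ^ 2
          + 2 * (e1 * S.M x 0 1 + e2 * S.M x 1 0) * (k * a) * (k * b)
          + 2 * e2 * S.M x 1 1 * (k * b) ^ 2)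
          = N⁻¹ * (p' * a ^ 2 + m' * b ^ 2 - |S.η₀| * (2 * e1 * S.M x 0 0 * a ^ 2
        + 2 * (e1 * S.M x 0 1 + e2 * S.M x 1 0) * a * b + 2 * e2 * S.M x 1 1 * b ^ 2)) := by
        rw [← hk2]; ring
      rw [h2] at h1
      have h3 := mul_le_mul_of_nonneg_left h1 hNp.le
      rwa [← mul_assoc, mul_inv_cancel₀ h0, one_mul, mul_comm N νa] at h3
  have c1 : S.dPlus x * S.couplePlus x a b = S.η₀ * (S.M x 0 0 * a + S.M x 0 1 * b) := by
    unfold couplePlus; field_simp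
  have c2 : |S.dMinus x| * S.coupleMinus x a b = S.η₀ * (S.M x 1 0 * a + S.M x 1 1 * b) := by
    have : |S.dMinus x| ≠ 0 := abs_ne_zero.2 hd2.ne
    unfold coupleMinus; field_simp
  rw [hη] at main
  calc _ = p' * a ^ 2 + 2 * e1 * a * (S.dPlus x * S.couplePlus x a b) + (m' * b ^ 2
        + 2 * e2 * b * (|S.dMinus x| * S.coupleMinus x a b)) := by ring
    _ ≤ _ := by rw [c1, c2]; linarith

/-- The dissipativity condition in the form used by the energy estimates: with suitable weights,
the production of energy is negative definite up to the contribution of the sources. -/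
theorem exists_weights (hS : S.ForwardDissipative) : ∃ p m : ℝ → ℝ,
    ContDiffOn ℝ 1 p (Icc 0 S.L) ∧ ContDiffOn ℝ 1 m (Icc 0 S.L) ∧
    (∀ x ∈ Icc 0 S.L, 0 < p x) ∧ (∀ x ∈ Icc 0 S.L, 0 < m x) ∧
    ∃ c > 0, ∃ C > 0, ∀ x ∈ Icc 0 S.L, ∀ a b f g : ℝ,
      (derivWithin p (Icc 0 S.L) x * a ^ 2 + 2 * p x * a * (S.couplePlus x a b + f))
        + (-derivWithin m (Icc 0 S.L) x * b ^ 2 + 2 * m x * b * (S.coupleMinus x a b + g))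
      ≤ -c * (a ^ 2 + b ^ 2) + C * (f ^ 2 + g ^ 2) := by
  obtain ⟨μp, -, μm, -, νa, hνa, h⟩ := hS
  set p : ℝ → ℝ := fun y => Real.exp (-μp * y) * S.dPlus y with hp
  set m : ℝ → ℝ := fun y => Real.exp (μm * y) * |S.dMinus y| with hm
  have hpC : ContDiffOn ℝ 1 p (Icc 0 S.L) :=
    (show ContDiff ℝ 1 fun y : ℝ => Real.exp (-μp * y) by fun_prop).contDiffOn.mul S.dPlus_contDiff
  have hmC : ContDiffOn ℝ 1 m (Icc 0 S.L) :=
    ((show ContDiff ℝ 1 fun y : ℝ => Real.exp (μm * y) by fun_prop).contDiffOn.mul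
      S.dMinus_contDiff.neg).congr fun y hy => by
        simp [hm, abs_of_neg (S.dMinus_neg y hy)]
  have hpp : ∀ x ∈ Icc 0 S.L, 0 < p x := fun x hx => mul_pos (Real.exp_pos _) (S.dPlus_pos x hx)
  have hmp : ∀ x ∈ Icc 0 S.L, 0 < m x := fun x hx =>
    mul_pos (Real.exp_pos _) (abs_pos.2 (S.dMinus_neg x hx).ne)
  refine ⟨p, m, hpC, hmC, hpp, hmp, ?_⟩
  have hne : (Icc 0 S.L).Nonempty := ⟨0, left_mem_Icc.2 S.L_nonneg⟩
  have hE : Continuous fun x : ℝ => min (Real.exp (-μp * x)) (Real.exp (μm * x)) := by fun_prop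
  obtain ⟨x0, -, hx0⟩ := isCompact_Icc.exists_isMinOn hne hE.continuousOn
  set ε := min (Real.exp (-μp * x0)) (Real.exp (μm * x0)) with hε
  have hεp : 0 < ε := lt_min (Real.exp_pos _) (Real.exp_pos _)
  obtain ⟨P, hP⟩ := isCompact_Icc.exists_bound_of_continuousOn
    (hpC.continuousOn.prodMk hmC.continuousOn)
  have hP0 : 0 ≤ P := (norm_nonneg _).trans (hP 0 (left_mem_Icc.2 S.L_nonneg))
  -- `ε` bounds the exponential weights from below. Half of the resulting decay is kept; the other
  -- half absorbs the products with the sources by Young's inequality.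
  set c := -νa * ε / 2 with hc
  have hcp : 0 < c := by have := mul_pos (neg_pos.2 hνa) hεp; positivity
  refine ⟨c, hcp, P ^ 2 / c + 1, by positivity, fun x hx a b f g => ?_⟩
  have hq := S.forward_quadratic hx (h x hx) a b
  have hmin : ε ≤ min (Real.exp (-μp * x)) (Real.exp (μm * x)) := hx0 hx
  have h1 : ε ≤ Real.exp (-μp * x) := hmin.trans (min_le_left _ _)
  have h2 : ε ≤ Real.exp (μm * x) := hmin.trans (min_le_right _ _)
  have h3 : νa * (Real.exp (-μp * x) * a ^ 2 + Real.exp (μm * x) * b ^ 2)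
      ≤ -(2 * c) * (a ^ 2 + b ^ 2) := by
    have i1 := mul_le_mul_of_nonneg_right h1 (sq_nonneg a)
    have i2 := mul_le_mul_of_nonneg_right h2 (sq_nonneg b)
    have := mul_le_mul_of_nonneg_left (add_le_add i1 i2) (neg_nonneg.2 hνa.le)
    rw [hc]
    linarith
  have young : ∀ k s f : ℝ, |k| ≤ P → 2 * k * s * f ≤ c * s ^ 2 + (P ^ 2 / c) * f ^ 2 := by
    intro k s f hk
    have hk2 : k ^ 2 ≤ P ^ 2 := sq_le_sq' (abs_le.1 hk).1 (abs_le.1 hk).2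
    have i1 : 0 ≤ (c * s - k * f) ^ 2 / c := by positivity
    have i2 : (c * s - k * f) ^ 2 / c = c * s ^ 2 - 2 * k * s * f + k ^ 2 / c * f ^ 2 := by
      field_simp
      ring
    have i3 : k ^ 2 / c * f ^ 2 ≤ P ^ 2 / c * f ^ 2 := by gcongr
    linarith
  have hPx := hP x hx
  have y1 := young (p x) a f ((norm_fst_le (p x, m x)).trans hPx)
  have y2 := young (m x) b g ((norm_snd_le (p x, m x)).trans hPx)
  have hff := sq_nonneg f
  have hgg := sq_nonneg g
  simp only [hp, hm] at y1 y2 hq ⊢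
  linarith

end HyperbolicSystem

/-! ### Travel times and the system as two coupled scalar transport equations. -/

/-- Measuring positions from `L` makes the minus-characteristics start at `0` and run to the right,
so that the scalar theory covers both components. -/
theorem measurePreserving_mirror (T L : ℝ) :
    MeasurePreserving (fun p : ℝ × ℝ => (p.1, L - p.2)) (rectMeasure T L) (rectMeasure T L) := by
  have h1 : MeasurePreserving (fun y : ℝ => L - y) (volume.restrict (Ioo 0 L))
      (volume.restrict (Ioo 0 L)) := by
    have h := (Measure.measurePreserving_sub_left (volume : Measure ℝ) L).restrict_preimage
      (measurableSet_Ioo (a := (0 : ℝ)) (b := L))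
    convert! h using 2
    ext y
    simp [and_comm]
  exact (MeasurePreserving.id _).prod h1

theorem memLp_mul_of_continuousOn {T L : ℝ} {a : ℝ → ℝ} {h : ℝ → ℝ → ℝ}
    (ha : ContinuousOn a (Icc 0 L)) (hh : MemLp (Function.uncurry h) 2 (rectMeasure T L)) :
    MemLp (Function.uncurry fun t x => a x * h t x) 2 (rectMeasure T L) := by
  obtain ⟨C, hC⟩ := isCompact_Icc.exists_bound_of_continuousOn ha
  have hm : AEStronglyMeasurable a (volume.restrict (Ioo 0 L)) :=
    (ha.mono Ioo_subset_Icc_self).aestronglyMeasurable measurableSet_Ioo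
  have hm2 : AEStronglyMeasurable (fun p : ℝ × ℝ => a p.2) (rectMeasure T L) := hm.comp_snd
  refine MemLp.of_le_mul (c := C) hh (hm2.mul hh.1) ?_
  rw [rectMeasure_eq, ae_restrict_iff' (measurableSet_rect T L)]
  refine ae_of_all _ fun p hp => ?_
  simp only [Function.uncurry]
  rw [norm_mul]
  exact mul_le_mul_of_nonneg_right (hC _ (Ioo_subset_Icc_self hp.2)) (norm_nonneg _)

theorem mirror_mem {L x : ℝ} (hx : x ∈ Icc 0 L) : L - x ∈ Icc 0 L :=
  ⟨by linarith [hx.2], by linarith [hx.1]⟩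

/-- The rate is the reciprocal of the maximal speed. It makes the travel times monotone and later
drives the decay of the Neumann series. -/
theorem exists_rate {δ : ℝ → ℝ} {L : ℝ} (hL : 0 ≤ L) (hδ : ContinuousOn δ (Icc 0 L))
    (hδp : ∀ x ∈ Icc 0 L, 0 < δ x) :
    ∃ κ > 0, ∀ x ∈ Icc 0 L, ∀ y ∈ Icc 0 L, y ≤ x → κ * (x - y) ≤ ∫ s in y..x, 1 / δ s := by
  obtain ⟨x0, hx0m, hx0⟩ := isCompact_Icc.exists_isMaxOn ⟨0, left_mem_Icc.2 hL⟩ hδ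
  refine ⟨1 / δ x0, one_div_pos.2 (hδp _ hx0m), fun x hx y hy hyx => ?_⟩
  have hsub : Icc y x ⊆ Icc 0 L := Icc_subset_Icc hy.1 hx.2
  have hc : ContinuousOn (fun s => 1 / δ s) (Icc y x) :=
    continuousOn_const.div (hδ.mono hsub) fun s hs => (hδp s (hsub hs)).ne'
  have h := intervalIntegral.integral_mono_on (μ := volume) hyx
    (intervalIntegrable_const (c := 1 / δ x0))
    (hc.intervalIntegrable_of_Icc hyx) fun s hs =>
      one_div_le_one_div_of_le (hδp s (hsub hs)) (hx0 (hsub hs))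
  rw [intervalIntegral.integral_const, smul_eq_mul, mul_comm] at h
  exact h

/-- The nearest point of `[0, L]`. -/
noncomputable def clampTo (L x : ℝ) : ℝ := max 0 (min x L)

theorem clampTo_mem {L : ℝ} (hL : 0 ≤ L) (x : ℝ) : clampTo L x ∈ Icc 0 L :=
  ⟨le_max_left _ _, max_le hL (min_le_right _ _)⟩

theorem clampTo_of_mem {L x : ℝ} (hx : x ∈ Icc 0 L) : clampTo L x = x := by
  unfold clampTo
  rw [min_eq_left hx.2, max_eq_right hx.1]

theorem continuous_clampTo (L : ℝ) : Continuous (clampTo L) := by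
  unfold clampTo; fun_prop

namespace HyperbolicSystem
variable (S : HyperbolicSystem)

/-- The travel time of the plus-characteristics, extended continuously to the line. -/
noncomputable def tauPlus (x : ℝ) : ℝ := S.timePlus (clampTo S.L x)

/-- The travel time of the minus-characteristics as a function of the distance from `L`,
extended continuously to the line. -/
noncomputable def tauMinus (x : ℝ) : ℝ := S.timeMinus (S.L - clampTo S.L x)

theorem continuousOn_inv_dPlus : ContinuousOn (fun y => 1 / S.dPlus y) (Icc 0 S.L) :=
  continuousOn_const.div S.dPlus_contDiff.continuousOn fun s hs => (S.dPlus_pos s hs).ne'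

theorem continuousOn_inv_dMinus : ContinuousOn (fun y => 1 / |S.dMinus y|) (Icc 0 S.L) :=
  continuousOn_const.div S.dMinus_contDiff.continuousOn.abs
    fun s hs => abs_ne_zero.2 (S.dMinus_neg s hs).ne

theorem exists_rate_tauPlus : ∃ κ > 0, ∀ x ∈ Icc 0 S.L, ∀ y ∈ Icc 0 S.L, y ≤ x →
    κ * (x - y) ≤ S.tauPlus x - S.tauPlus y := by
  obtain ⟨κ, hκ, h⟩ := exists_rate S.L_nonneg S.dPlus_contDiff.continuousOn S.dPlus_pos
  refine ⟨κ, hκ, fun x hx y hy hyx => ?_⟩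
  unfold tauPlus timePlus
  rw [clampTo_of_mem hx, clampTo_of_mem hy, intervalIntegral.integral_interval_sub_left]
  · exact h x hx y hy hyx
  · exact (S.continuousOn_inv_dPlus.mono (Icc_subset_Icc_right hx.2)).intervalIntegrable_of_Icc hx.1
  · exact (S.continuousOn_inv_dPlus.mono (Icc_subset_Icc_right hy.2)).intervalIntegrable_of_Icc hy.1

theorem exists_rate_tauMinus : ∃ κ > 0, ∀ x ∈ Icc 0 S.L, ∀ y ∈ Icc 0 S.L, y ≤ x →
    κ * (x - y) ≤ S.tauMinus x - S.tauMinus y := by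
  obtain ⟨κ, hκ, h⟩ := exists_rate S.L_nonneg S.dMinus_contDiff.continuousOn.abs
    fun x hx => abs_pos.2 (S.dMinus_neg x hx).ne
  refine ⟨κ, hκ, fun x hx y hy hyx => ?_⟩
  unfold tauMinus timeMinus
  have hx' := mirror_mem hx
  have hy' := mirror_mem hy
  rw [clampTo_of_mem hx, clampTo_of_mem hy, intervalIntegral.integral_interval_sub_interval_comm,
    intervalIntegral.integral_same, sub_zero]
  · have := h (S.L - y) hy' (S.L - x) hx' (by linarith)
    linarith
  · exact (S.continuousOn_inv_dMinus.mono (Icc_subset_Icc_left hx'.1)).intervalIntegrable_of_Icc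
      hx'.2
  · exact (S.continuousOn_inv_dMinus.mono (Icc_subset_Icc_left hy'.1)).intervalIntegrable_of_Icc
      hy'.2
  · exact (S.continuousOn_inv_dMinus.mono
      (Icc_subset_Icc hx'.1 hy'.2)).intervalIntegrable_of_Icc (by linarith)

theorem isTravelTime_tauPlus : IsTravelTime S.L S.tauPlus where
  continuous := by
    have h : ContinuousOn S.timePlus (Icc 0 S.L) := by
      have := intervalIntegral.continuousOn_primitive_interval (μ := volume) (a := 0) (b := S.L)
        (f := fun y => 1 / S.dPlus y) (by
          rw [uIcc_of_le S.L_nonneg]; exact S.continuousOn_inv_dPlus.integrableOn_Icc)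
      rwa [uIcc_of_le S.L_nonneg] at this
    exact h.comp_continuous (continuous_clampTo _) fun x => clampTo_mem S.L_nonneg x
  monotoneOn := by
    obtain ⟨κ, hκ, h⟩ := S.exists_rate_tauPlus
    intro y hy x hx hyx
    have := h x hx y hy hyx
    nlinarith
  zero := by
    unfold tauPlus timePlus
    rw [clampTo_of_mem (left_mem_Icc.2 S.L_nonneg), intervalIntegral.integral_same]

theorem isTravelTime_tauMinus : IsTravelTime S.L S.tauMinus where
  continuous := by
    have h : ContinuousOn S.timeMinus (Icc 0 S.L) := by
      have := intervalIntegral.continuousOn_primitive_interval_left (μ := volume) (a := 0)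
        (b := S.L) (f := fun y => 1 / |S.dMinus y|) (by
          rw [uIcc_of_le S.L_nonneg]; exact S.continuousOn_inv_dMinus.integrableOn_Icc)
      rwa [uIcc_of_le S.L_nonneg] at this
    exact h.comp_continuous (continuous_const.sub (continuous_clampTo _))
      fun x => mirror_mem (clampTo_mem S.L_nonneg x)
  monotoneOn := by
    obtain ⟨κ, hκ, h⟩ := S.exists_rate_tauMinus
    intro y hy x hx hyx
    have := h x hx y hy hyx
    nlinarith
  zero := by
    unfold tauMinus timeMinus
    rw [clampTo_of_mem (left_mem_Icc.2 S.L_nonneg), sub_zero, intervalIntegral.integral_same]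

/-- The source of the plus-equation along the characteristics. -/
noncomputable def sourcePlus (q f : ℝ → ℝ → Plane) (t y : ℝ) : ℝ :=
  S.couplePlus y (q t y 0) (q t y 1) + f t y 0

/-- The source of the minus-equation along the characteristics, at the distance `y` from `L`. -/
noncomputable def sourceMinus (q f : ℝ → ℝ → Plane) (t y : ℝ) : ℝ :=
  S.coupleMinus (S.L - y) (q t (S.L - y) 0) (q t (S.L - y) 1) + f t (S.L - y) 1

/-- The plus-component at `(t, x)` by integration along the characteristic. -/
noncomputable def broadPlus (w : ℝ → Plane) (f q : ℝ → ℝ → Plane) : ℝ → ℝ → ℝ :=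
  broad S.tauPlus (fun t => w t 0) (S.sourcePlus q f)

/-- The minus-component at the distance `x` from `L`, by integration along the
characteristic. -/
noncomputable def broadMinus (w : ℝ → Plane) (f q : ℝ → ℝ → Plane) : ℝ → ℝ → ℝ :=
  broad S.tauMinus (fun t => w t 1) (S.sourceMinus q f)

/-- `q` is a square integrable broad solution with inflow `w`, source `f` and zero initial
values. -/
structure IsBroad (T : ℝ) (w : ℝ → Plane) (f q : ℝ → ℝ → Plane) : Prop where
  inflow : MemLp w 2 (volume.restrict (Ioo 0 T))
  source : MemLp (Function.uncurry f) 2 (rectMeasure T S.L)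
  state : MemLp (Function.uncurry q) 2 (rectMeasure T S.L)
  plus : ∀ᵐ p : ℝ × ℝ ∂(rectMeasure T S.L), q p.1 p.2 0 = S.broadPlus w f q p.1 p.2
  minus : ∀ᵐ p : ℝ × ℝ ∂(rectMeasure T S.L), q p.1 p.2 1 = S.broadMinus w f q p.1 (S.L - p.2)

theorem alongPlus_eq (u : ℝ → Plane) (r : ℝ → ℝ → Plane) (t : ℝ) {x : ℝ} (hx : x ∈ Icc 0 S.L) :
    S.alongPlus u r t x = S.broadPlus u 0 r t x := by
  unfold alongPlus broadPlus broad
  have hτ : ∀ y ∈ Icc 0 S.L, S.tauPlus y = S.timePlus y := fun y hy => by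
    unfold tauPlus; rw [clampTo_of_mem hy]
  rw [hτ x hx]
  congr 1
  apply intervalIntegral.integral_congr
  intro y hy
  rw [uIcc_of_le hx.1] at hy
  have hy' : y ∈ Icc 0 S.L := ⟨hy.1, hy.2.trans hx.2⟩
  simp only [hτ y hy', sourcePlus, couplePlus, Matrix.mulVec, dotProduct, Fin.sum_univ_two,
    Pi.zero_apply, PiLp.zero_apply, add_zero]

theorem alongMinus_eq (u : ℝ → Plane) (r : ℝ → ℝ → Plane) (t : ℝ) {x : ℝ} (hx : x ∈ Icc 0 S.L) :
    S.alongMinus u r t x = S.broadMinus u 0 r t (S.L - x) := by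
  unfold alongMinus broadMinus broad
  have hτ : ∀ y ∈ Icc 0 S.L, S.tauMinus (S.L - y) = S.timeMinus y := fun y hy => by
    unfold tauMinus; rw [clampTo_of_mem (mirror_mem hy), sub_sub_cancel]
  rw [hτ x hx]
  congr 1
  have h := intervalIntegral.integral_comp_sub_left (a := x) (b := S.L) (fun y =>
    if S.timeMinus x - S.tauMinus y < t then
      S.sourceMinus r 0 (t - (S.timeMinus x - S.tauMinus y)) y else 0) S.L
  rw [sub_self] at h
  rw [← h]
  apply intervalIntegral.integral_congr
  intro y hy
  rw [uIcc_of_le hx.2] at hy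
  have hy' : y ∈ Icc 0 S.L := ⟨hx.1.trans hy.1, hy.2⟩
  simp only [hτ y hy', sourceMinus, coupleMinus, Matrix.mulVec, dotProduct, Fin.sum_univ_two,
    Pi.zero_apply, PiLp.zero_apply, add_zero, sub_sub_cancel]

theorem ae_rect {T : ℝ} {P : ℝ → ℝ → Prop} (h : ∀ t ∈ Ioo 0 T, ∀ x ∈ Icc 0 S.L, P t x) :
    ∀ᵐ p : ℝ × ℝ ∂(rectMeasure T S.L), P p.1 p.2 := by
  rw [rectMeasure_eq, ae_restrict_iff' (measurableSet_rect T S.L)]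
  exact ae_of_all _ fun p hp => h _ hp.1 _ (Ioo_subset_Icc_self hp.2)

/-- With zero source and reflected minus-component the two formulations agree at every point of the
rectangle; integrability of the control is a field of `IsBroad` only. -/
theorem isState_iff {T : ℝ} {u : ℝ → Plane} {r : ℝ → ℝ → Plane}
    (hu : MemLp u 2 (volume.restrict (Ioo 0 T))) : S.IsState T u r ↔ S.IsBroad T u 0 r := by
  have e1 := S.ae_rect (T := T) (P := fun t x => S.alongPlus u r t x = S.broadPlus u 0 r t x)
    fun t _ x hx => S.alongPlus_eq u r t hx
  have e2 := S.ae_rect (T := T)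
    (P := fun t x => S.alongMinus u r t x = S.broadMinus u 0 r t (S.L - x))
    fun t _ x hx => S.alongMinus_eq u r t hx
  constructor
  · rintro ⟨h1, h2, h3⟩
    refine ⟨hu, MemLp.zero, h1, ?_, ?_⟩
    · filter_upwards [h2, e1] with p hp hp'
      rw [hp, hp']
    · filter_upwards [h3, e2] with p hp hp'
      rw [hp, hp']
  · rintro ⟨-, -, h1, h2, h3⟩
    refine ⟨h1, ?_, ?_⟩
    · filter_upwards [h2, e1] with p hp hp'
      rw [hp, hp']
    · filter_upwards [h3, e2] with p hp hp'
      rw [hp, hp']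

theorem outflowTrace_eq (u : ℝ → Plane) (r : ℝ → ℝ → Plane) (t : ℝ) :
    S.outflowTrace u r t = !₂[S.broadPlus u 0 r t S.L, S.broadMinus u 0 r t S.L] := by
  unfold outflowTrace
  rw [S.alongPlus_eq u r t (right_mem_Icc.2 S.L_nonneg),
    S.alongMinus_eq u r t (left_mem_Icc.2 S.L_nonneg), sub_zero]

theorem continuousOn_entry (i j : Fin 2) : ContinuousOn (fun x => S.M x i j) (Icc 0 S.L) :=
  (continuous_apply_apply i j).comp_continuousOn S.M_continuous

theorem couplePlus_eq (x a b : ℝ) : S.couplePlus x a b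
    = (S.η₀ * S.M x 0 0 * (1 / S.dPlus x)) * a + (S.η₀ * S.M x 0 1 * (1 / S.dPlus x)) * b := by
  unfold couplePlus; ring

theorem coupleMinus_eq (x a b : ℝ) : S.coupleMinus x a b
    = (S.η₀ * S.M x 1 0 * (1 / |S.dMinus x|)) * a
      + (S.η₀ * S.M x 1 1 * (1 / |S.dMinus x|)) * b := by
  unfold coupleMinus; ring

theorem continuousOn_coeff_plus (j : Fin 2) :
    ContinuousOn (fun x => S.η₀ * S.M x 0 j * (1 / S.dPlus x)) (Icc 0 S.L) :=
  (continuousOn_const.mul (S.continuousOn_entry 0 j)).mul S.continuousOn_inv_dPlus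

theorem continuousOn_coeff_minus (j : Fin 2) :
    ContinuousOn (fun x => S.η₀ * S.M x 1 j * (1 / |S.dMinus x|)) (Icc 0 S.L) :=
  (continuousOn_const.mul (S.continuousOn_entry 1 j)).mul S.continuousOn_inv_dMinus

variable {S}

theorem memLp_sourcePlus {T : ℝ} {q f : ℝ → ℝ → Plane}
    (hf : MemLp (Function.uncurry f) 2 (rectMeasure T S.L))
    (hq : MemLp (Function.uncurry q) 2 (rectMeasure T S.L)) :
    MemLp (Function.uncurry (S.sourcePlus q f)) 2 (rectMeasure T S.L) := by
  have h0 := memLp_mul_of_continuousOn (h := fun t x => q t x 0) (S.continuousOn_coeff_plus 0)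
    (hq.eval_piLp 0)
  have h1 := memLp_mul_of_continuousOn (h := fun t x => q t x 1) (S.continuousOn_coeff_plus 1)
    (hq.eval_piLp 1)
  refine ((h0.add h1).add (hf.eval_piLp 0)).congr_norm ?_ (ae_of_all _ fun p => ?_)
  · refine (((h0.add h1).add (hf.eval_piLp 0)).1).congr (ae_of_all _ fun p => ?_)
    simp only [Pi.add_apply, Function.uncurry, sourcePlus, couplePlus_eq]
  · simp only [Pi.add_apply, Function.uncurry, sourcePlus, couplePlus_eq]

theorem memLp_sourceMinus {T : ℝ} {q f : ℝ → ℝ → Plane}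
    (hf : MemLp (Function.uncurry f) 2 (rectMeasure T S.L))
    (hq : MemLp (Function.uncurry q) 2 (rectMeasure T S.L)) :
    MemLp (Function.uncurry (S.sourceMinus q f)) 2 (rectMeasure T S.L) := by
  have h0 := memLp_mul_of_continuousOn (h := fun t x => q t x 0) (S.continuousOn_coeff_minus 0)
    (hq.eval_piLp 0)
  have h1 := memLp_mul_of_continuousOn (h := fun t x => q t x 1) (S.continuousOn_coeff_minus 1)
    (hq.eval_piLp 1)
  have h2 := ((h0.add h1).add (hf.eval_piLp 1)).comp_measurePreserving
    (measurePreserving_mirror T S.L)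
  refine h2.congr_norm (h2.1.congr (ae_of_all _ fun p => ?_)) (ae_of_all _ fun p => ?_) <;>
  simp only [Pi.add_apply, Function.uncurry, sourceMinus, coupleMinus_eq, Function.comp]

theorem IsBroad.memLp_outPlus {T : ℝ} {w : ℝ → Plane} {f q : ℝ → ℝ → Plane}
    (h : S.IsBroad T w f q) {x : ℝ} (hx : x ∈ Icc 0 S.L) :
    MemLp (fun t => S.broadPlus w f q t x) 2 (volume.restrict (Ioo 0 T)) :=
  S.isTravelTime_tauPlus.integrable_sq_broad hx (h.inflow.eval_piLp 0)
    (memLp_sourcePlus h.source h.state)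

theorem IsBroad.memLp_outMinus {T : ℝ} {w : ℝ → Plane} {f q : ℝ → ℝ → Plane}
    (h : S.IsBroad T w f q) {x : ℝ} (hx : x ∈ Icc 0 S.L) :
    MemLp (fun t => S.broadMinus w f q t x) 2 (volume.restrict (Ioo 0 T)) :=
  S.isTravelTime_tauMinus.integrable_sq_broad hx (h.inflow.eval_piLp 1)
    (memLp_sourceMinus h.source h.state)

theorem continuousOn_mirror {L : ℝ} {a : ℝ → ℝ} (ha : ContinuousOn a (Icc 0 L)) :
    ContinuousOn (fun x => a (L - x)) (Icc 0 L) :=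
  ha.comp (by fun_prop) fun _ hx => mirror_mem hx

theorem derivWithin_mirror (a : ℝ → ℝ) (L x : ℝ) :
    derivWithin (fun y => a (L - y)) (Icc 0 L) x = -derivWithin a (Icc 0 L) (L - x) := by
  rw [derivWithin_comp_const_sub]
  congr 2
  ext y
  rw [mem_vadd_set]
  constructor
  · rintro ⟨z, hz, rfl⟩
    rw [Set.mem_neg] at hz
    simp only [vadd_eq_add, mem_Icc] at hz ⊢
    constructor <;> linarith [hz.1, hz.2]
  · intro hy
    refine ⟨y - L, ?_, by simp [vadd_eq_add]⟩
    rw [Set.mem_neg]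
    constructor <;> linarith [hy.1, hy.2]

end HyperbolicSystem

/-! ### Energy estimate for the system. -/

theorem Plane.norm_sq (v : Plane) : ‖v‖ ^ 2 = v 0 ^ 2 + v 1 ^ 2 := by
  rw [EuclideanSpace.real_norm_sq_eq, Fin.sum_univ_two]

theorem integral_mirror {T L : ℝ} {F : ℝ × ℝ → ℝ} (hF : Integrable F (rectMeasure T L)) :
    Integrable (fun p : ℝ × ℝ => F (p.1, L - p.2)) (rectMeasure T L) ∧
    ∫ p, F (p.1, L - p.2) ∂(rectMeasure T L) = ∫ p, F p ∂(rectMeasure T L) := by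
  have hm := measurePreserving_mirror T L
  refine ⟨hm.integrable_comp_of_integrable hF, ?_⟩
  conv_rhs => rw [← hm.map_eq]
  rw [integral_map hm.measurable.aemeasurable (by rw [hm.map_eq]; exact hF.1)]

theorem contDiffOn_mirror {L : ℝ} {a : ℝ → ℝ} (ha : ContDiffOn ℝ 1 a (Icc 0 L)) :
    ContDiffOn ℝ 1 (fun x => a (L - x)) (Icc 0 L) :=
  ha.comp (by fun_prop) fun _ hx => mirror_mem hx

namespace HyperbolicSystem
variable {S : HyperbolicSystem}

/-- The energy estimate, with a constant that does not depend on the time horizon. -/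
theorem exists_energy (hS : S.ForwardDissipative) : ∃ C > 0, ∀ (T : ℝ) (w : ℝ → Plane)
    (f q : ℝ → ℝ → Plane), S.IsBroad T w f q →
    (∫ t in Ioo 0 T, S.broadPlus w f q t S.L ^ 2) + (∫ t in Ioo 0 T, S.broadMinus w f q t S.L ^ 2)
      + ∫ p, ‖Function.uncurry q p‖ ^ 2 ∂(rectMeasure T S.L)
    ≤ C * ((∫ t in Ioo 0 T, ‖w t‖ ^ 2)
      + ∫ p, ‖Function.uncurry f p‖ ^ 2 ∂(rectMeasure T S.L)) := by
  obtain ⟨p, m, hp, hm, hpp, hmp, c, hc, C, hC, hdis⟩ := S.exists_weights hS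
  have h0 : (0 : ℝ) ∈ Icc 0 S.L := left_mem_Icc.2 S.L_nonneg
  have hL : S.L ∈ Icc 0 S.L := right_mem_Icc.2 S.L_nonneg
  -- `k` is a lower bound for the coefficients of the estimated terms, `K` an upper bound for those
  -- of the data. The minus-component leaves at `0` and enters at `L`.
  set k := min (min (p S.L) (m 0)) c with hk
  set K := max (max (p 0) (m S.L)) C with hK
  have hkp : 0 < k := lt_min (lt_min (hpp _ hL) (hmp _ h0)) hc
  have hKp : 0 < K := lt_max_of_lt_right hC
  refine ⟨K / k, by positivity, fun T w f q h => ?_⟩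
  have Ep := S.isTravelTime_tauPlus.energy S.L_nonneg hp (fun x hx => (hpp x hx).le)
    (hp.continuousOn_derivWithin S.uniqueDiffOn le_rfl) (h.inflow.eval_piLp 0)
    (memLp_sourcePlus h.source h.state) (z := fun t x => q t x 0) (h.state.eval_piLp 0) h.plus
  have hmir := measurePreserving_mirror T S.L
  have hmin : ∀ᵐ x : ℝ × ℝ ∂(rectMeasure T S.L),
      q x.1 (S.L - x.2) 1 = S.broadMinus w f q x.1 x.2 := by
    have := hmir.quasiMeasurePreserving.ae h.minus
    simpa using this
  have Em := S.isTravelTime_tauMinus.energy S.L_nonneg (contDiffOn_mirror hm)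
    (fun x hx => (hmp _ (mirror_mem hx)).le)
    ((contDiffOn_mirror hm).continuousOn_derivWithin S.uniqueDiffOn le_rfl)
    (h.inflow.eval_piLp 1) (memLp_sourceMinus h.source h.state)
    (z := fun t x => q t (S.L - x) 1)
    ((h.state.eval_piLp 1).comp_measurePreserving hmir) hmin
  obtain ⟨Ip, Ep⟩ := Ep
  obtain ⟨Im, Em⟩ := Em
  -- Each scalar inequality contains the coupling, so only the sum of the two productions is
  -- controlled by dissipativity. The reflection is undone in order to add them pointwise.
  obtain ⟨Im', Em'⟩ := integral_mirror Im
  rw [← Em', sub_self, sub_zero] at Em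
  have hq2 : Integrable (fun x => ‖Function.uncurry q x‖ ^ 2) (rectMeasure T S.L) :=
    h.state.norm.integrable_sq
  have hf2 : Integrable (fun x => ‖Function.uncurry f x‖ ^ 2) (rectMeasure T S.L) :=
    h.source.norm.integrable_sq
  have hle := integral_mono_ae (Ip.add Im') ((hq2.const_mul (-c)).add (hf2.const_mul C)) (by
    rw [rectMeasure_eq]
    refine (ae_restrict_iff' (measurableSet_rect T S.L)).2 (ae_of_all _ fun x hx => ?_)
    have hx2 : x.2 ∈ Icc 0 S.L := Ioo_subset_Icc_self hx.2
    have := hdis x.2 hx2 (q x.1 x.2 0) (q x.1 x.2 1) (f x.1 x.2 0) (f x.1 x.2 1)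
    simp only [Pi.add_apply, Function.uncurry, Plane.norm_sq, derivWithin_mirror, sourcePlus,
      sourceMinus, sub_sub_cancel]
    exact this)
  have eadd := integral_add Ip Im'
  have eadd2 := integral_add (hq2.const_mul (-c)) (hf2.const_mul C)
  rw [integral_const_mul, integral_const_mul] at eadd2
  simp only [Pi.add_apply] at hle
  rw [eadd, eadd2] at hle
  have hw0 : IntegrableOn (fun t => w t 0 ^ 2) (Ioo 0 T) := (h.inflow.eval_piLp 0).integrable_sq
  have hw1 : IntegrableOn (fun t => w t 1 ^ 2) (Ioo 0 T) := (h.inflow.eval_piLp 1).integrable_sq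
  have ew : ∫ t in Ioo 0 T, ‖w t‖ ^ 2 = (∫ t in Ioo 0 T, w t 0 ^ 2) + ∫ t in Ioo 0 T, w t 1 ^ 2 := by
    simp_rw [Plane.norm_sq]
    exact integral_add hw0 hw1
  rw [ew]
  have n0 : 0 ≤ ∫ t in Ioo 0 T, w t 0 ^ 2 := integral_nonneg fun _ => sq_nonneg _
  have n1 : 0 ≤ ∫ t in Ioo 0 T, w t 1 ^ 2 := integral_nonneg fun _ => sq_nonneg _
  have n2 : 0 ≤ ∫ x, ‖Function.uncurry f x‖ ^ 2 ∂(rectMeasure T S.L) :=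
    integral_nonneg fun _ => sq_nonneg _
  have n3 : 0 ≤ ∫ x, ‖Function.uncurry q x‖ ^ 2 ∂(rectMeasure T S.L) :=
    integral_nonneg fun _ => sq_nonneg _
  have n4 : 0 ≤ ∫ t in Ioo 0 T, S.broadPlus w f q t S.L ^ 2 := integral_nonneg fun _ => sq_nonneg _
  have n5 : 0 ≤ ∫ t in Ioo 0 T, S.broadMinus w f q t S.L ^ 2 := integral_nonneg fun _ => sq_nonneg _
  have k1 : k ≤ p S.L := (min_le_left _ _).trans (min_le_left _ _)
  have k2 : k ≤ m 0 := (min_le_left _ _).trans (min_le_right _ _)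
  have k3 : k ≤ c := min_le_right _ _
  have K1 : p 0 ≤ K := (le_max_left _ _).trans (le_max_left _ _)
  have K2 : m S.L ≤ K := (le_max_right _ _).trans (le_max_left _ _)
  have K3 : C ≤ K := le_max_right _ _
  rw [div_mul_eq_mul_div, le_div_iff₀ hkp]
  have i1 := mul_le_mul_of_nonneg_right k1 n4
  have i2 := mul_le_mul_of_nonneg_right k2 n5
  have i3 := mul_le_mul_of_nonneg_right k3 n3
  have j1 := mul_le_mul_of_nonneg_right K1 n0
  have j2 := mul_le_mul_of_nonneg_right K2 n1
  have j3 := mul_le_mul_of_nonneg_right K3 n2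
  change p S.L * (∫ t in Ioo 0 T, S.broadPlus w f q t S.L ^ 2) ≤ _ at Ep
  change m 0 * (∫ t in Ioo 0 T, S.broadMinus w f q t S.L ^ 2) ≤ _ at Em
  linarith

/-! ### Stability of the stationary two-point problem. -/

theorem exists_couple_bound (S : HyperbolicSystem) : ∃ K > 0, ∀ x ∈ Icc 0 S.L, ∀ a b : ℝ,
    |S.couplePlus x a b| ≤ K * (|a| + |b|) ∧ |S.coupleMinus x a b| ≤ K * (|a| + |b|) := by
  obtain ⟨K0, h0⟩ := isCompact_Icc.exists_bound_of_continuousOn (S.continuousOn_coeff_plus 0)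
  obtain ⟨K1, h1⟩ := isCompact_Icc.exists_bound_of_continuousOn (S.continuousOn_coeff_plus 1)
  obtain ⟨K2, h2⟩ := isCompact_Icc.exists_bound_of_continuousOn (S.continuousOn_coeff_minus 0)
  obtain ⟨K3, h3⟩ := isCompact_Icc.exists_bound_of_continuousOn (S.continuousOn_coeff_minus 1)
  set K := max (max K0 K1) (max (max K2 K3) 1) with hK
  have b0 : K0 ≤ K := (le_max_left _ _).trans (le_max_left _ _)
  have b1 : K1 ≤ K := (le_max_right _ _).trans (le_max_left _ _)
  have b2 : K2 ≤ K := ((le_max_left _ _).trans (le_max_left _ _)).trans (le_max_right _ _)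
  have b3 : K3 ≤ K := ((le_max_right _ _).trans (le_max_left _ _)).trans (le_max_right _ _)
  have b4 : 1 ≤ K := (le_max_right _ _).trans (le_max_right _ _)
  have aux : ∀ u v a b : ℝ, |u| ≤ K → |v| ≤ K → |u * a + v * b| ≤ K * (|a| + |b|) := by
    intro u v a b hu hv
    refine (abs_add_le _ _).trans ?_
    rw [abs_mul, abs_mul, mul_add]
    exact add_le_add (mul_le_mul_of_nonneg_right hu (abs_nonneg _))
      (mul_le_mul_of_nonneg_right hv (abs_nonneg _))
  refine ⟨K, by linarith, fun x hx a b => ⟨?_, ?_⟩⟩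
  · rw [couplePlus_eq]
    exact aux _ _ _ _ ((h0 x hx).trans b0) ((h1 x hx).trans b1)
  · rw [coupleMinus_eq]
    exact aux _ _ _ _ ((h2 x hx).trans b2) ((h3 x hx).trans b3)

theorem couplePlus_add (x a b a' b' : ℝ) : S.couplePlus x (a + a') (b + b')
    = S.couplePlus x a b + S.couplePlus x a' b' := by
  simp only [couplePlus_eq]; ring

theorem coupleMinus_add (x a b a' b' : ℝ) : S.coupleMinus x (a + a') (b + b')
    = S.coupleMinus x a b + S.coupleMinus x a' b' := by
  simp only [coupleMinus_eq]; ring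

theorem couplePlus_smul (x k a b : ℝ) : S.couplePlus x (k * a) (k * b) = k * S.couplePlus x a b := by
  simp only [couplePlus_eq]; ring

theorem coupleMinus_smul (x k a b : ℝ) :
    S.coupleMinus x (k * a) (k * b) = k * S.coupleMinus x a b := by
  simp only [coupleMinus_eq]; ring

theorem intervalIntegrable_couplePlus {Φ Ψ : ℝ → ℝ} (hΦ : IntervalIntegrable Φ volume 0 S.L)
    (hΨ : IntervalIntegrable Ψ volume 0 S.L) :
    IntervalIntegrable (fun y => S.couplePlus y (Φ y) (Ψ y)) volume 0 S.L := by
  simp_rw [couplePlus_eq]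
  have e : uIcc 0 S.L = Icc 0 S.L := uIcc_of_le S.L_nonneg
  exact (hΦ.continuousOn_mul (by rw [e]; exact S.continuousOn_coeff_plus 0)).add
    (hΨ.continuousOn_mul (by rw [e]; exact S.continuousOn_coeff_plus 1))

theorem intervalIntegrable_coupleMinus {Φ Ψ : ℝ → ℝ} (hΦ : IntervalIntegrable Φ volume 0 S.L)
    (hΨ : IntervalIntegrable Ψ volume 0 S.L) :
    IntervalIntegrable (fun y => S.coupleMinus y (Φ y) (Ψ y)) volume 0 S.L := by
  simp_rw [coupleMinus_eq]
  have e : uIcc 0 S.L = Icc 0 S.L := uIcc_of_le S.L_nonneg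
  exact (hΦ.continuousOn_mul (by rw [e]; exact S.continuousOn_coeff_minus 0)).add
    (hΨ.continuousOn_mul (by rw [e]; exact S.continuousOn_coeff_minus 1))

/-- Stability of the stationary two-point problem: approximate solutions of the homogeneous
problem have small outflow. -/
theorem exists_static_stability (hS : S.ForwardDissipative) : ∃ C > 0, ∀ (ε : ℝ) (Φ Ψ : ℝ → ℝ),
    IntervalIntegrable Φ volume 0 S.L → IntervalIntegrable Ψ volume 0 S.L →
    (∀ᵐ x ∂(volume.restrict (Ioo 0 S.L)),
      |Φ x - ∫ y in (0 : ℝ)..x, S.couplePlus y (Φ y) (Ψ y)| ≤ ε ∧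
      |Ψ x - ∫ y in x..S.L, S.coupleMinus y (Φ y) (Ψ y)| ≤ ε) →
    |∫ y in (0 : ℝ)..S.L, S.couplePlus y (Φ y) (Ψ y)| ≤ C * ε ∧
    |∫ y in (0 : ℝ)..S.L, S.coupleMinus y (Φ y) (Ψ y)| ≤ C * ε := by
  obtain ⟨p, m, hp, hm, hpp, hmp, c, hc, C, hC, hdis⟩ := S.exists_weights hS
  obtain ⟨K, hK, hKb⟩ := S.exists_couple_bound
  have h0 : (0 : ℝ) ∈ Icc 0 S.L := left_mem_Icc.2 S.L_nonneg
  have hL : S.L ∈ Icc 0 S.L := right_mem_Icc.2 S.L_nonneg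
  have hLp := S.L_pos
  set k := min (p S.L) (m 0) with hk
  have hkp : 0 < k := lt_min (hpp _ hL) (hmp _ h0)
  -- Each of the two perturbations of the coupling is at most `2 * K * ε`, which accounts for `8 * K
  -- ^ 2`.
  set B := S.L * (C * (8 * K ^ 2)) / k with hB
  have hBp : 0 < B := by positivity
  refine ⟨Real.sqrt B, Real.sqrt_pos.2 hBp, fun ε Φ Ψ hΦ hΨ hae => ?_⟩
  -- The interval has positive measure, so the bound by `ε` holds at some point.
  have hε : 0 ≤ ε := by
    have hne : (ae (volume.restrict (Ioo 0 S.L))).NeBot := by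
      rw [ae_neBot]
      intro h
      have h' := Measure.restrict_eq_zero.1 h
      rw [Real.volume_Ioo, ENNReal.ofReal_eq_zero] at h'
      linarith
    obtain ⟨x, hx⟩ := hae.exists
    exact (abs_nonneg _).trans hx.1
  set Gp : ℝ → ℝ := fun y => S.couplePlus y (Φ y) (Ψ y) with hGp
  set Gm : ℝ → ℝ := fun y => S.coupleMinus y (Φ y) (Ψ y) with hGm
  have hGpi : IntervalIntegrable Gp volume 0 S.L := intervalIntegrable_couplePlus hΦ hΨ
  have hGmi : IntervalIntegrable Gm volume 0 S.L := intervalIntegrable_coupleMinus hΦ hΨ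
  -- `Φ` and `Ψ` need not be continuous. The energy identity is applied to these primitives, which
  -- vanish at their inflow ends and differ from `Φ`, `Ψ` by at most `ε`.
  set θp : ℝ → ℝ := fun x => ∫ y in (0 : ℝ)..x, Gp y with hθp
  set θm : ℝ → ℝ := fun x => ∫ y in x..S.L, Gm y with hθm
  have e : uIcc 0 S.L = Icc 0 S.L := uIcc_of_le S.L_nonneg
  have cθp : ContinuousOn θp (Icc 0 S.L) := by
    have := intervalIntegral.continuousOn_primitive_interval' hGpi (left_mem_uIcc (a := 0))
    rwa [e] at this
  have cθm : ContinuousOn θm (Icc 0 S.L) := by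
    have := intervalIntegral.continuousOn_primitive_interval_left (a := 0) (b := S.L) (f := Gm)
      (μ := volume) (by
        rw [e]; exact (intervalIntegrable_iff_integrableOn_Icc_of_le S.L_nonneg).1 hGmi)
    rwa [e] at this
  have Ep := integral_weighted_sq (c := 0) S.L_nonneg le_rfl hp hGpi
  have hGmr : IntervalIntegrable (fun y => Gm (S.L - y)) volume 0 S.L := by
    have := (hGmi.comp_sub_left S.L).symm
    simpa using this
  have Em := integral_weighted_sq (c := 0) S.L_nonneg le_rfl (contDiffOn_mirror hm) hGmr
  have hrev : ∀ x, ∫ y in (0:ℝ)..x, Gm (S.L - y) = θm (S.L - x) := by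
    intro x
    rw [intervalIntegral.integral_comp_sub_left, sub_zero]
  simp only [hrev, derivWithin_mirror, zero_add] at Em
  simp only [zero_add] at Ep
  have Em2 := intervalIntegral.integral_comp_sub_left (a := 0) (b := S.L) (fun x =>
    -derivWithin m (Icc 0 S.L) x * θm x ^ 2 + 2 * m x * θm x * Gm x) S.L
  rw [Em2, sub_self, sub_zero] at Em
  have Ip : IntervalIntegrable (fun x => derivWithin p (Icc 0 S.L) x * θp x ^ 2
      + 2 * p x * θp x * Gp x) volume 0 S.L := by
    refine (ContinuousOn.intervalIntegrable (by
      rw [e]; exact (hp.continuousOn_derivWithin S.uniqueDiffOn le_rfl).mul (cθp.pow 2))).add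
      (hGpi.continuousOn_mul (by
        rw [e]; exact (continuousOn_const.mul hp.continuousOn).mul cθp))
  have Im : IntervalIntegrable (fun x => -derivWithin m (Icc 0 S.L) x * θm x ^ 2
      + 2 * m x * θm x * Gm x) volume 0 S.L := by
    refine (ContinuousOn.intervalIntegrable (by
      rw [e]
      exact (hm.continuousOn_derivWithin S.uniqueDiffOn le_rfl).neg.mul (cθm.pow 2))).add
      (hGmi.continuousOn_mul (by
        rw [e]; exact (continuousOn_const.mul hm.continuousOn).mul cθm))
  have hle := intervalIntegral.integral_mono_ae_restrict S.L_nonneg (Ip.add Im)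
    (intervalIntegrable_const (c := C * (8 * K ^ 2 * ε ^ 2))) (by
      rw [← restrict_Ioo_eq_restrict_Icc]
      filter_upwards [hae, ae_restrict_mem measurableSet_Ioo] with x hx hxm
      have hxI : x ∈ Icc 0 S.L := Ioo_subset_Icc_self hxm
      -- By linearity, the coupling at `(Φ, Ψ)` is the coupling at the primitives plus a small
      -- source.
      have hd := hdis x hxI (θp x) (θm x) (S.couplePlus x (Φ x - θp x) (Ψ x - θm x))
        (S.coupleMinus x (Φ x - θp x) (Ψ x - θm x))
      rw [← couplePlus_add, ← coupleMinus_add, add_sub_cancel, add_sub_cancel] at hd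
      obtain ⟨b1, b2⟩ := hKb x hxI (Φ x - θp x) (Ψ x - θm x)
      have hs : |Φ x - θp x| + |Ψ x - θm x| ≤ 2 * ε := by linarith [hx.1, hx.2]
      have hs' := mul_le_mul_of_nonneg_left hs hK.le
      have s1 := sq_le_sq' (abs_le.1 (b1.trans hs')).1 (abs_le.1 (b1.trans hs')).2
      have s2 := sq_le_sq' (abs_le.1 (b2.trans hs')).1 (abs_le.1 (b2.trans hs')).2
      have s3 := mul_le_mul_of_nonneg_left (add_le_add s1 s2) hC.le
      have s4 : 0 ≤ c * (θp x ^ 2 + θm x ^ 2) := by positivity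
      change _ ≤ C * (8 * K ^ 2 * ε ^ 2)
      refine hd.trans ?_
      linarith)
  have hsum : p S.L * θp S.L ^ 2 + m 0 * θm 0 ^ 2 ≤ S.L * (C * (8 * K ^ 2 * ε ^ 2)) := by
    have := intervalIntegral.integral_add Ip Im
    simp only [sub_zero, intervalIntegral.integral_const, smul_eq_mul] at hle
    rw [this] at hle
    simp only [ne_eq, OfNat.ofNat_ne_zero, not_false_eq_true, zero_pow, mul_zero, sub_zero] at Ep Em
    change _ = p S.L * θp S.L ^ 2 at Ep
    linarith
  have n1 := mul_le_mul_of_nonneg_right (min_le_left (p S.L) (m 0)) (sq_nonneg (θp S.L))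
  have n2 := mul_le_mul_of_nonneg_right (min_le_right (p S.L) (m 0)) (sq_nonneg (θm 0))
  have n3 : 0 ≤ k * θp S.L ^ 2 := by positivity
  have n4 : 0 ≤ k * θm 0 ^ 2 := by positivity
  have fin : ∀ z : ℝ, k * z ^ 2 ≤ S.L * (C * (8 * K ^ 2 * ε ^ 2)) → |z| ≤ Real.sqrt B * ε := by
    intro z hz
    apply abs_le_of_sq_le_sq _ (by positivity)
    rw [mul_pow, Real.sq_sqrt hBp.le, hB, div_mul_eq_mul_div, le_div_iff₀ hkp]
    linarith
  exact ⟨fin (θp S.L) (by linarith), fin (θm 0) (by linarith)⟩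

end HyperbolicSystem

/-! ### Solvability of the stationary equations and the stationary response. -/

theorem integral_exp_mul_le {γ x : ℝ} (hγ : 0 < γ) :
    ∫ s in (0 : ℝ)..x, Real.exp (γ * s) ≤ Real.exp (γ * x) / γ := by
  rw [intervalIntegral.integral_comp_mul_left _ hγ.ne', integral_exp, smul_eq_mul, mul_zero,
    Real.exp_zero, inv_mul_eq_div]
  gcongr
  linarith

/-- Solvability of a Volterra integral equation with a globally Lipschitz nonlinearity. -/
theorem exists_volterra {E : Type*} [NormedAddCommGroup E] [NormedSpace ℝ E] [CompleteSpace E]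
    {G : ℝ → E → E} (hG : Continuous (Function.uncurry G)) {K : ℝ} (hK : 0 < K)
    (hGK : ∀ x a b, ‖G x a - G x b‖ ≤ K * ‖a - b‖) (c : E) {L : ℝ} (hL : 0 ≤ L) :
    ∃ R : ℝ → E, Continuous R ∧ ∀ x ∈ Icc 0 L, R x = c + ∫ y in (0 : ℝ)..x, G y (R y) := by
  -- The fixed point is sought for the unknown `exp (-γ * x) • R x`; this choice makes the
  -- contraction factor `K / γ = 1 / 2`, whatever the length of the interval.
  set γ := 2 * K with hγ
  have hγp : 0 < γ := by positivity
  let ext : C(Icc (0 : ℝ) L, E) → ℝ → E := fun y x => y (projIcc 0 L hL x)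
  have hext : ∀ y, Continuous (ext y) := fun y => y.continuous.comp continuous_projIcc
  let H : C(Icc (0 : ℝ) L, E) → ℝ → E := fun y s => G s (Real.exp (γ * s) • ext y s)
  have hH : ∀ y, Continuous (H y) := fun y => by
    have : Continuous fun s => (s, Real.exp (γ * s) • ext y s) := by
      have := hext y
      fun_prop
    exact hG.comp this
  let Ψ : C(Icc (0 : ℝ) L, E) → C(Icc (0 : ℝ) L, E) := fun y =>
    ⟨fun x => Real.exp (-γ * x) • (c + ∫ s in (0 : ℝ)..x, H y s), by
      have h1 : Continuous fun x : ℝ => ∫ s in (0 : ℝ)..x, H y s :=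
        intervalIntegral.continuous_primitive (fun a b => (hH y).intervalIntegrable a b) 0
      have h2 : Continuous fun x : ℝ => Real.exp (-γ * x) • (c + ∫ s in (0 : ℝ)..x, H y s) := by
        fun_prop
      exact h2.comp continuous_subtype_val⟩
  have hΨ : ContractingWith (1 / 2) Ψ := by
    refine ⟨by rw [← NNReal.coe_lt_coe]; norm_num, LipschitzWith.of_dist_le_mul fun y z => ?_⟩
    rw [ContinuousMap.dist_le (by positivity)]
    intro x
    have hx := x.2
    rw [dist_eq_norm]
    have e : Ψ y x - Ψ z x
        = Real.exp (-γ * x) • ∫ s in (0 : ℝ)..x, (H y s - H z s) := by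
      simp only [Ψ, ContinuousMap.coe_mk]
      rw [← smul_sub, add_sub_add_left_eq_sub, intervalIntegral.integral_sub
        ((hH y).intervalIntegrable _ _) ((hH z).intervalIntegrable _ _)]
    have hb : ‖∫ s in (0 : ℝ)..x, (H y s - H z s)‖
        ≤ ∫ s in (0 : ℝ)..x, K * dist y z * Real.exp (γ * s) := by
      apply intervalIntegral.norm_integral_le_of_norm_le hx.1
      · refine ae_of_all _ fun s _ => ?_
        refine (hGK _ _ _).trans ?_
        rw [← smul_sub, norm_smul, Real.norm_eq_abs, abs_of_pos (Real.exp_pos _)]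
        have hd : ‖ext y s - ext z s‖ ≤ dist y z := by
          rw [← dist_eq_norm]; exact ContinuousMap.dist_apply_le_dist _
        calc K * (Real.exp (γ * s) * ‖ext y s - ext z s‖)
            ≤ K * (Real.exp (γ * s) * dist y z) := by gcongr
          _ = _ := by ring
      · exact Continuous.intervalIntegrable (by fun_prop) _ _
    rw [e, norm_smul, Real.norm_eq_abs, abs_of_pos (Real.exp_pos _)]
    rw [intervalIntegral.integral_const_mul] at hb
    calc Real.exp (-γ * x) * ‖∫ s in (0 : ℝ)..x, (H y s - H z s)‖
        ≤ Real.exp (-γ * x) * (K * dist y z * (Real.exp (γ * x) / γ)) := by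
          gcongr
          exact hb.trans (mul_le_mul_of_nonneg_left (integral_exp_mul_le hγp) (by positivity))
      _ = (Real.exp (-γ * x) * Real.exp (γ * x)) * (K / γ) * dist y z := by ring
      _ = ((1 / 2 : NNReal) : ℝ) * dist y z := by
          rw [← Real.exp_add, neg_mul, neg_add_cancel, Real.exp_zero, hγ]
          push_cast
          field_simp
  set y := ContractingWith.fixedPoint Ψ hΨ with hy
  have hfix : Ψ y = y := hΨ.fixedPoint_isFixedPt
  refine ⟨fun x => Real.exp (γ * x) • ext y x, ?_, fun x hx => ?_⟩
  · have := hext y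
    fun_prop
  · have h1 : ext y x = Real.exp (-γ * x) • (c + ∫ s in (0 : ℝ)..x, H y s) := by
      have h2 : ext y x = y ⟨x, hx⟩ := by simp only [ext, projIcc_of_mem hL hx]
      rw [h2]
      conv_lhs => rw [← hfix]
      rfl
    simp only [h1]
    rw [smul_smul, ← Real.exp_add, neg_mul, add_neg_cancel, Real.exp_zero, one_smul]

theorem hasDerivAt_plane {R : ℝ → Plane} {R' : Plane} {x : ℝ} :
    HasDerivAt R R' x ↔ ∀ i, HasDerivAt (fun x => R x i) (R' i) x := by
  constructor
  · intro h i
    exact (EuclideanSpace.proj (𝕜 := ℝ) i).hasFDerivAt.comp_hasDerivAt x h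
  · intro h
    exact (PiLp.continuousLinearEquiv 2 ℝ fun _ : Fin 2 => ℝ).symm.hasFDerivAt.comp_hasDerivAt x
      (hasDerivAt_pi.2 h)

namespace HyperbolicSystem
variable {S : HyperbolicSystem}

/-- The stationary equations in integrated form. -/
structure IsStaticIntegral (S : HyperbolicSystem) (v : Plane) (R : ℝ → Plane) : Prop where
  continuousOn : ContinuousOn R (Icc 0 S.L)
  plus : ∀ x ∈ Icc 0 S.L, R x 0 = v 0 + ∫ y in (0 : ℝ)..x, S.couplePlus y (R y 0) (R y 1)
  minus : ∀ x ∈ Icc 0 S.L, R x 1 = v 1 + ∫ y in x..S.L, S.coupleMinus y (R y 0) (R y 1)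

theorem continuousOn_coord {A : Set ℝ} {R : ℝ → Plane} (hR : ContinuousOn R A) (i : Fin 2) :
    ContinuousOn (fun x => R x i) A :=
  (PiLp.continuous_apply 2 _ i).comp_continuousOn hR

theorem intervalIntegrable_coord {R : ℝ → Plane} (hR : ContinuousOn R (Icc 0 S.L)) (i : Fin 2) :
    IntervalIntegrable (fun x => R x i) volume 0 S.L :=
  (continuousOn_coord hR i).intervalIntegrable_of_Icc S.L_nonneg

theorem continuousOn_couplePlus {R : ℝ → Plane} (hR : ContinuousOn R (Icc 0 S.L)) :
    ContinuousOn (fun y => S.couplePlus y (R y 0) (R y 1)) (Icc 0 S.L) := by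
  simp_rw [couplePlus_eq]
  exact ((S.continuousOn_coeff_plus 0).mul (continuousOn_coord hR 0)).add
    ((S.continuousOn_coeff_plus 1).mul (continuousOn_coord hR 1))

theorem continuousOn_coupleMinus {R : ℝ → Plane} (hR : ContinuousOn R (Icc 0 S.L)) :
    ContinuousOn (fun y => S.coupleMinus y (R y 0) (R y 1)) (Icc 0 S.L) := by
  simp_rw [coupleMinus_eq]
  exact ((S.continuousOn_coeff_minus 0).mul (continuousOn_coord hR 0)).add
    ((S.continuousOn_coeff_minus 1).mul (continuousOn_coord hR 1))

/-- Division by the nonzero speeds. The minus sign appears because `coupleMinus` is normalised by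
`|d₋|`, that is, along decreasing `x`. -/
theorem D_mulVec_eq_iff {x : ℝ} (hx : x ∈ Icc 0 S.L) (R' R : Plane) :
    S.D x *ᵥ R'.ofLp = S.η₀ • (S.M x *ᵥ R.ofLp) ↔
      R' 0 = S.couplePlus x (R 0) (R 1) ∧ R' 1 = -S.coupleMinus x (R 0) (R 1) := by
  have h1 := S.dPlus_pos x hx
  have h2 := S.dMinus_neg x hx
  have h3 : -S.dMinus x ≠ 0 := by linarith
  have d0 : (S.D x *ᵥ R'.ofLp) 0 = S.dPlus x * R' 0 := by simp [D, Matrix.mulVec_diagonal]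
  have d1 : (S.D x *ᵥ R'.ofLp) 1 = S.dMinus x * R' 1 := by simp [D, Matrix.mulVec_diagonal]
  rw [funext_iff, Fin.forall_fin_two, d0, d1]
  simp only [Matrix.mulVec, dotProduct, Fin.sum_univ_two, Pi.smul_apply, smul_eq_mul, couplePlus,
    coupleMinus, abs_of_neg h2]
  rw [eq_div_iff h1.ne', ← neg_div, eq_div_iff h3]
  constructor <;> rintro ⟨i1, i2⟩ <;> constructor <;> linarith

theorem IsStaticState.hasDerivAt {v : Plane} {R : ℝ → Plane} (h : S.IsStaticState v R) {x : ℝ}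
    (hx : x ∈ Ioo 0 S.L) : HasDerivAt (fun x => R x 0) (S.couplePlus x (R x 0) (R x 1)) x ∧
      HasDerivAt (fun x => R x 1) (-S.coupleMinus x (R x 0) (R x 1)) x := by
  obtain ⟨R', hR', he⟩ := h.ode x hx
  obtain ⟨e0, e1⟩ := (D_mulVec_eq_iff (Ioo_subset_Icc_self hx) R' (R x)).1 he
  have h0 := (hasDerivAt_plane.1 hR') 0
  have h1 := (hasDerivAt_plane.1 hR') 1
  rw [← e0, ← e1]
  exact ⟨h0, h1⟩

theorem IsStaticState.isStaticIntegral {v : Plane} {R : ℝ → Plane} (h : S.IsStaticState v R) :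
    S.IsStaticIntegral v R := by
  have hode := fun x (hx : x ∈ Ioo 0 S.L) => h.hasDerivAt hx
  refine ⟨h.continuousOn, fun x hx => ?_, fun x hx => ?_⟩
  · have hs : Icc 0 x ⊆ Icc 0 S.L := Icc_subset_Icc_right hx.2
    rw [intervalIntegral.integral_eq_sub_of_hasDerivAt_of_le hx.1
      ((continuousOn_coord h.continuousOn 0).mono hs)
      (fun y hy => (hode y ⟨hy.1, hy.2.trans_le hx.2⟩).1)
      (((continuousOn_couplePlus h.continuousOn).mono hs).intervalIntegrable_of_Icc hx.1),
      h.plus]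
    ring
  · have hs : Icc x S.L ⊆ Icc 0 S.L := Icc_subset_Icc_left hx.1
    have := intervalIntegral.integral_eq_sub_of_hasDerivAt_of_le hx.2
      ((continuousOn_coord h.continuousOn 1).mono hs)
      (fun y hy => (hode y ⟨hx.1.trans_lt hy.1, hy.2⟩).2)
      (((continuousOn_coupleMinus h.continuousOn).neg.mono hs).intervalIntegrable_of_Icc hx.2)
    rw [intervalIntegral.integral_neg, h.minus] at this
    linarith

theorem IsStaticIntegral.isStaticState {v : Plane} {R : ℝ → Plane} (h : S.IsStaticIntegral v R) :
    S.IsStaticState v R := by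
  refine ⟨h.continuousOn, fun x hx => ?_, ?_, ?_⟩
  · have hxI : x ∈ Icc 0 S.L := Ioo_subset_Icc_self hx
    have hn : Icc 0 S.L ∈ nhds x := Icc_mem_nhds hx.1 hx.2
    refine ⟨!₂[S.couplePlus x (R x 0) (R x 1), -S.coupleMinus x (R x 0) (R x 1)], ?_, ?_⟩
    · rw [hasDerivAt_plane, Fin.forall_fin_two]
      constructor
      · have hc := continuousOn_couplePlus h.continuousOn
        have hd := intervalIntegral.integral_hasDerivAt_right
          ((hc.mono (Icc_subset_Icc_right hxI.2)).intervalIntegrable_of_Icc hxI.1)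
          (hc.stronglyMeasurableAtFilter_nhdsWithin measurableSet_Icc x |>.filter_mono
            (by rw [nhdsWithin_eq_nhds.2 hn])) (hc.continuousAt hn)
        have := (hd.const_add (v 0)).congr_of_eventuallyEq
          (f₁ := fun y => R y 0) (Filter.eventually_of_mem hn fun y hy => h.plus y hy)
        exact this
      · have hc := continuousOn_coupleMinus h.continuousOn
        have hd := intervalIntegral.integral_hasDerivAt_left
          ((hc.mono (Icc_subset_Icc_left hxI.1)).intervalIntegrable_of_Icc hxI.2)
          (hc.stronglyMeasurableAtFilter_nhdsWithin measurableSet_Icc x |>.filter_mono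
            (by rw [nhdsWithin_eq_nhds.2 hn])) (hc.continuousAt hn)
        have := (hd.const_add (v 1)).congr_of_eventuallyEq
          (f₁ := fun y => R y 1) (Filter.eventually_of_mem hn fun y hy => h.minus y hy)
        exact this
    · rw [D_mulVec_eq_iff hxI]
      exact ⟨rfl, rfl⟩
  · rw [h.plus 0 (left_mem_Icc.2 S.L_nonneg), intervalIntegral.integral_same, add_zero]
  · rw [h.minus _ (right_mem_Icc.2 S.L_nonneg), intervalIntegral.integral_same, add_zero]

/-- Solutions of the initial value problem for the stationary equations. -/
theorem exists_cauchy (S : HyperbolicSystem) (c d : ℝ) : ∃ R : ℝ → Plane, Continuous R ∧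
    ∀ x ∈ Icc 0 S.L, R x 0 = c + ∫ y in (0 : ℝ)..x, S.couplePlus y (R y 0) (R y 1) ∧
      R x 1 = d - ∫ y in (0 : ℝ)..x, S.coupleMinus y (R y 0) (R y 1) := by
  obtain ⟨K, hK, hb⟩ := S.exists_couple_bound
  have hcl : ∀ x, clampTo S.L x ∈ Icc 0 S.L := clampTo_mem S.L_nonneg
  let G : ℝ → ℝ × ℝ → ℝ × ℝ := fun x a =>
    (S.couplePlus (clampTo S.L x) a.1 a.2, -S.coupleMinus (clampTo S.L x) a.1 a.2)
  have cp : ∀ j, Continuous fun p : ℝ × ℝ × ℝ =>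
      (fun x => S.η₀ * S.M x 0 j * (1 / S.dPlus x)) (clampTo S.L p.1) := fun j =>
    (S.continuousOn_coeff_plus j).comp_continuous ((continuous_clampTo _).comp continuous_fst)
      fun p => hcl p.1
  have cm : ∀ j, Continuous fun p : ℝ × ℝ × ℝ =>
      (fun x => S.η₀ * S.M x 1 j * (1 / |S.dMinus x|)) (clampTo S.L p.1) := fun j =>
    (S.continuousOn_coeff_minus j).comp_continuous ((continuous_clampTo _).comp continuous_fst)
      fun p => hcl p.1
  have hG : Continuous (Function.uncurry G) := by
    simp only [G, Function.uncurry_def, couplePlus_eq, coupleMinus_eq]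
    have c0 := cp 0
    have c1 := cp 1
    have c2 := cm 0
    have c3 := cm 1
    refine Continuous.prodMk ?_ (Continuous.neg ?_)
    · exact (c0.mul (by fun_prop)).add (c1.mul (by fun_prop))
    · exact (c2.mul (by fun_prop)).add (c3.mul (by fun_prop))
  have hLip : ∀ x a b, ‖G x a - G x b‖ ≤ (2 * K) * ‖a - b‖ := by
    intro x a b
    have e1 : S.couplePlus (clampTo S.L x) a.1 a.2 - S.couplePlus (clampTo S.L x) b.1 b.2
        = S.couplePlus (clampTo S.L x) (a.1 - b.1) (a.2 - b.2) := by
      simp only [couplePlus_eq]; ring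
    have e2 : -S.coupleMinus (clampTo S.L x) a.1 a.2 - -S.coupleMinus (clampTo S.L x) b.1 b.2
        = -S.coupleMinus (clampTo S.L x) (a.1 - b.1) (a.2 - b.2) := by
      simp only [coupleMinus_eq]; ring
    obtain ⟨b1, b2⟩ := hb _ (hcl x) (a.1 - b.1) (a.2 - b.2)
    have n1 : |a.1 - b.1| ≤ ‖a - b‖ := norm_fst_le (a - b)
    have n2 : |a.2 - b.2| ≤ ‖a - b‖ := norm_snd_le (a - b)
    have n3 : K * (|a.1 - b.1| + |a.2 - b.2|) ≤ 2 * K * ‖a - b‖ := by nlinarith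
    rw [Prod.norm_def]
    refine max_le ?_ ?_
    · change |S.couplePlus (clampTo S.L x) a.1 a.2 - S.couplePlus (clampTo S.L x) b.1 b.2| ≤ _
      rw [e1]; exact b1.trans n3
    · change |-S.coupleMinus (clampTo S.L x) a.1 a.2 - -S.coupleMinus (clampTo S.L x) b.1 b.2| ≤ _
      rw [e2, abs_neg]; exact b2.trans n3
  obtain ⟨R, hRc, hR⟩ := exists_volterra hG (by positivity : 0 < 2 * K) hLip (c, d) S.L_nonneg
  refine ⟨fun x => !₂[(R x).1, (R x).2], ?_, fun x hx => ?_⟩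
  · have : Continuous fun x => (![(R x).1, (R x).2] : Fin 2 → ℝ) := by
      refine continuous_pi fun i => ?_
      fin_cases i
      · exact continuous_fst.comp hRc
      · exact continuous_snd.comp hRc
    exact (PiLp.continuous_toLp 2 _).comp this
  · have hGc : Continuous fun y => G y (R y) := hG.comp (continuous_id.prodMk hRc)
    have hI := hGc.intervalIntegrable (μ := volume) 0 x
    have hfst : (∫ y in (0 : ℝ)..x, G y (R y)).1 = ∫ y in (0 : ℝ)..x, (G y (R y)).1 :=
      ((ContinuousLinearMap.fst ℝ ℝ ℝ).intervalIntegral_comp_comm hI).symm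
    have hsnd : (∫ y in (0 : ℝ)..x, G y (R y)).2 = ∫ y in (0 : ℝ)..x, (G y (R y)).2 :=
      ((ContinuousLinearMap.snd ℝ ℝ ℝ).intervalIntegral_comp_comm hI).symm
    have hmem : ∀ y ∈ uIcc 0 x, clampTo S.L y = y := fun y hy => by
      rw [uIcc_of_le hx.1] at hy
      exact clampTo_of_mem ⟨hy.1, hy.2.trans hx.2⟩
    have hRx := hR x hx
    constructor
    · change (R x).1 = _
      rw [hRx, Prod.fst_add, hfst]
      congr 1
      apply intervalIntegral.integral_congr
      intro y hy
      simp only [G, hmem y hy]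
      rfl
    · change (R x).2 = _
      rw [hRx, Prod.snd_add, hsnd, sub_eq_add_neg, ← intervalIntegral.integral_neg]
      congr 1
      apply intervalIntegral.integral_congr
      intro y hy
      simp only [G, hmem y hy]
      rfl

end HyperbolicSystem

namespace HyperbolicSystem
variable {S : HyperbolicSystem}

theorem IsStaticIntegral.out_plus {v : Plane} {R : ℝ → Plane} (h : S.IsStaticIntegral v R) :
    R S.L 0 = v 0 + ∫ y in (0 : ℝ)..S.L, S.couplePlus y (R y 0) (R y 1) :=
  h.plus _ (right_mem_Icc.2 S.L_nonneg)

theorem IsStaticIntegral.out_minus {v : Plane} {R : ℝ → Plane} (h : S.IsStaticIntegral v R) :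
    R 0 1 = v 1 + ∫ y in (0 : ℝ)..S.L, S.coupleMinus y (R y 0) (R y 1) :=
  h.minus _ (left_mem_Icc.2 S.L_nonneg)

theorem subinterval_integrable {f : ℝ → ℝ} {L a b : ℝ} (hf : IntervalIntegrable f volume 0 L)
    (ha : 0 ≤ a) (hab : a ≤ b) (hb : b ≤ L) : IntervalIntegrable f volume a b :=
  hf.mono_set (by
    rw [uIcc_of_le hab, uIcc_of_le (ha.trans (hab.trans hb))]
    exact Icc_subset_Icc ha hb)

theorem IsStaticIntegral.linear_comb {v w : Plane} {R Q : ℝ → Plane} (hR : S.IsStaticIntegral v R)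
    (hQ : S.IsStaticIntegral w Q) (a b : ℝ) :
    S.IsStaticIntegral (a • v + b • w) (fun x => a • R x + b • Q x) := by
  have iR := intervalIntegrable_couplePlus (intervalIntegrable_coord hR.continuousOn 0)
    (intervalIntegrable_coord hR.continuousOn 1)
  have iQ := intervalIntegrable_couplePlus (intervalIntegrable_coord hQ.continuousOn 0)
    (intervalIntegrable_coord hQ.continuousOn 1)
  have jR := intervalIntegrable_coupleMinus (intervalIntegrable_coord hR.continuousOn 0)
    (intervalIntegrable_coord hR.continuousOn 1)
  have jQ := intervalIntegrable_coupleMinus (intervalIntegrable_coord hQ.continuousOn 0)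
    (intervalIntegrable_coord hQ.continuousOn 1)
  refine ⟨(hR.continuousOn.const_smul a).add (hQ.continuousOn.const_smul b), fun x hx => ?_,
    fun x hx => ?_⟩
  · simp only [PiLp.add_apply, PiLp.smul_apply, smul_eq_mul, couplePlus_add, couplePlus_smul]
    rw [intervalIntegral.integral_add, intervalIntegral.integral_const_mul,
      intervalIntegral.integral_const_mul, hR.plus x hx, hQ.plus x hx]
    · ring
    · exact (subinterval_integrable iR le_rfl hx.1 hx.2).const_mul a
    · exact (subinterval_integrable iQ le_rfl hx.1 hx.2).const_mul b
  · simp only [PiLp.add_apply, PiLp.smul_apply, smul_eq_mul, coupleMinus_add, coupleMinus_smul]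
    rw [intervalIntegral.integral_add, intervalIntegral.integral_const_mul,
      intervalIntegral.integral_const_mul, hR.minus x hx, hQ.minus x hx]
    · ring
    · exact (subinterval_integrable jR hx.1 hx.2 le_rfl).const_mul a
    · exact (subinterval_integrable jQ hx.1 hx.2 le_rfl).const_mul b

/-- The solution of an initial value problem solves a two-point problem. -/
theorem isStaticIntegral_of_cauchy {R : ℝ → Plane} (hRc : Continuous R) {c d : ℝ}
    (hR : ∀ x ∈ Icc 0 S.L, R x 0 = c + ∫ y in (0 : ℝ)..x, S.couplePlus y (R y 0) (R y 1) ∧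
      R x 1 = d - ∫ y in (0 : ℝ)..x, S.coupleMinus y (R y 0) (R y 1)) :
    S.IsStaticIntegral !₂[c, R S.L 1] R := by
  refine ⟨hRc.continuousOn, fun x hx => (hR x hx).1, fun x hx => ?_⟩
  have j := intervalIntegrable_coupleMinus (S := S) (intervalIntegrable_coord hRc.continuousOn 0)
    (intervalIntegrable_coord hRc.continuousOn 1)
  have e := intervalIntegral.integral_add_adjacent_intervals
    (subinterval_integrable j le_rfl hx.1 hx.2) (subinterval_integrable j hx.1 hx.2 le_rfl)
  have h1 := (hR x hx).2
  have h2 := (hR _ (right_mem_Icc.2 S.L_nonneg)).2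
  change R x 1 = R S.L 1 + _
  linarith

/-- The two-point problem for the stationary equations is solvable. -/
theorem exists_static (hS : S.ForwardDissipative) (v : Plane) :
    ∃ R, S.IsStaticIntegral v R := by
  obtain ⟨R, hRc, hR⟩ := S.exists_cauchy 1 0
  obtain ⟨Q, hQc, hQ⟩ := S.exists_cauchy 0 1
  have hR' := isStaticIntegral_of_cauchy hRc hR
  have hQ' := isStaticIntegral_of_cauchy hQc hQ
  -- Otherwise `Q` solves the homogeneous two-point problem. Stability with `ε = 0` then makes the
  -- integral of its minus-coupling vanish, which contradicts the initial value `1` of its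
  -- minus-component.
  have hne : Q S.L 1 ≠ 0 := by
    intro h0
    obtain ⟨C, -, hC⟩ := S.exists_static_stability hS
    have := (hC 0 (fun x => Q x 0) (fun x => Q x 1) (intervalIntegrable_coord hQc.continuousOn 0)
      (intervalIntegrable_coord hQc.continuousOn 1) (by
        refine (ae_restrict_iff' measurableSet_Ioo).2 (ae_of_all _ fun x hx => ?_)
        have h1 := hQ'.plus x (Ioo_subset_Icc_self hx)
        have h2 := hQ'.minus x (Ioo_subset_Icc_self hx)
        change Q x 0 = 0 + _ at h1
        change Q x 1 = Q S.L 1 + _ at h2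
        rw [h0] at h2
        constructor
        · rw [h1]; simp
        · rw [h2]; simp)).2
    rw [mul_zero] at this
    have h3 := abs_nonpos_iff.1 this
    have h4 := (hQ S.L (right_mem_Icc.2 S.L_nonneg)).2
    rw [h3, h0] at h4
    norm_num at h4
  -- Shooting: the second coefficient is chosen to meet the condition at `L`.
  have h := hR'.linear_comb hQ' (v 0) ((v 1 - v 0 * R S.L 1) / Q S.L 1)
  have e : v 0 • (!₂[1, R S.L 1] : Plane)
      + ((v 1 - v 0 * R S.L 1) / Q S.L 1) • (!₂[0, Q S.L 1] : Plane) = v := by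
    ext i
    fin_cases i
    · simp
    · simp [hne]
  rw [e] at h
  exact ⟨_, h⟩

/-- The linear response of the stationary outflow to the stationary controls, and its stability
under perturbations of the stationary equations. -/
theorem exists_static_response (hS : S.ForwardDissipative) :
    ∃ H : Matrix (Fin 2) (Fin 2) ℝ, ∃ C > 0, ∀ (A B ε : ℝ) (Φ Ψ : ℝ → ℝ),
    IntervalIntegrable Φ volume 0 S.L → IntervalIntegrable Ψ volume 0 S.L →
    (∀ᵐ x ∂(volume.restrict (Ioo 0 S.L)),
      |Φ x - (A + ∫ y in (0 : ℝ)..x, S.couplePlus y (Φ y) (Ψ y))| ≤ ε ∧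
      |Ψ x - (B + ∫ y in x..S.L, S.coupleMinus y (Φ y) (Ψ y))| ≤ ε) →
    |A + (∫ y in (0 : ℝ)..S.L, S.couplePlus y (Φ y) (Ψ y)) - (H 0 0 * A + H 0 1 * B)| ≤ C * ε ∧
    |B + (∫ y in (0 : ℝ)..S.L, S.coupleMinus y (Φ y) (Ψ y)) - (H 1 0 * A + H 1 1 * B)|
      ≤ C * ε := by
  obtain ⟨P, hP⟩ := exists_static hS !₂[1, 0]
  obtain ⟨Q, hQ⟩ := exists_static hS !₂[0, 1]
  obtain ⟨C, hCp, hC⟩ := S.exists_static_stability hS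
  -- The columns of the response matrix are the outflows for the two unit controls.
  refine ⟨!![P S.L 0, Q S.L 0; P 0 1, Q 0 1], C, hCp, fun A B ε Φ Ψ hΦ hΨ hae => ?_⟩
  set R : ℝ → Plane := fun x => A • P x + B • Q x with hRdef
  have hR : S.IsStaticIntegral _ R := hP.linear_comb hQ A B
  set v : Plane := A • !₂[1, 0] + B • !₂[0, 1] with hv
  have hv0 : v 0 = A := by simp [hv]
  have hv1 : v 1 = B := by simp [hv]
  have iR0 := intervalIntegrable_coord hR.continuousOn 0
  have iR1 := intervalIntegrable_coord hR.continuousOn 1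
  have iR := intervalIntegrable_couplePlus iR0 iR1
  have jR := intervalIntegrable_coupleMinus iR0 iR1
  have iF := intervalIntegrable_couplePlus hΦ hΨ
  have jF := intervalIntegrable_coupleMinus hΦ hΨ
  have ep : ∀ y, S.couplePlus y (Φ y - R y 0) (Ψ y - R y 1)
      = S.couplePlus y (Φ y) (Ψ y) - S.couplePlus y (R y 0) (R y 1) := fun y => by
    simp only [couplePlus_eq]; ring
  have em : ∀ y, S.coupleMinus y (Φ y - R y 0) (Ψ y - R y 1)
      = S.coupleMinus y (Φ y) (Ψ y) - S.coupleMinus y (R y 0) (R y 1) := fun y => by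
    simp only [coupleMinus_eq]; ring
  -- Subtracting the exact stationary solution for `(A, B)` leaves an approximate solution of the
  -- homogeneous problem.
  have key := hC ε (fun x => Φ x - R x 0) (fun x => Ψ x - R x 1) (hΦ.sub iR0) (hΨ.sub iR1) (by
    filter_upwards [hae, ae_restrict_mem measurableSet_Ioo] with x hx hxm
    have hxI : x ∈ Icc 0 S.L := Ioo_subset_Icc_self hxm
    simp only [ep, em]
    rw [intervalIntegral.integral_sub (subinterval_integrable iF le_rfl hxI.1 hxI.2)
      (subinterval_integrable iR le_rfl hxI.1 hxI.2),
      intervalIntegral.integral_sub (subinterval_integrable jF hxI.1 hxI.2 le_rfl)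
      (subinterval_integrable jR hxI.1 hxI.2 le_rfl)]
    have r0 := hR.plus x hxI
    have r1 := hR.minus x hxI
    rw [hv0] at r0
    rw [hv1] at r1
    constructor
    · convert! hx.1 using 2
      rw [r0]; ring
    · convert! hx.2 using 2
      rw [r1]; ring)
  simp only [ep, em] at key
  rw [intervalIntegral.integral_sub iF iR, intervalIntegral.integral_sub jF jR] at key
  have o0 := hR.out_plus
  have o1 := hR.out_minus
  rw [hv0] at o0
  rw [hv1] at o1
  have e0 : R S.L 0 = P S.L 0 * A + Q S.L 0 * B := by
    simp only [hRdef, PiLp.add_apply, PiLp.smul_apply, smul_eq_mul]; ring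
  have e1 : R 0 1 = P 0 1 * A + Q 0 1 * B := by
    simp only [hRdef, PiLp.add_apply, PiLp.smul_apply, smul_eq_mul]; ring
  constructor
  · convert! key.1 using 2
    simp only [Matrix.of_apply, Matrix.cons_val_zero, Matrix.cons_val_one, Matrix.cons_val',
      Matrix.cons_val_fin_one]
    linarith
  · convert! key.2 using 2
    simp only [Matrix.of_apply, Matrix.cons_val_zero, Matrix.cons_val_one, Matrix.cons_val',
      Matrix.cons_val_fin_one]
    linarith

end HyperbolicSystem

/-! ### States for constant controls by a Neumann series. -/

/-- The variable limit is moved into an indicator, which leaves a parametric integral over the whole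
line. -/
theorem measurable_uIoc_integral {F : ℝ → ℝ → ℝ → ℝ}
    (hF : Measurable fun p : (ℝ × ℝ) × ℝ => F p.1.1 p.1.2 p.2) :
    Measurable fun p : ℝ × ℝ => ∫ y in (0 : ℝ)..p.2, F p.1 p.2 y := by
  have h1 : ∀ p : ℝ × ℝ, ∫ y in (0 : ℝ)..p.2, F p.1 p.2 y
      = (if 0 ≤ p.2 then 1 else -1) * ∫ y, (uIoc 0 p.2).indicator (F p.1 p.2) y := by
    intro p
    rw [intervalIntegral.intervalIntegral_eq_integral_uIoc, smul_eq_mul,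
      ← integral_indicator measurableSet_uIoc]
  simp_rw [h1]
  have hset : MeasurableSet {p : (ℝ × ℝ) × ℝ | p.2 ∈ uIoc 0 p.1.2} := by
    have : {p : (ℝ × ℝ) × ℝ | p.2 ∈ uIoc 0 p.1.2}
        = {p | min 0 p.1.2 < p.2} ∩ {p | p.2 ≤ max 0 p.1.2} := by
      ext p; rfl
    rw [this]
    exact (measurableSet_lt (by fun_prop) (by fun_prop)).inter
      (measurableSet_le (by fun_prop) (by fun_prop))
  have hm : StronglyMeasurable fun p : (ℝ × ℝ) × ℝ =>
      (uIoc 0 p.1.2).indicator (F p.1.1 p.1.2) p.2 :=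
    (hF.indicator hset).stronglyMeasurable
  have hI := (hm.integral_prod_right' (ν := volume)).measurable
  refine Measurable.mul (Measurable.ite (measurableSet_le (by fun_prop) (by fun_prop))
    measurable_const measurable_const) hI

/-- The part of the solution formula that comes from the source. -/
noncomputable def broadSource (τ : ℝ → ℝ) (g : ℝ → ℝ → ℝ) (t x : ℝ) : ℝ :=
  ∫ y in (0 : ℝ)..x, if τ x - τ y < t then g (t - (τ x - τ y)) y else 0

theorem measurable_integrand {τ : ℝ → ℝ} (hτ : Measurable τ) {g : ℝ → ℝ → ℝ}
    (hg : Measurable (Function.uncurry g)) :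
    Measurable fun p : (ℝ × ℝ) × ℝ => if τ p.1.2 - τ p.2 < p.1.1 then
      g (p.1.1 - (τ p.1.2 - τ p.2)) p.2 else 0 := by
  refine Measurable.ite (measurableSet_lt (by fun_prop) (by fun_prop)) ?_ measurable_const
  exact hg.comp (by fun_prop : Measurable fun p : (ℝ × ℝ) × ℝ =>
    (p.1.1 - (τ p.1.2 - τ p.2), p.2))

theorem measurable_broadSource {τ : ℝ → ℝ} (hτ : Measurable τ) {g : ℝ → ℝ → ℝ}
    (hg : Measurable (Function.uncurry g)) :
    Measurable (Function.uncurry (broadSource τ g)) :=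
  measurable_uIoc_integral (F := fun t x y => if τ x - τ y < t then g (t - (τ x - τ y)) y else 0)
    (measurable_integrand hτ hg)

/-- At `y` the characteristic through `(t, x)` is earlier by at least `κ * (x - y)`. A bound
exponential in time thus gains `exp (-γ * κ * (x - y))`, whose integral is at most `1 / (γ * κ)`,
and this is small for large `γ`. -/
theorem abs_broadSource_le {τ : ℝ → ℝ} {g : ℝ → ℝ → ℝ} {L κ γ B : ℝ} (hκ : 0 < κ) (hγ : 0 < γ)
    (hτ : ∀ x ∈ Icc 0 L, ∀ y ∈ Icc 0 L, y ≤ x → κ * (x - y) ≤ τ x - τ y) (hB : 0 ≤ B)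
    (hg : ∀ t, ∀ y ∈ Icc 0 L, |g t y| ≤ B * Real.exp (γ * t)) (t : ℝ) {x : ℝ} (hx : x ∈ Icc 0 L) :
    |broadSource τ g t x| ≤ B / (γ * κ) * Real.exp (γ * t) := by
  have hγκ : 0 < γ * κ := mul_pos hγ hκ
  have h1 : ‖broadSource τ g t x‖
      ≤ ∫ y in (0 : ℝ)..x, B * Real.exp (γ * t) * Real.exp (-(γ * κ) * x)
        * Real.exp (γ * κ * y) := by
    apply intervalIntegral.norm_integral_le_of_norm_le hx.1
    · refine ae_of_all _ fun y hy => ?_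
      have hyI : y ∈ Icc 0 L := ⟨hy.1.le, hy.2.trans hx.2⟩
      split_ifs
      · refine (hg _ y hyI).trans ?_
        rw [mul_assoc, mul_assoc, ← Real.exp_add, ← Real.exp_add]
        gcongr
        have := mul_le_mul_of_nonneg_left (hτ x hx y hyI hy.2) hγ.le
        nlinarith
      · rw [norm_zero]; positivity
    · exact Continuous.intervalIntegrable (by fun_prop) _ _
  rw [intervalIntegral.integral_const_mul] at h1
  refine h1.trans ?_
  calc _ ≤ B * Real.exp (γ * t) * Real.exp (-(γ * κ) * x) * (Real.exp (γ * κ * x) / (γ * κ)) := by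
        gcongr
        exact integral_exp_mul_le hγκ
    _ = B / (γ * κ) * Real.exp (γ * t) * (Real.exp (-(γ * κ) * x) * Real.exp (γ * κ * x)) := by ring
    _ = _ := by rw [← Real.exp_add, neg_mul, neg_add_cancel, Real.exp_zero, mul_one]

/-- Dominated convergence on a single characteristic. Monotonicity of `τ` ensures that only times up
to `t` occur, so bounds there suffice. -/
theorem hasSum_broadSource {τ : ℝ → ℝ} (hτ : Measurable τ) {L : ℝ}
    (hmono : MonotoneOn τ (Icc 0 L)) {g : ℕ → ℝ → ℝ → ℝ} {G : ℝ → ℝ → ℝ} {β : ℕ → ℝ}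
    (hg : ∀ n, Measurable (Function.uncurry (g n))) (hβ : Summable β) {t x : ℝ} (hx : x ∈ Icc 0 L)
    (hgβ : ∀ n, ∀ s ≤ t, ∀ y ∈ Icc 0 L, |g n s y| ≤ β n)
    (hG : ∀ s, ∀ y ∈ Icc 0 L, HasSum (fun n => g n s y) (G s y)) :
    HasSum (fun n => broadSource τ (g n) t x) (broadSource τ G t x) := by
  have hβ0 : ∀ n, 0 ≤ β n := fun n =>
    (abs_nonneg _).trans (hgβ n t le_rfl 0 (left_mem_Icc.2 (hx.1.trans hx.2)))
  have hmem : ∀ y ∈ uIoc 0 x, y ∈ Icc 0 L ∧ τ y ≤ τ x := fun y hy => by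
    rw [uIoc_of_le hx.1] at hy
    have hyI : y ∈ Icc 0 L := ⟨hy.1.le, hy.2.trans hx.2⟩
    exact ⟨hyI, hmono hyI hx hy.2⟩
  unfold broadSource
  apply intervalIntegral.hasSum_integral_of_dominated_convergence (fun n _ => β n)
  · intro n
    exact ((measurable_integrand hτ (hg n)).comp
      (by fun_prop : Measurable fun y : ℝ => (((t, x) : ℝ × ℝ), y))).aestronglyMeasurable
  · intro n
    refine ae_of_all _ fun y hy => ?_
    obtain ⟨hyI, hyx⟩ := hmem y hy
    split_ifs
    · exact hgβ n _ (by linarith) y hyI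
    · rw [norm_zero]; exact hβ0 n
  · exact ae_of_all _ fun y _ => hβ
  · exact intervalIntegrable_const
  · refine ae_of_all _ fun y hy => ?_
    obtain ⟨hyI, hyx⟩ := hmem y hy
    by_cases h : τ x - τ y < t
    · simp only [if_pos h]; exact hG _ y hyI
    · simp only [if_neg h]; exact hasSum_zero

namespace HyperbolicSystem
variable (S : HyperbolicSystem)

/-- The terms of the Neumann series for the state generated by the constant control `v`. -/
noncomputable def neumannTerm (v : Plane) : ℕ → ℝ → ℝ → Plane
  | 0 => fun t x => !₂[if S.tauPlus x < t then v 0 else 0,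
      if S.tauMinus (S.L - x) < t then v 1 else 0]
  | n + 1 => fun t x =>
      !₂[broadSource S.tauPlus (fun t y => S.sourcePlus (neumannTerm v n) 0 t (clampTo S.L y)) t x,
        broadSource S.tauMinus (fun t y => S.sourceMinus (neumannTerm v n) 0 t (clampTo S.L y))
          t (S.L - x)]

variable {S}

theorem neumannTerm_succ_plus (v : Plane) (n : ℕ) (t x : ℝ) : S.neumannTerm v (n + 1) t x 0
    = broadSource S.tauPlus (fun t y => S.sourcePlus (S.neumannTerm v n) 0 t (clampTo S.L y)) t x :=
  rfl

theorem neumannTerm_succ_minus (v : Plane) (n : ℕ) (t x : ℝ) : S.neumannTerm v (n + 1) t x 1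
    = broadSource S.tauMinus (fun t y => S.sourceMinus (S.neumannTerm v n) 0 t (clampTo S.L y)) t
      (S.L - x) :=
  rfl

theorem measurable_plane {α : Type*} [MeasurableSpace α] {f g : α → ℝ} (hf : Measurable f)
    (hg : Measurable g) : Measurable fun a => (!₂[f a, g a] : Plane) := by
  have : Measurable fun a => (![f a, g a] : Fin 2 → ℝ) := by
    refine measurable_pi_lambda _ fun i => ?_
    fin_cases i
    · exact hf
    · exact hg
  exact (PiLp.continuous_toLp 2 _).measurable.comp this

theorem measurable_coord (i : Fin 2) : Measurable fun v : Plane => v i :=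
  (PiLp.continuous_apply 2 _ i).measurable

/-- The coefficients are continuous on `[0, L]` only; clamping the position extends them
continuously and does not affect the solution formula on `[0, L]`. -/
theorem measurable_sourcePlus_clamp {q : ℝ → ℝ → Plane} (hq : Measurable (Function.uncurry q)) :
    Measurable (Function.uncurry fun t y => S.sourcePlus q 0 t (clampTo S.L y)) := by
  have hc : ∀ j, Measurable fun y => (fun x => S.η₀ * S.M x 0 j * (1 / S.dPlus x)) (clampTo S.L y) :=
    fun j => ((S.continuousOn_coeff_plus j).comp_continuous (continuous_clampTo _)
      fun y => clampTo_mem S.L_nonneg y).measurable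
  have hcl := (continuous_clampTo S.L).measurable
  have hq' : Measurable fun p : ℝ × ℝ => q p.1 (clampTo S.L p.2) :=
    hq.comp (measurable_fst.prodMk (hcl.comp measurable_snd))
  simp only [Function.uncurry_def, sourcePlus, couplePlus_eq, Pi.zero_apply, PiLp.zero_apply,
    add_zero]
  exact (((hc 0).comp measurable_snd).mul ((measurable_coord 0).comp hq')).add
    (((hc 1).comp measurable_snd).mul ((measurable_coord 1).comp hq'))

theorem measurable_sourceMinus_clamp {q : ℝ → ℝ → Plane} (hq : Measurable (Function.uncurry q)) :
    Measurable (Function.uncurry fun t y => S.sourceMinus q 0 t (clampTo S.L y)) := by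
  have hc : ∀ j, Measurable fun y =>
      (fun x => S.η₀ * S.M x 1 j * (1 / |S.dMinus x|)) (S.L - clampTo S.L y) :=
    fun j => ((S.continuousOn_coeff_minus j).comp_continuous
      (continuous_const.sub (continuous_clampTo _))
      fun y => mirror_mem (clampTo_mem S.L_nonneg y)).measurable
  have hcl := (continuous_clampTo S.L).measurable
  have hq' : Measurable fun p : ℝ × ℝ => q p.1 (S.L - clampTo S.L p.2) :=
    hq.comp (measurable_fst.prodMk (measurable_const.sub (hcl.comp measurable_snd)))
  simp only [Function.uncurry_def, sourceMinus, coupleMinus_eq, Pi.zero_apply, PiLp.zero_apply,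
    add_zero]
  exact (((hc 0).comp measurable_snd).mul ((measurable_coord 0).comp hq')).add
    (((hc 1).comp measurable_snd).mul ((measurable_coord 1).comp hq'))

theorem measurable_neumannTerm (v : Plane) (n : ℕ) :
    Measurable (Function.uncurry (S.neumannTerm v n)) := by
  have hp := S.isTravelTime_tauPlus.continuous.measurable
  have hm := S.isTravelTime_tauMinus.continuous.measurable
  induction n with
  | zero =>
    refine measurable_plane ?_ ?_
    · exact Measurable.ite (measurableSet_lt (by fun_prop) (by fun_prop)) measurable_const
        measurable_const
    · exact Measurable.ite (measurableSet_lt (by fun_prop) (by fun_prop)) measurable_const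
        measurable_const
  | succ n ih =>
    refine measurable_plane ?_ ?_
    · exact measurable_broadSource hp (measurable_sourcePlus_clamp ih)
    · exact (measurable_broadSource hm (measurable_sourceMinus_clamp ih)).comp
        (by fun_prop : Measurable fun p : ℝ × ℝ => (p.1, S.L - p.2))

/-- Each iteration multiplies the exponentially weighted bound by `2 * K / (γ * κ)`, which is `1 /
2` for `γ = 4 * K / κ`. -/
theorem exists_neumann_bound (S : HyperbolicSystem) : ∃ γ > 0, ∀ (v : Plane) (n : ℕ) (t : ℝ),
    ∀ x ∈ Icc 0 S.L, ∀ i, |S.neumannTerm v n t x i|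
      ≤ (|v 0| + |v 1|) * (1 / 2) ^ n * Real.exp (γ * t) := by
  obtain ⟨K, hK, hKb⟩ := S.exists_couple_bound
  obtain ⟨κp, hκp, hp⟩ := S.exists_rate_tauPlus
  obtain ⟨κm, hκm, hm⟩ := S.exists_rate_tauMinus
  set κ := min κp κm with hκdef
  have hκ : 0 < κ := lt_min hκp hκm
  set γ := 4 * K / κ with hγdef
  have hγ : 0 < γ := by positivity
  refine ⟨γ, hγ, fun v n => ?_⟩
  set B := |v 0| + |v 1| with hB
  have hB0 : 0 ≤ B := by positivity
  induction n with
  | zero =>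
    intro t x hx i
    have aux : ∀ (τ b : ℝ), 0 ≤ τ → |b| ≤ B → |if τ < t then b else 0|
        ≤ B * (1 / 2) ^ 0 * Real.exp (γ * t) := by
      intro τ b hτ hb
      split_ifs with h
      · have : 1 ≤ Real.exp (γ * t) := Real.one_le_exp (mul_nonneg hγ.le (by linarith))
        rw [pow_zero, mul_one]
        nlinarith
      · rw [abs_zero]; positivity
    fin_cases i
    · exact aux _ _ (S.isTravelTime_tauPlus.nonneg hx) (le_add_of_nonneg_right (abs_nonneg _))
    · exact aux _ _ (S.isTravelTime_tauMinus.nonneg (mirror_mem hx))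
        (le_add_of_nonneg_left (abs_nonneg _))
  | succ n ih =>
    intro t x hx i
    have e : 2 * K * (B * (1 / 2) ^ n) / (γ * κ) = B * (1 / 2) ^ (n + 1) := by
      rw [hγdef, pow_succ]
      field_simp
      ring
    have hτp : ∀ x ∈ Icc 0 S.L, ∀ y ∈ Icc 0 S.L, y ≤ x →
        κ * (x - y) ≤ S.tauPlus x - S.tauPlus y := fun x hx y hy hyx =>
      (mul_le_mul_of_nonneg_right (min_le_left _ _) (by linarith)).trans (hp x hx y hy hyx)
    have hτm : ∀ x ∈ Icc 0 S.L, ∀ y ∈ Icc 0 S.L, y ≤ x →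
        κ * (x - y) ≤ S.tauMinus x - S.tauMinus y := fun x hx y hy hyx =>
      (mul_le_mul_of_nonneg_right (min_le_right _ _) (by linarith)).trans (hm x hx y hy hyx)
    have aux : ∀ t, ∀ y ∈ Icc 0 S.L, K * (|S.neumannTerm v n t y 0| + |S.neumannTerm v n t y 1|)
        ≤ 2 * K * (B * (1 / 2) ^ n) * Real.exp (γ * t) := fun t y hy => by
      have h0 := ih t y hy 0
      have h1 := ih t y hy 1
      nlinarith
    fin_cases i
    · simp only [Fin.zero_eta]
      rw [neumannTerm_succ_plus, ← e]
      refine abs_broadSource_le hκ hγ hτp (by positivity) (fun t y hy => ?_) t hx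
      rw [clampTo_of_mem hy]
      simp only [sourcePlus, Pi.zero_apply, PiLp.zero_apply, add_zero]
      exact (hKb y hy _ _).1.trans (aux t y hy)
    · simp only [Fin.mk_one]
      rw [neumannTerm_succ_minus, ← e]
      refine abs_broadSource_le hκ hγ hτm (by positivity) (fun t y hy => ?_) t (mirror_mem hx)
      rw [clampTo_of_mem hy]
      simp only [sourceMinus, Pi.zero_apply, PiLp.zero_apply, add_zero]
      exact (hKb _ (mirror_mem hy) _ _).2.trans (aux t _ (mirror_mem hy))

/-- Constant controls generate a state. -/
theorem exists_state (S : HyperbolicSystem) (v : Plane) :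
    ∃ r : ℝ → ℝ → Plane, ∀ T, S.IsBroad T (fun _ => v) 0 r := by
  obtain ⟨γ, hγ, hb⟩ := S.exists_neumann_bound
  set B := |v 0| + |v 1| with hB
  have hB0 : 0 ≤ B := by positivity
  set X := S.neumannTerm v with hX
  have hgeo : ∀ t : ℝ, HasSum (fun n : ℕ => B * (1 / 2) ^ n * Real.exp (γ * t))
      (B * 2 * Real.exp (γ * t)) := fun t =>
    (hasSum_geometric_two.mul_left B).mul_right _
  set r : ℝ → ℝ → Plane := fun t x =>
    !₂[∑' n, X n t (clampTo S.L x) 0, ∑' n, X n t (clampTo S.L x) 1] with hr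
  have hsum : ∀ t x i, HasSum (fun n => X n t (clampTo S.L x) i) (r t x i) := by
    intro t x i
    have : Summable fun n => X n t (clampTo S.L x) i :=
      Summable.of_norm_bounded (f := fun n => X n t (clampTo S.L x) i) (g := fun n : ℕ => B * (1 / 2) ^ n * Real.exp (γ * t))
        (hgeo t).summable fun n => hb v n t _ (clampTo_mem S.L_nonneg x) i
    fin_cases i
    · exact this.hasSum
    · exact this.hasSum
  have hsum' : ∀ t, ∀ x ∈ Icc 0 S.L, ∀ i, HasSum (fun n => X n t x i) (r t x i) := by
    intro t x hx i
    have := hsum t x i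
    rwa [clampTo_of_mem hx] at this
  have hXm : ∀ n, Measurable fun p : ℝ × ℝ => X n p.1 (clampTo S.L p.2) := fun n =>
    (measurable_neumannTerm v n).comp
      (measurable_fst.prodMk ((continuous_clampTo S.L).measurable.comp measurable_snd))
  have hrm : ∀ i, Measurable fun p : ℝ × ℝ => r p.1 p.2 i := by
    intro i
    refine measurable_of_tendsto_metrizable (f := fun N (p : ℝ × ℝ) =>
      ∑ n ∈ Finset.range N, X n p.1 (clampTo S.L p.2) i)
      (fun N => Finset.measurable_sum _ fun n _ => (measurable_coord i).comp (hXm n)) ?_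
    rw [tendsto_pi_nhds]
    exact fun p => (hsum p.1 p.2 i).tendsto_sum_nat
  have hrb : ∀ t x i, |r t x i| ≤ B * 2 * Real.exp (γ * t) := by
    intro t x i
    rw [← (hsum t x i).tsum_eq]
    exact tsum_of_norm_bounded (f := fun n => X n t (clampTo S.L x) i) (hgeo t) fun n => hb v n t _ (clampTo_mem S.L_nonneg x) i
  refine ⟨r, fun T => ⟨memLp_const v, MemLp.zero, ?_, ?_, ?_⟩⟩
  · refine MemLp.of_eval_piLp fun i => MemLp.of_bound (hrm i).aestronglyMeasurable
      (B * 2 * Real.exp (γ * T)) ?_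
    rw [rectMeasure_eq, ae_restrict_iff' (measurableSet_rect T S.L)]
    refine ae_of_all _ fun p hp => (hrb p.1 p.2 i).trans ?_
    have : p.1 ≤ T := hp.1.2.le
    gcongr
  · refine S.ae_rect (P := fun t x => r t x 0 = S.broadPlus (fun _ => v) 0 r t x)
      fun t _ x hx => ?_
    have h1 := hasSum_broadSource S.isTravelTime_tauPlus.continuous.measurable
      S.isTravelTime_tauPlus.monotoneOn (t := t) (x := x)
      (g := fun n t y => S.sourcePlus (X n) 0 t (clampTo S.L y)) (G := S.sourcePlus r 0)
      (fun n => measurable_sourcePlus_clamp (measurable_neumannTerm v n))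
      (β := fun n => (S.exists_couple_bound.choose * 2) * (B * (1 / 2) ^ n * Real.exp (γ * t)))
      ((hgeo t).summable.mul_left _) hx (fun n s hs y hy => by
        obtain ⟨hK, hKb⟩ := S.exists_couple_bound.choose_spec
        simp only [clampTo_of_mem hy, sourcePlus, Pi.zero_apply, PiLp.zero_apply, add_zero]
        refine (hKb y hy _ _).1.trans ?_
        rw [mul_assoc]
        refine mul_le_mul_of_nonneg_left ?_ hK.le
        have e : Real.exp (γ * s) ≤ Real.exp (γ * t) := by gcongr
        have := mul_le_mul_of_nonneg_left e (by positivity : 0 ≤ B * (1 / 2 : ℝ) ^ n)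
        linarith [hb v n s y hy 0, hb v n s y hy 1]) (fun s y hy => by
        simp only [clampTo_of_mem hy, sourcePlus, couplePlus_eq, Pi.zero_apply, PiLp.zero_apply,
          add_zero]
        exact ((hsum' s y hy 0).mul_left _).add ((hsum' s y hy 1).mul_left _))
    -- The terms from index one on sum to `r` minus the zeroth term and also to the source integral
    -- of `r`; uniqueness of the sum is the equation for `r`.
    have h2 := (hasSum_nat_add_iff' 1).2 (hsum' t x hx 0)
    have h3 := h1.unique h2
    simp only [Finset.range_one, Finset.sum_singleton] at h3
    have h4 : r t x 0 = X 0 t x 0 + broadSource S.tauPlus (S.sourcePlus r 0) t x := by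
      rw [h3]; ring
    exact h4
  · refine S.ae_rect (P := fun t x => r t x 1 = S.broadMinus (fun _ => v) 0 r t (S.L - x))
      fun t _ x hx => ?_
    have h1 := hasSum_broadSource S.isTravelTime_tauMinus.continuous.measurable
      S.isTravelTime_tauMinus.monotoneOn (t := t) (x := S.L - x)
      (g := fun n t y => S.sourceMinus (X n) 0 t (clampTo S.L y)) (G := S.sourceMinus r 0)
      (fun n => measurable_sourceMinus_clamp (measurable_neumannTerm v n))
      (β := fun n => (S.exists_couple_bound.choose * 2) * (B * (1 / 2) ^ n * Real.exp (γ * t)))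
      ((hgeo t).summable.mul_left _) (mirror_mem hx) (fun n s hs y hy => by
        obtain ⟨hK, hKb⟩ := S.exists_couple_bound.choose_spec
        simp only [clampTo_of_mem hy, sourceMinus, Pi.zero_apply, PiLp.zero_apply, add_zero]
        have hy' := mirror_mem hy
        refine (hKb _ hy' _ _).2.trans ?_
        rw [mul_assoc]
        refine mul_le_mul_of_nonneg_left ?_ hK.le
        have e : Real.exp (γ * s) ≤ Real.exp (γ * t) := by gcongr
        have := mul_le_mul_of_nonneg_left e (by positivity : 0 ≤ B * (1 / 2 : ℝ) ^ n)
        linarith [hb v n s _ hy' 0, hb v n s _ hy' 1]) (fun s y hy => by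
        have hy' := mirror_mem hy
        simp only [clampTo_of_mem hy, sourceMinus, coupleMinus_eq, Pi.zero_apply, PiLp.zero_apply,
          add_zero]
        exact ((hsum' s _ hy' 0).mul_left _).add ((hsum' s _ hy' 1).mul_left _))
    have h2 := (hasSum_nat_add_iff' 1).2 (hsum' t x hx 1)
    have h3 := h1.unique h2
    simp only [Finset.range_one, Finset.sum_singleton] at h3
    have h4 : r t x 1 = X 0 t x 1 + broadSource S.tauMinus (S.sourceMinus r 0) t (S.L - x) := by
      rw [h3]; ring
    exact h4

end HyperbolicSystem

/-! ### Linearity of the solution formula and profiles that are switched on smoothly. -/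

/-- The integrand in the solution formula. -/
noncomputable def charSource (τ : ℝ → ℝ) (g : ℝ → ℝ → ℝ) (t x y : ℝ) : ℝ :=
  if τ x - τ y < t then g (t - (τ x - τ y)) y else 0

namespace IsTravelTime
variable {T L : ℝ} {τ : ℝ → ℝ} {g : ℝ → ℝ → ℝ}

theorem charSource_integrable_of_entry (hτ : IsTravelTime L τ) {t x : ℝ} (hx : x ∈ Icc 0 L)
    (ht : t < T) (h : Integrable fun y => entry T L τ g (t - τ x) y) :
    IntervalIntegrable (charSource τ g t x) volume 0 x := by
  refine (h.intervalIntegrable (a := 0) (b := x)).congr_ae ?_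
  rw [uIoc_of_le hx.1]
  refine (ae_restrict_iff' measurableSet_Ioc).2 ?_
  have hne : ∀ᵐ y : ℝ, y ≠ L := by simp [ae_iff, measure_singleton]
  filter_upwards [hne] with y hyL hy
  have hyx : τ y ≤ τ x := hτ.monotoneOn ⟨hy.1.le, hy.2.trans hx.2⟩ hx hy.2
  rw [entry_eq, charSource]
  have e : t - τ x + τ y = t - (τ x - τ y) := by ring
  rw [e]
  refine if_congr ⟨fun h => by linarith [h.1.1], fun h => ⟨⟨by linarith, by linarith⟩, hy.1, ?_⟩⟩
    rfl rfl
  exact lt_of_le_of_ne (hy.2.trans hx.2) hyL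

/-- The solution formula is additive in the source only where its integrand is integrable. Fubini in
entry coordinates provides this for almost every characteristic. -/
theorem ae_integrable_charSource (hτ : IsTravelTime L τ)
    (hg : Integrable (Function.uncurry g) (rectMeasure T L)) :
    ∀ᵐ p : ℝ × ℝ ∂(rectMeasure T L),
      IntervalIntegrable (charSource τ g p.1 p.2) volume 0 p.2 := by
  have h1 := (integrable_entry hτ.continuous.measurable hg).prod_right_ae
  have h2 := (measurePreserving_shear (τ := fun x => -τ x)
    hτ.continuous.measurable.neg).quasiMeasurePreserving.ae
    (Measure.quasiMeasurePreserving_fst.ae h1)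
  rw [rectMeasure_eq]
  filter_upwards [ae_restrict_of_ae h2, ae_restrict_mem (measurableSet_rect T L)] with p hp hpm
  refine hτ.charSource_integrable_of_entry (T := T) (Ioo_subset_Icc_self hpm.2) hpm.1.2 ?_
  simpa [shear, ← sub_eq_add_neg, Function.uncurry] using hp

/-- The outflow traces live at one fixed position, a null set of the rectangle, so they need their
own version. -/
theorem ae_integrable_charSource_right (hτ : IsTravelTime L τ)
    (hg : Integrable (Function.uncurry g) (rectMeasure T L)) {x : ℝ} (hx : x ∈ Icc 0 L) :
    ∀ᵐ t ∂(volume.restrict (Ioo 0 T)), IntervalIntegrable (charSource τ g t x) volume 0 x := by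
  have h1 := (integrable_entry hτ.continuous.measurable hg).prod_right_ae
  have h2 := (measurePreserving_sub_right (volume : Measure ℝ)
    (τ x)).quasiMeasurePreserving.ae h1
  filter_upwards [ae_restrict_of_ae h2, ae_restrict_mem measurableSet_Ioo] with t ht htm
  exact hτ.charSource_integrable_of_entry (T := T) hx htm.2 ht

end IsTravelTime

theorem broad_sub {τ w w' : ℝ → ℝ} {g g' : ℝ → ℝ → ℝ} {t x : ℝ}
    (h : IntervalIntegrable (charSource τ g t x) volume 0 x)
    (h' : IntervalIntegrable (charSource τ g' t x) volume 0 x) :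
    broad τ (fun s => w s - w' s) (fun s y => g s y - g' s y) t x
      = broad τ w g t x - broad τ w' g' t x := by
  have e := intervalIntegral.integral_sub h h'
  have e2 : ∀ y, charSource τ g t x y - charSource τ g' t x y
      = charSource τ (fun s y => g s y - g' s y) t x y := by
    intro y
    unfold charSource
    split_ifs <;> simp
  simp only [e2] at e
  change (if τ x < t then w (t - τ x) - w' (t - τ x) else 0)
    + (∫ y in (0 : ℝ)..x, charSource τ (fun s y => g s y - g' s y) t x y)
    = (if τ x < t then w (t - τ x) else 0) + (∫ y in (0 : ℝ)..x, charSource τ g t x y)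
      - ((if τ x < t then w' (t - τ x) else 0) + ∫ y in (0 : ℝ)..x, charSource τ g' t x y)
  rw [e]
  split_ifs <;> ring

theorem broad_congr {τ w w' : ℝ → ℝ} {g g' : ℝ → ℝ → ℝ} {t x L : ℝ} (hx : x ∈ Icc 0 L)
    (hw : ∀ s, w s = w' s) (hg : ∀ s, ∀ y ∈ Icc 0 L, g s y = g' s y) :
    broad τ w g t x = broad τ w' g' t x := by
  unfold broad
  rw [hw]
  congr 1
  apply intervalIntegral.integral_congr
  intro y hy
  rw [uIcc_of_le hx.1] at hy
  simp only [hg _ y ⟨hy.1, hy.2.trans hx.2⟩]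

/-- The value zero is minimal, so Fermat's rule applies, the endpoint included. -/
theorem smoothTransition_deriv_of_nonpos {s : ℝ} (hs : s ≤ 0) :
    deriv Real.smoothTransition s = 0 := by
  apply IsLocalMin.deriv_eq_zero
  refine Eventually.of_forall fun z => ?_
  simp only [Real.smoothTransition.zero_of_nonpos hs]
  exact Real.smoothTransition.nonneg z

theorem smoothTransition_deriv_of_one_le {s : ℝ} (hs : 1 ≤ s) :
    deriv Real.smoothTransition s = 0 := by
  apply IsLocalMax.deriv_eq_zero
  refine Eventually.of_forall fun z => ?_
  simp only [Real.smoothTransition.one_of_one_le hs]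
  exact Real.smoothTransition.le_one z

theorem contDiff_smoothTransition : ContDiff ℝ 1 Real.smoothTransition :=
  Real.smoothTransition.contDiff

theorem continuous_deriv_smoothTransition : Continuous (deriv Real.smoothTransition) :=
  contDiff_smoothTransition.continuous_deriv le_rfl

theorem integrable_deriv_smoothTransition_sq :
    Integrable fun s => deriv Real.smoothTransition s ^ 2 := by
  refine (continuous_deriv_smoothTransition.pow 2).integrable_of_hasCompactSupport
    (HasCompactSupport.intro (isCompact_Icc (a := (0 : ℝ)) (b := 1)) fun x hx => ?_)
  rcases le_or_gt x 0 with h | h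
  · simp [smoothTransition_deriv_of_nonpos h]
  · have : 1 ≤ x := by
      by_contra hc
      exact hx ⟨h.le, (not_le.1 hc).le⟩
    simp [smoothTransition_deriv_of_one_le this]

theorem setIntegral_one_sub_smoothTransition_sq_le (T : ℝ) :
    IntegrableOn (fun s => (1 - Real.smoothTransition s) ^ 2) (Ioo 0 T) ∧
    ∫ s in Ioo 0 T, (1 - Real.smoothTransition s) ^ 2 ≤ 1 := by
  have hc : Continuous fun s => (1 - Real.smoothTransition s) ^ 2 :=
    (continuous_const.sub contDiff_smoothTransition.continuous).pow 2
  have hi : IntegrableOn (fun s => (1 - Real.smoothTransition s) ^ 2) (Ioo 0 T) :=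
    (hc.integrableOn_Icc (a := 0) (b := T)).mono_set Ioo_subset_Icc_self
  refine ⟨hi, ?_⟩
  have hind : Integrable ((Ioo (0 : ℝ) 1).indicator fun _ => (1 : ℝ)) :=
    (integrable_indicator_iff measurableSet_Ioo).2 (by simp)
  calc ∫ s in Ioo 0 T, (1 - Real.smoothTransition s) ^ 2
      ≤ ∫ s in Ioo 0 T, (Ioo (0 : ℝ) 1).indicator (fun _ => (1 : ℝ)) s := by
        apply setIntegral_mono_on hi hind.integrableOn measurableSet_Ioo
        intro s hs
        by_cases h : s < 1
        · rw [indicator_of_mem (show s ∈ Ioo (0 : ℝ) 1 from ⟨hs.1, h⟩)]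
          have h1 := Real.smoothTransition.nonneg s
          have h2 := Real.smoothTransition.le_one s
          nlinarith
        · rw [Real.smoothTransition.one_of_one_le (not_lt.1 h)]
          simp only [sub_self, ne_eq, OfNat.ofNat_ne_zero, not_false_eq_true, zero_pow]
          exact indicator_nonneg (fun _ _ => zero_le_one) _
    _ ≤ ∫ s, (Ioo (0 : ℝ) 1).indicator (fun _ => (1 : ℝ)) s :=
        setIntegral_le_integral hind (ae_of_all _ fun s => indicator_nonneg (fun _ _ => zero_le_one) _)
    _ = 1 := by rw [integral_indicator measurableSet_Ioo]; simp

/-- A stationary profile that is switched on smoothly solves the transport equation with an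
additional source. -/
theorem IsTravelTime.broad_switch_on {L : ℝ} {τ δ ρ k : ℝ → ℝ} (hτ : IsTravelTime L τ)
    (hτ' : ∀ y ∈ Ioo 0 L, HasDerivAt τ (δ y) y) (hδ : ContinuousOn δ (Icc 0 L))
    (hρ : ContinuousOn ρ (Icc 0 L)) (hρ' : ∀ y ∈ Ioo 0 L, HasDerivAt ρ (k y) y)
    (hk : ContinuousOn k (Icc 0 L)) (t : ℝ) {x : ℝ} (hx : x ∈ Icc 0 L) :
    IntervalIntegrable (charSource τ (fun s y => Real.smoothTransition s * k y
      + deriv Real.smoothTransition s * (ρ y * δ y)) t x) volume 0 x ∧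
    broad τ (fun s => Real.smoothTransition s * ρ 0) (fun s y => Real.smoothTransition s * k y
      + deriv Real.smoothTransition s * (ρ y * δ y)) t x = Real.smoothTransition t * ρ x := by
  set χ := Real.smoothTransition with hχ
  have hs : Icc 0 x ⊆ Icc 0 L := Icc_subset_Icc_right hx.2
  have hσ : Continuous fun y => t - (τ x - τ y) := by
    have := hτ.continuous
    fun_prop
  set φ' : ℝ → ℝ := fun y => χ (t - (τ x - τ y)) * k y
    + deriv χ (t - (τ x - τ y)) * (ρ y * δ y) with hφ'
  -- The cut-off at time zero is invisible, since the transition and its derivative vanish at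
  -- nonpositive times.
  have hc : ∀ y, charSource τ (fun s y => χ s * k y + deriv χ s * (ρ y * δ y)) t x y = φ' y := by
    intro y
    unfold charSource
    split_ifs with h
    · rfl
    · have : t - (τ x - τ y) ≤ 0 := by linarith
      simp only [hφ', hχ, Real.smoothTransition.zero_of_nonpos this,
        smoothTransition_deriv_of_nonpos this, zero_mul, add_zero]
  have hcf : charSource τ (fun s y => χ s * k y + deriv χ s * (ρ y * δ y)) t x = φ' := funext hc
  have hφc : ContinuousOn φ' (Icc 0 x) :=
    ((contDiff_smoothTransition.continuous.comp hσ).continuousOn.mul (hk.mono hs)).add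
      ((continuous_deriv_smoothTransition.comp hσ).continuousOn.mul
        ((hρ.mono hs).mul (hδ.mono hs)))
  have hφi : IntervalIntegrable φ' volume 0 x := hφc.intervalIntegrable_of_Icc hx.1
  refine ⟨hcf ▸ hφi, ?_⟩
  -- The integrand is the derivative of the switched-on profile along the characteristic.
  have hft := intervalIntegral.integral_eq_sub_of_hasDerivAt_of_le (f' := φ')
    (f := fun y => χ (t - (τ x - τ y)) * ρ y) hx.1
    ((contDiff_smoothTransition.continuous.comp hσ).continuousOn.mul (hρ.mono hs))
    (fun y hy => by
      have hyL : y ∈ Ioo 0 L := ⟨hy.1, hy.2.trans_le hx.2⟩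
      have d1 : HasDerivAt (fun y => t - (τ x - τ y)) (δ y) y := by
        simpa using ((hτ' y hyL).const_sub (τ x)).const_sub t
      have d2 : HasDerivAt χ (deriv χ (t - (τ x - τ y))) (t - (τ x - τ y)) :=
        (contDiff_smoothTransition.differentiable one_ne_zero _).hasDerivAt
      have d3 := (d2.comp y d1).mul (hρ' y hyL)
      convert! d3 using 1
      simp only [hφ', Function.comp_apply]
      ring) hφi
  change (if τ x < t then χ (t - τ x) * ρ 0 else 0)
    + (∫ y in (0 : ℝ)..x, charSource τ (fun s y => χ s * k y + deriv χ s * (ρ y * δ y)) t x y) = _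
  rw [hcf, hft, hτ.zero, sub_self, sub_zero, sub_zero]
  split_ifs with h
  · ring
  · rw [hχ, Real.smoothTransition.zero_of_nonpos (show t - τ x ≤ 0 by linarith)]
    ring

namespace HyperbolicSystem
variable (S : HyperbolicSystem)

theorem hasDerivAt_tauPlus {y : ℝ} (hy : y ∈ Ioo 0 S.L) :
    HasDerivAt S.tauPlus (1 / S.dPlus y) y := by
  have hn : Icc 0 S.L ∈ nhds y := Icc_mem_nhds hy.1 hy.2
  have hc := S.continuousOn_inv_dPlus
  have hd : HasDerivAt S.timePlus (1 / S.dPlus y) y :=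
    intervalIntegral.integral_hasDerivAt_right
      ((hc.mono (Icc_subset_Icc_right hy.2.le)).intervalIntegrable_of_Icc hy.1.le)
      (hc.stronglyMeasurableAtFilter_nhdsWithin measurableSet_Icc y |>.filter_mono
        (by rw [nhdsWithin_eq_nhds.2 hn])) (hc.continuousAt hn)
  refine hd.congr_of_eventuallyEq (Filter.eventually_of_mem hn fun z hz => ?_)
  unfold tauPlus
  rw [clampTo_of_mem hz]

theorem hasDerivAt_tauMinus {y : ℝ} (hy : y ∈ Ioo 0 S.L) :
    HasDerivAt S.tauMinus (1 / |S.dMinus (S.L - y)|) y := by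
  have hn : Icc 0 S.L ∈ nhds y := Icc_mem_nhds hy.1 hy.2
  have hy1 : 0 < S.L - y := by linarith [hy.2]
  have hy2 : S.L - y < S.L := by linarith [hy.1]
  have hn' : Icc 0 S.L ∈ nhds (S.L - y) := Icc_mem_nhds hy1 hy2
  have hc := S.continuousOn_inv_dMinus
  have hd : HasDerivAt S.timeMinus (-(1 / |S.dMinus (S.L - y)|)) (S.L - y) :=
    intervalIntegral.integral_hasDerivAt_left
      ((hc.mono (Icc_subset_Icc_left hy1.le)).intervalIntegrable_of_Icc hy2.le)
      (hc.stronglyMeasurableAtFilter_nhdsWithin measurableSet_Icc _ |>.filter_mono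
        (by rw [nhdsWithin_eq_nhds.2 hn'])) (hc.continuousAt hn')
  have hd2 : HasDerivAt (fun z => S.timeMinus (S.L - z)) (1 / |S.dMinus (S.L - y)|) y := by
    have := hd.comp y ((hasDerivAt_id y).const_sub S.L)
    simpa [Function.comp_def] using this
  refine hd2.congr_of_eventuallyEq (Filter.eventually_of_mem hn fun z hz => ?_)
  unfold tauMinus
  rw [clampTo_of_mem hz]

/-- The source that results from switching on the stationary profile `R`. -/
noncomputable def switchProfile (R : ℝ → Plane) (x : ℝ) : Plane :=
  !₂[-(R x 0 * (1 / S.dPlus x)), -(R x 1 * (1 / |S.dMinus x|))]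

variable {S}

theorem continuousOn_switchProfile {R : ℝ → Plane} (hR : ContinuousOn R (Icc 0 S.L)) :
    ContinuousOn (S.switchProfile R) (Icc 0 S.L) := by
  have : ContinuousOn (fun x => (![-(R x 0 * (1 / S.dPlus x)), -(R x 1 * (1 / |S.dMinus x|))] :
      Fin 2 → ℝ)) (Icc 0 S.L) := by
    refine continuousOn_pi.2 fun i => ?_
    fin_cases i
    · exact ((continuousOn_coord hR 0).mul S.continuousOn_inv_dPlus).neg
    · exact ((continuousOn_coord hR 1).mul S.continuousOn_inv_dMinus).neg
  exact (PiLp.continuous_toLp 2 _).comp_continuousOn this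

theorem memLp_switch {T : ℝ} {F : ℝ → Plane} (hF : ContinuousOn F (Icc 0 S.L)) {χ : ℝ → ℝ}
    (hχ : Continuous χ) :
    MemLp (Function.uncurry fun t x => χ t • F x) 2 (rectMeasure T S.L) := by
  obtain ⟨C, hC⟩ := isCompact_Icc.exists_bound_of_continuousOn hF
  obtain ⟨B, hB⟩ := (isCompact_Icc (a := (0 : ℝ)) (b := T)).exists_bound_of_continuousOn
    hχ.continuousOn
  have m1 : AEStronglyMeasurable F (volume.restrict (Ioo 0 S.L)) :=
    (hF.mono Ioo_subset_Icc_self).aestronglyMeasurable measurableSet_Ioo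
  have m2 : AEStronglyMeasurable (fun p : ℝ × ℝ => F p.2) (rectMeasure T S.L) := m1.comp_snd
  refine MemLp.of_bound ((hχ.comp continuous_fst).aestronglyMeasurable.smul m2) (B * C) ?_
  rw [rectMeasure_eq, ae_restrict_iff' (measurableSet_rect T S.L)]
  refine ae_of_all _ fun p hp => ?_
  have b1 := hB _ (Ioo_subset_Icc_self hp.1)
  change ‖χ p.1 • F p.2‖ ≤ _
  rw [norm_smul]
  exact mul_le_mul b1 (hC _ (Ioo_subset_Icc_self hp.2)) (norm_nonneg _) ((norm_nonneg _).trans b1)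

/-- The deviation from a stationary profile that is switched on smoothly. -/
theorem IsStaticIntegral.isBroad_sub {v : Plane} {R : ℝ → Plane} (hR : S.IsStaticIntegral v R)
    {T : ℝ} {u : ℝ → Plane} {r : ℝ → ℝ → Plane} (hr : S.IsBroad T u 0 r) :
    let w : ℝ → Plane := fun t => u t - Real.smoothTransition t • v
    let q : ℝ → ℝ → Plane := fun t x => r t x - Real.smoothTransition t • R x
    let f : ℝ → ℝ → Plane := fun t x => deriv Real.smoothTransition t • S.switchProfile R x
    S.IsBroad T w f q ∧ (∀ᵐ t ∂(volume.restrict (Ioo 0 T)),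
      S.broadPlus w f q t S.L = S.broadPlus u 0 r t S.L - Real.smoothTransition t * R S.L 0 ∧
      S.broadMinus w f q t S.L = S.broadMinus u 0 r t S.L - Real.smoothTransition t * R 0 1) := by
  intro w q f
  set χ := Real.smoothTransition with hχ
  have hχc : Continuous χ := contDiff_smoothTransition.continuous
  have hode := fun x (hx : x ∈ Ioo 0 S.L) => hR.isStaticState.hasDerivAt hx
  have hgp := (memLp_sourcePlus hr.source hr.state).integrable one_le_two
  have hgm := (memLp_sourceMinus hr.source hr.state).integrable one_le_two
  have hR0 : R 0 0 = v 0 := hR.isStaticState.plus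
  have hR1 : R S.L 1 = v 1 := hR.isStaticState.minus
  have swp := fun t x (hx : x ∈ Icc 0 S.L) => S.isTravelTime_tauPlus.broad_switch_on
    (fun y hy => S.hasDerivAt_tauPlus hy) S.continuousOn_inv_dPlus
    (continuousOn_coord hR.continuousOn 0) (fun y hy => (hode y hy).1)
    (continuousOn_couplePlus hR.continuousOn) t hx
  have hodem : ∀ y ∈ Ioo 0 S.L, HasDerivAt (fun y => R (S.L - y) 1)
      (S.coupleMinus (S.L - y) (R (S.L - y) 0) (R (S.L - y) 1)) y := by
    intro y hy
    have := (hode (S.L - y) ⟨by linarith [hy.2], by linarith [hy.1]⟩).2.comp y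
      ((hasDerivAt_id y).const_sub S.L)
    simpa [Function.comp_def] using this
  have swm := fun t x (hx : x ∈ Icc 0 S.L) => S.isTravelTime_tauMinus.broad_switch_on
    (fun y hy => S.hasDerivAt_tauMinus hy) (continuousOn_mirror S.continuousOn_inv_dMinus)
    (continuousOn_mirror (continuousOn_coord hR.continuousOn 1)) hodem
    (continuousOn_mirror (continuousOn_coupleMinus hR.continuousOn)) t hx
  -- The formula for the deviation is the difference of those for `r` and for the switched-on
  -- profile; the source in `f` compensates the time derivative of the transition.
  have eqp : ∀ t, ∀ x ∈ Icc 0 S.L,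
      IntervalIntegrable (charSource S.tauPlus (S.sourcePlus r 0) t x) volume 0 x →
      S.broadPlus w f q t x = S.broadPlus u 0 r t x - χ t * R x 0 := by
    intro t x hx hi
    rw [← (swp t x hx).2]
    unfold broadPlus
    rw [← broad_sub hi (swp t x hx).1]
    refine broad_congr hx (fun s => ?_) fun s y hy => ?_
    · simp only [w, PiLp.sub_apply, PiLp.smul_apply, smul_eq_mul, hR0]
    · simp only [sourcePlus, q, f, switchProfile, couplePlus_eq, PiLp.sub_apply, PiLp.smul_apply,
        smul_eq_mul, Pi.zero_apply, PiLp.zero_apply, Matrix.cons_val_zero]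
      ring
  have eqm : ∀ t, ∀ x ∈ Icc 0 S.L,
      IntervalIntegrable (charSource S.tauMinus (S.sourceMinus r 0) t x) volume 0 x →
      S.broadMinus w f q t x = S.broadMinus u 0 r t x - χ t * R (S.L - x) 1 := by
    intro t x hx hi
    rw [← (swm t x hx).2]
    unfold broadMinus
    rw [← broad_sub hi (swm t x hx).1]
    refine broad_congr hx (fun s => ?_) fun s y hy => ?_
    · simp only [w, PiLp.sub_apply, PiLp.smul_apply, smul_eq_mul, sub_zero, hR1]
    · simp only [sourceMinus, q, f, switchProfile, coupleMinus_eq, PiLp.sub_apply,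
        PiLp.smul_apply, smul_eq_mul, Pi.zero_apply, PiLp.zero_apply, Matrix.cons_val_one,
        Matrix.cons_val_fin_one]
      ring
  refine ⟨⟨?_, memLp_switch (continuousOn_switchProfile hR.continuousOn)
    continuous_deriv_smoothTransition, hr.state.sub (memLp_switch hR.continuousOn hχc), ?_, ?_⟩, ?_⟩
  · refine hr.inflow.sub (MemLp.of_bound (C := ‖v‖)
      (hχc.smul continuous_const).aestronglyMeasurable (ae_of_all _ fun t => ?_))
    rw [norm_smul, Real.norm_eq_abs, abs_of_nonneg (Real.smoothTransition.nonneg t)]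
    exact mul_le_of_le_one_left (norm_nonneg _) (Real.smoothTransition.le_one t)
  · have hm := S.ae_rect (T := T) (P := fun t x =>
      IntervalIntegrable (charSource S.tauPlus (S.sourcePlus r 0) t x) volume 0 x →
      S.broadPlus w f q t x = S.broadPlus u 0 r t x - χ t * R x 0) fun t _ x hx => eqp t x hx
    filter_upwards [hm, S.isTravelTime_tauPlus.ae_integrable_charSource hgp, hr.plus]
      with p h1 h2 h3
    rw [h1 h2, ← h3]
    simp only [q, PiLp.sub_apply, PiLp.smul_apply, smul_eq_mul, hχ]
  · have hm := S.ae_rect (T := T) (P := fun t x =>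
      IntervalIntegrable (charSource S.tauMinus (S.sourceMinus r 0) t (S.L - x)) volume 0
        (S.L - x) →
      S.broadMinus w f q t (S.L - x) = S.broadMinus u 0 r t (S.L - x) - χ t * R (S.L - (S.L - x)) 1)
      fun t _ x hx => eqm t _ (mirror_mem hx)
    have hi := (measurePreserving_mirror T S.L).quasiMeasurePreserving.ae
      (S.isTravelTime_tauMinus.ae_integrable_charSource hgm)
    filter_upwards [hm, hi, hr.minus] with p h1 h2 h3
    rw [h1 h2, ← h3]
    simp only [q, PiLp.sub_apply, PiLp.smul_apply, smul_eq_mul, sub_sub_cancel, hχ]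
  · have hL := right_mem_Icc.2 S.L_nonneg
    filter_upwards [S.isTravelTime_tauPlus.ae_integrable_charSource_right hgp hL,
      S.isTravelTime_tauMinus.ae_integrable_charSource_right hgm hL] with t h1 h2
    refine ⟨eqp t _ hL h1, ?_⟩
    rw [eqm t _ hL h2, sub_self]

end HyperbolicSystem

/-! ### Deviation estimates uniform in the horizon, and time integrals of the outflow. -/

theorem norm_add_sq_le_two {E : Type*} [SeminormedAddCommGroup E] (a b : E) :
    ‖a + b‖ ^ 2 ≤ 2 * ‖a‖ ^ 2 + 2 * ‖b‖ ^ 2 := by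
  have h := norm_add_le a b
  have h0 := norm_nonneg (a + b)
  nlinarith [sq_nonneg (‖a‖ - ‖b‖), norm_nonneg a, norm_nonneg b]

theorem slab_setIntegral_le {T τ c : ℝ} (hτ : 0 ≤ τ) (hc : 0 ≤ c) :
    IntegrableOn ((Ici (T - τ)).indicator fun _ => c) (Ioo 0 T) ∧
    ∫ t in Ioo 0 T, (Ici (T - τ)).indicator (fun _ => c) t ≤ c * τ := by
  refine ⟨(integrable_const c).indicator measurableSet_Ici, ?_⟩
  rw [integral_indicator measurableSet_Ici, Measure.restrict_restrict measurableSet_Ici,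
    integral_const, smul_eq_mul, mul_comm]
  refine mul_le_mul_of_nonneg_left ?_ hc
  have h : Ici (T - τ) ∩ Ioo 0 T ⊆ Icc (T - τ) T := fun x hx => ⟨hx.1, hx.2.2.le⟩
  rw [measureReal_restrict_apply_univ]
  refine (measureReal_mono h (by simp)).trans ?_
  rw [Real.volume_real_Icc_of_le (by linarith)]
  linarith

/-- Only the constant `c` profits from the shortness of the final slab. The term with `n` is
integrated over the whole rectangle and is made small by `δ` instead. -/
theorem slab_integral_le {T L τ c δ : ℝ} (hL : 0 ≤ L) (hτ : 0 ≤ τ) (hc : 0 ≤ c) (hδ : 0 ≤ δ)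
    {g : ℝ → ℝ → ℝ} {n : ℝ × ℝ → ℝ} (hn : Integrable n (rectMeasure T L)) (hn0 : ∀ p, 0 ≤ n p)
    (hle : ∀ᵐ p ∂(rectMeasure T L), |g p.1 p.2| ≤ c + δ * n p) :
    ∫ p, (Function.uncurry fun t y => (Ici (T - τ)).indicator (fun t => |g t y|) t) p
      ∂(rectMeasure T L) ≤ c * τ * L + δ * ∫ p, n p ∂(rectMeasure T L) := by
  obtain ⟨i1, e1⟩ := slab_setIntegral_le (T := T) hτ hc
  have hi : Integrable (fun p : ℝ × ℝ => (Ici (T - τ)).indicator (fun _ => c) p.1 * (1 : ℝ))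
      (rectMeasure T L) := Integrable.mul_prod i1 (integrable_const (1 : ℝ))
  have hmain := integral_mono_of_nonneg (μ := rectMeasure T L)
    (f := Function.uncurry fun t y => (Ici (T - τ)).indicator (fun t => |g t y|) t)
    (ae_of_all _ fun p => indicator_nonneg (fun _ _ => abs_nonneg _) _)
    (hi.add (hn.const_mul δ)) (by
      filter_upwards [hle] with p hp
      simp only [Pi.add_apply, Function.uncurry, mul_one]
      by_cases h : p.1 ∈ Ici (T - τ)
      · rw [indicator_of_mem h, indicator_of_mem h]; exact hp
      · rw [indicator_of_notMem h, indicator_of_notMem h, zero_add]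
        exact mul_nonneg hδ (hn0 p))
  refine hmain.trans ?_
  have e2 := integral_add hi (hn.const_mul δ)
  have e3 : ∫ p : ℝ × ℝ, (Ici (T - τ)).indicator (fun _ => c) p.1 * (1 : ℝ) ∂(rectMeasure T L)
      = (∫ t in Ioo 0 T, (Ici (T - τ)).indicator (fun _ => c) t) * ∫ y in Ioo 0 L, (1 : ℝ) :=
    integral_prod_mul (μ := volume.restrict (Ioo 0 T)) (ν := volume.restrict (Ioo 0 L))
      ((Ici (T - τ)).indicator fun _ => c) fun _ => (1 : ℝ)
  have e4 : ∫ y in Ioo 0 L, (1 : ℝ) = L := by simp [hL]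
  simp only [Pi.add_apply]
  rw [e2, e3, e4, integral_const_mul]
  exact add_le_add (mul_le_mul_of_nonneg_right e1 hL) le_rfl

theorem slab_setIntegral_abs_le {T τ c δ : ℝ} (hτ : 0 ≤ τ) (hc : 0 ≤ c) (hδ : 0 ≤ δ)
    {g n : ℝ → ℝ} (hn : IntegrableOn n (Ioo 0 T)) (hn0 : ∀ t, 0 ≤ n t)
    (hle : ∀ t, |g t| ≤ c + δ * n t) :
    ∫ t in Ioo 0 T, (Ici (T - τ)).indicator (fun t => |g t|) t
      ≤ c * τ + δ * ∫ t in Ioo 0 T, n t := by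
  obtain ⟨i1, e1⟩ := slab_setIntegral_le (T := T) hτ hc
  have hmain := integral_mono_of_nonneg (μ := volume.restrict (Ioo 0 T))
    (f := (Ici (T - τ)).indicator fun t => |g t|)
    (ae_of_all _ fun p => indicator_nonneg (fun _ _ => abs_nonneg _) _)
    (i1.add (Integrable.const_mul hn δ)) (by
      refine ae_of_all _ fun t => ?_
      simp only [Pi.add_apply]
      by_cases h : t ∈ Ici (T - τ)
      · rw [indicator_of_mem h, indicator_of_mem h]; exact hle t
      · rw [indicator_of_notMem h, indicator_of_notMem h, zero_add]
        exact mul_nonneg hδ (hn0 t))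
  refine hmain.trans ?_
  have e2 := integral_add i1 (Integrable.const_mul hn δ)
  simp only [Pi.add_apply]
  rw [e2, integral_const_mul]
  exact add_le_add e1 le_rfl

/-- A completed square. It lets linear quantities in the final slab be bounded by a constant plus a
small multiple of the quadratic deviation. -/
theorem le_add_mul_sq {δ a : ℝ} (hδ : 0 < δ) : a ≤ 1 / (4 * δ) + δ * a ^ 2 := by
  have h : 0 ≤ (2 * δ * a - 1) ^ 2 / (4 * δ) := by positivity
  have e : (2 * δ * a - 1) ^ 2 / (4 * δ) = 1 / (4 * δ) + δ * a ^ 2 - a := by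
    field_simp
    ring
  linarith

theorem Plane.abs_le_norm (v : Plane) (i : Fin 2) : |v i| ≤ ‖v‖ := PiLp.norm_apply_le v i

namespace HyperbolicSystem
variable {S : HyperbolicSystem}

theorem integrable_norm_sub_sq {T : ℝ} {u : ℝ → Plane}
    (hu : MemLp u 2 (volume.restrict (Ioo 0 T))) (v : Plane) :
    IntegrableOn (fun t => ‖u t - v‖ ^ 2) (Ioo 0 T) :=
  (hu.sub (memLp_const v)).norm.integrable_sq

theorem memLp_profile {T : ℝ} {R : ℝ → Plane} (hR : ContinuousOn R (Icc 0 S.L)) :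
    MemLp (Function.uncurry fun _ x => R x) 2 (rectMeasure T S.L) := by
  have := memLp_switch (T := T) hR (χ := fun _ => 1) continuous_const
  simpa using this

theorem integrable_norm_sub_profile_sq {T : ℝ} {r : ℝ → ℝ → Plane} {R : ℝ → Plane}
    (hr : MemLp (Function.uncurry r) 2 (rectMeasure T S.L)) (hR : ContinuousOn R (Icc 0 S.L)) :
    Integrable (fun p : ℝ × ℝ => ‖r p.1 p.2 - R p.2‖ ^ 2) (rectMeasure T S.L) :=
  (hr.sub (memLp_profile hR)).norm.integrable_sq

theorem integral_switch_le {T : ℝ} (F : ℝ → Plane) {χ : ℝ → ℝ} {D : ℝ}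
    (hD : ∫ t in Ioo 0 T, χ t ^ 2 ≤ D) :
    ∫ p : ℝ × ℝ, ‖χ p.1 • F p.2‖ ^ 2 ∂(rectMeasure T S.L)
      ≤ D * ∫ x in Ioo 0 S.L, ‖F x‖ ^ 2 := by
  have e : ∀ p : ℝ × ℝ, ‖χ p.1 • F p.2‖ ^ 2 = χ p.1 ^ 2 * ‖F p.2‖ ^ 2 := fun p => by
    rw [norm_smul, mul_pow, Real.norm_eq_abs, sq_abs]
  simp_rw [e]
  have h := integral_prod_mul (μ := volume.restrict (Ioo 0 T)) (ν := volume.restrict (Ioo 0 S.L))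
    (fun t => χ t ^ 2) (fun x => ‖F x‖ ^ 2)
  rw [h]
  exact mul_le_mul_of_nonneg_right hD (integral_nonneg fun _ => sq_nonneg _)

/-- The deviation of a state from a stationary state is controlled by the deviation of the
control, uniformly in the time horizon. -/
theorem exists_deviation_estimate (hS : S.ForwardDissipative) {v : Plane} {R : ℝ → Plane}
    (hR : S.IsStaticIntegral v R) : ∃ C > 0, ∀ (T : ℝ) (u : ℝ → Plane) (r : ℝ → ℝ → Plane),
    S.IsBroad T u 0 r →
    (∫ t in Ioo 0 T, (S.broadPlus u 0 r t S.L - R S.L 0) ^ 2)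
      + (∫ t in Ioo 0 T, (S.broadMinus u 0 r t S.L - R 0 1) ^ 2)
      + ∫ p : ℝ × ℝ, ‖r p.1 p.2 - R p.2‖ ^ 2 ∂(rectMeasure T S.L)
    ≤ C * (1 + ∫ t in Ioo 0 T, ‖u t - v‖ ^ 2) := by
  obtain ⟨C, hC, hE⟩ := S.exists_energy hS
  set D := ∫ s, deriv Real.smoothTransition s ^ 2 with hD
  have hD0 : 0 ≤ D := integral_nonneg fun _ => sq_nonneg _
  set IF := ∫ x in Ioo 0 S.L, ‖S.switchProfile R x‖ ^ 2 with hIF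
  have hIF0 : 0 ≤ IF := integral_nonneg fun _ => sq_nonneg _
  set IR := ∫ x in Ioo 0 S.L, ‖R x‖ ^ 2 with hIR
  have hIR0 : 0 ≤ IR := integral_nonneg fun _ => sq_nonneg _
  refine ⟨2 * C * (2 + 2 * ‖v‖ ^ 2 + D * IF) + 2 * R S.L 0 ^ 2 + 2 * R 0 1 ^ 2 + 2 * IR,
    by positivity, fun T u r hr => ?_⟩
  -- The energy estimate presupposes zero initial values and is therefore applied to the deviation
  -- from the switched-on profile. Passing to `R` itself costs only the unit of time in which the
  -- transition may differ from one, hence a constant.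
  obtain ⟨hb, hout⟩ := hR.isBroad_sub hr
  have hEb := hE T _ _ _ hb
  obtain ⟨hχi, hχ1⟩ := setIntegral_one_sub_smoothTransition_sq_le T
  set χ := Real.smoothTransition with hχ
  have hχc : Continuous χ := contDiff_smoothTransition.continuous
  set w : ℝ → Plane := fun t => u t - χ t • v with hw
  set q : ℝ → ℝ → Plane := fun t x => r t x - χ t • R x with hq
  set f : ℝ → ℝ → Plane := fun t x => deriv χ t • S.switchProfile R x with hf
  have hL := right_mem_Icc.2 S.L_nonneg
  set W := ∫ t in Ioo 0 T, ‖u t - v‖ ^ 2 with hW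
  have hW0 : 0 ≤ W := integral_nonneg fun _ => sq_nonneg _
  have hwle : ∫ t in Ioo 0 T, ‖w t‖ ^ 2 ≤ 2 * W + 2 * ‖v‖ ^ 2 := by
    have i1 : IntegrableOn (fun t => ‖w t‖ ^ 2) (Ioo 0 T) := hb.inflow.norm.integrable_sq
    have i2 := integrable_norm_sub_sq hr.inflow v
    have h := integral_mono (μ := volume.restrict (Ioo 0 T)) i1
      ((Integrable.const_mul i2 2).add (Integrable.const_mul hχi (2 * ‖v‖ ^ 2))) fun t => by
        have e : w t = (u t - v) + (1 - χ t) • v := by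
          simp only [hw]; module
        have := norm_add_sq_le_two (u t - v) ((1 - χ t) • v)
        rw [← e, norm_smul, mul_pow, Real.norm_eq_abs, sq_abs] at this
        simp only [Pi.add_apply]
        linarith
    refine h.trans ?_
    have e2 := integral_add (Integrable.const_mul i2 2) (Integrable.const_mul hχi (2 * ‖v‖ ^ 2))
    simp only [Pi.add_apply]
    rw [e2, integral_const_mul, integral_const_mul]
    nlinarith [sq_nonneg ‖v‖]
  have hfle : ∫ p, ‖Function.uncurry f p‖ ^ 2 ∂(rectMeasure T S.L) ≤ D * IF :=
    integral_switch_le (S.switchProfile R)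
      (setIntegral_le_integral integrable_deriv_smoothTransition_sq
        (ae_of_all _ fun _ => sq_nonneg _))
  have outle : ∀ (o o' : ℝ → ℝ) (ρ : ℝ), MemLp o 2 (volume.restrict (Ioo 0 T)) →
      MemLp o' 2 (volume.restrict (Ioo 0 T)) →
      (∀ᵐ t ∂(volume.restrict (Ioo 0 T)), o' t = o t - χ t * ρ) →
      ∫ t in Ioo 0 T, (o t - ρ) ^ 2 ≤ 2 * (∫ t in Ioo 0 T, o' t ^ 2) + 2 * ρ ^ 2 := by
    intro o o' ρ ho ho' hae
    have i1 : IntegrableOn (fun t => (o t - ρ) ^ 2) (Ioo 0 T) :=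
      (ho.sub (memLp_const ρ)).integrable_sq
    have i2 : IntegrableOn (fun t => o' t ^ 2) (Ioo 0 T) := ho'.integrable_sq
    have h := integral_mono_ae (μ := volume.restrict (Ioo 0 T)) i1
      ((Integrable.const_mul i2 2).add (Integrable.const_mul hχi (2 * ρ ^ 2))) (by
        filter_upwards [hae] with t ht
        simp only [Pi.add_apply]
        rw [ht]
        nlinarith [sq_nonneg ((o t - χ t * ρ) + (1 - χ t) * ρ)])
    refine h.trans ?_
    have e2 := integral_add (Integrable.const_mul i2 2) (Integrable.const_mul hχi (2 * ρ ^ 2))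
    simp only [Pi.add_apply]
    rw [e2, integral_const_mul, integral_const_mul]
    nlinarith [sq_nonneg ρ]
  have o1 := outle _ _ _ (hr.memLp_outPlus hL) (hb.memLp_outPlus hL) (hout.mono fun t ht => ht.1)
  have o2 := outle _ _ _ (hr.memLp_outMinus hL) (hb.memLp_outMinus hL) (hout.mono fun t ht => ht.2)
  have stle : ∫ p : ℝ × ℝ, ‖r p.1 p.2 - R p.2‖ ^ 2 ∂(rectMeasure T S.L)
      ≤ 2 * (∫ p, ‖Function.uncurry q p‖ ^ 2 ∂(rectMeasure T S.L)) + 2 * IR := by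
    have i1 := integrable_norm_sub_profile_sq hr.state hR.continuousOn
    have i2 : Integrable (fun p => ‖Function.uncurry q p‖ ^ 2) (rectMeasure T S.L) :=
      hb.state.norm.integrable_sq
    have i3 : Integrable (fun p : ℝ × ℝ => ‖(1 - χ p.1) • R p.2‖ ^ 2) (rectMeasure T S.L) :=
      (memLp_switch (T := T) hR.continuousOn (χ := fun t => 1 - χ t)
        (continuous_const.sub hχc)).norm.integrable_sq
    have h := integral_mono i1 ((i2.const_mul 2).add (i3.const_mul 2)) fun p => by
      have e : r p.1 p.2 - R p.2 = Function.uncurry q p + -((1 - χ p.1) • R p.2) := by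
        simp only [hq, Function.uncurry]; module
      have := norm_add_sq_le_two (Function.uncurry q p) (-((1 - χ p.1) • R p.2))
      rw [← e, norm_neg] at this
      exact this
    refine h.trans ?_
    have e2 := integral_add (i2.const_mul 2) (i3.const_mul 2)
    have e3 := integral_switch_le (S := S) (T := T) R (χ := fun t => 1 - χ t) hχ1
    simp only [Pi.add_apply]
    rw [e2, integral_const_mul, integral_const_mul]
    linarith
  have hsum := mul_le_mul_of_nonneg_left (add_le_add hwle hfle) hC.le
  have n1 : 0 ≤ ‖v‖ ^ 2 * W := by positivity
  have n2 : 0 ≤ D * IF * W := by positivity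
  have n3 : 0 ≤ R S.L 0 ^ 2 * W := by positivity
  have n4 : 0 ≤ R 0 1 ^ 2 * W := by positivity
  have n5 : 0 ≤ IR * W := by positivity
  have n6 : 0 ≤ C * (‖v‖ ^ 2 * W) := by positivity
  have n7 : 0 ≤ C * (D * IF * W) := by positivity
  nlinarith [hsum, o1, o2, stle, hEb]

/-- The time integral of the outflow is, up to a bounded error, the stationary response to the
time integral of the control. -/
theorem exists_mean_outflow (hS : S.ForwardDissipative) : ∃ H : Matrix (Fin 2) (Fin 2) ℝ,
    (∀ v R, S.IsStaticIntegral v R →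
      R S.L 0 = H 0 0 * v 0 + H 0 1 * v 1 ∧ R 0 1 = H 1 0 * v 0 + H 1 1 * v 1) ∧
    ∀ v R, S.IsStaticIntegral v R → ∀ δ > 0, ∃ C > 0,
    ∀ (T : ℝ) (u : ℝ → Plane) (r : ℝ → ℝ → Plane), S.IsBroad T u 0 r →
    |(∫ t in Ioo 0 T, S.broadPlus u 0 r t S.L)
        - (H 0 0 * (∫ t in Ioo 0 T, u t 0) + H 0 1 * ∫ t in Ioo 0 T, u t 1)|
      ≤ C + δ * ∫ t in Ioo 0 T, ‖u t - v‖ ^ 2 ∧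
    |(∫ t in Ioo 0 T, S.broadMinus u 0 r t S.L)
        - (H 1 0 * (∫ t in Ioo 0 T, u t 0) + H 1 1 * ∫ t in Ioo 0 T, u t 1)|
      ≤ C + δ * ∫ t in Ioo 0 T, ‖u t - v‖ ^ 2 := by
  obtain ⟨H, C, hC, hH⟩ := exists_static_response hS
  obtain ⟨K, hK, hKb⟩ := S.exists_couple_bound
  have hL := right_mem_Icc.2 S.L_nonneg
  refine ⟨H, fun v R hR => ?_, fun v R hR δ hδ => ?_⟩
  -- For an exact stationary solution the error is zero.
  · have := hH (v 0) (v 1) 0 (fun x => R x 0) (fun x => R x 1)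
      (intervalIntegrable_coord hR.continuousOn 0) (intervalIntegrable_coord hR.continuousOn 1)
      ((ae_restrict_iff' measurableSet_Ioo).2 (ae_of_all _ fun x hx => by
        have hx' : x ∈ Icc 0 S.L := Ioo_subset_Icc_self hx
        rw [← hR.plus x hx', ← hR.minus x hx', sub_self, sub_self, abs_zero]
        exact ⟨le_rfl, le_rfl⟩))
    rw [mul_zero, ← hR.out_plus, ← hR.out_minus] at this
    exact ⟨sub_eq_zero.1 (abs_nonpos_iff.1 this.1), sub_eq_zero.1 (abs_nonpos_iff.1 this.2)⟩
  obtain ⟨Cd, hCd, hdev⟩ := exists_deviation_estimate hS hR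
  obtain ⟨ρ, hρ⟩ := isCompact_Icc.exists_bound_of_continuousOn hR.continuousOn
  have hρ0 : 0 ≤ ρ := (norm_nonneg _).trans (hρ _ hL)
  -- `δ₁` bounds the contribution of the controls, `δ₂` that of the states
  set δ₁ := δ / (4 * (1 + C)) with hδ₁
  have hδ₁p : 0 < δ₁ := by positivity
  set δ₂ := δ₁ / (2 * K * Cd) with hδ₂
  have hδ₂p : 0 < δ₂ := by positivity
  set c₁ := ‖v‖ + 1 / (4 * δ₁) with hc₁
  have hc₁p : 0 < c₁ := by positivity
  set c₂ := 2 * K * (ρ + 1 / (4 * δ₂)) with hc₂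
  have hc₂p : 0 < c₂ := by positivity
  have hτp := S.isTravelTime_tauPlus.nonneg hL
  have hτm := S.isTravelTime_tauMinus.nonneg hL
  have hLp := S.L_pos
  set E := (c₁ + c₂ * S.L) * (S.tauPlus S.L + S.tauMinus S.L) + δ₁ with hE
  have hEp : 0 < E := by positivity
  refine ⟨2 * (1 + C) * E, by positivity, fun T u r hr => ?_⟩
  set W := ∫ t in Ioo 0 T, ‖u t - v‖ ^ 2 with hW
  have hW0 : 0 ≤ W := integral_nonneg fun _ => sq_nonneg _
  have hWi := integrable_norm_sub_sq hr.inflow v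
  set N : ℝ × ℝ → ℝ := fun p => ‖r p.1 p.2 - R p.2‖ ^ 2 with hN
  have hNi : Integrable N (rectMeasure T S.L) :=
    integrable_norm_sub_profile_sq hr.state hR.continuousOn
  have hNle : ∫ p, N p ∂(rectMeasure T S.L) ≤ Cd * (1 + W) := by
    have h := hdev T u r hr
    have n1 : 0 ≤ ∫ t in Ioo 0 T, (S.broadPlus u 0 r t S.L - R S.L 0) ^ 2 :=
      integral_nonneg fun _ => sq_nonneg _
    have n2 : 0 ≤ ∫ t in Ioo 0 T, (S.broadMinus u 0 r t S.L - R 0 1) ^ 2 :=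
      integral_nonneg fun _ => sq_nonneg _
    linarith
  have hNm := integral_mirror hNi
  have hgp := (memLp_sourcePlus hr.source hr.state).integrable one_le_two
  have hgm := (memLp_sourceMinus hr.source hr.state).integrable one_le_two
  have hu0 : IntegrableOn (fun t => u t 0) (Ioo 0 T) :=
    (hr.inflow.eval_piLp 0).integrable one_le_two
  have hu1 : IntegrableOn (fun t => u t 1) (Ioo 0 T) :=
    (hr.inflow.eval_piLp 1).integrable one_le_two
  have hr0 : Integrable (fun p : ℝ × ℝ => r p.1 p.2 0) (rectMeasure T S.L) :=
    (hr.state.eval_piLp 0).integrable one_le_two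
  have hr1 : Integrable (fun p : ℝ × ℝ => r p.1 p.2 1) (rectMeasure T S.L) :=
    (hr.state.eval_piLp 1).integrable one_le_two
  have hcoup : ∀ (t x : ℝ), x ∈ Icc 0 S.L →
      K * (|r t x 0| + |r t x 1|) ≤ c₂ + 2 * K * δ₂ * ‖r t x - R x‖ ^ 2 := by
    intro t x hx
    have h0 := Plane.abs_le_norm (r t x) 0
    have h1 := Plane.abs_le_norm (r t x) 1
    have h2 : ‖r t x‖ ≤ ‖r t x - R x‖ + ρ := by
      have := norm_add_le (r t x - R x) (R x)
      rw [sub_add_cancel] at this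
      linarith [hρ x hx]
    have h3 := le_add_mul_sq (a := ‖r t x - R x‖) hδ₂p
    have h4 : |r t x 0| + |r t x 1| ≤ 2 * (ρ + 1 / (4 * δ₂)) + 2 * δ₂ * ‖r t x - R x‖ ^ 2 := by
      linarith
    have := mul_le_mul_of_nonneg_left h4 hK.le
    rw [hc₂]
    linarith
  have hcu : ∀ i t, |u t i| ≤ c₁ + δ₁ * ‖u t - v‖ ^ 2 := by
    intro i t
    have h0 := Plane.abs_le_norm (u t) i
    have h2 : ‖u t‖ ≤ ‖u t - v‖ + ‖v‖ := by
      have := norm_add_le (u t - v) v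
      rwa [sub_add_cancel] at this
    have h3 := le_add_mul_sq (a := ‖u t - v‖) hδ₁p
    rw [hc₁]
    linarith
  have hδK : 2 * K * δ₂ * (Cd * (1 + W)) = δ₁ * (1 + W) := by
    rw [hδ₂]; field_simp
  -- the contributions of the final time slab
  have errp : (∫ t in Ioo 0 T, (Ici (T - S.tauPlus S.L)).indicator (fun t => |u t 0|) t)
      + (∫ p, (Function.uncurry fun t y => (Ici (T - S.tauPlus S.L)).indicator
        (fun t => |S.sourcePlus r 0 t y|) t) p ∂(rectMeasure T S.L)) ≤ E + 2 * δ₁ * W := by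
    have b1 := slab_setIntegral_abs_le (T := T) hτp hc₁p.le hδ₁p.le hWi (fun _ => sq_nonneg _)
      (hcu 0)
    have b2 := slab_integral_le (T := T) (g := S.sourcePlus r 0) S.L_nonneg hτp hc₂p.le
      (by positivity : 0 ≤ 2 * K * δ₂) hNi (fun _ => sq_nonneg _)
      (S.ae_rect (P := fun t x => |S.sourcePlus r 0 t x| ≤ c₂ + 2 * K * δ₂ * N (t, x))
        fun t _ x hx => by
          simp only [sourcePlus, Pi.zero_apply, PiLp.zero_apply, add_zero]
          exact ((hKb x hx _ _).1).trans (hcoup t x hx))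
    have b3 := mul_le_mul_of_nonneg_left hNle (by positivity : 0 ≤ 2 * K * δ₂)
    rw [hδK] at b3
    have b4 : 0 ≤ (c₁ + c₂ * S.L) * S.tauMinus S.L := by positivity
    rw [hE]
    linarith
  have errm : (∫ t in Ioo 0 T, (Ici (T - S.tauMinus S.L)).indicator (fun t => |u t 1|) t)
      + (∫ p, (Function.uncurry fun t y => (Ici (T - S.tauMinus S.L)).indicator
        (fun t => |S.sourceMinus r 0 t y|) t) p ∂(rectMeasure T S.L)) ≤ E + 2 * δ₁ * W := by
    have b1 := slab_setIntegral_abs_le (T := T) hτm hc₁p.le hδ₁p.le hWi (fun _ => sq_nonneg _)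
      (hcu 1)
    have b2 := slab_integral_le (T := T) (g := S.sourceMinus r 0) S.L_nonneg hτm hc₂p.le
      (by positivity : 0 ≤ 2 * K * δ₂) hNm.1 (fun _ => sq_nonneg _)
      (S.ae_rect (P := fun t x => |S.sourceMinus r 0 t x| ≤ c₂ + 2 * K * δ₂ * N (t, S.L - x))
        fun t _ x hx => by
          simp only [sourceMinus, Pi.zero_apply, PiLp.zero_apply, add_zero]
          exact ((hKb _ (mirror_mem hx) _ _).2).trans (hcoup t _ (mirror_mem hx)))
    rw [hNm.2] at b2
    have b3 := mul_le_mul_of_nonneg_left hNle (by positivity : 0 ≤ 2 * K * δ₂)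
    rw [hδK] at b3
    have b4 : 0 ≤ (c₁ + c₂ * S.L) * S.tauPlus S.L := by positivity
    rw [hE]
    linarith
  set ε := E + 2 * δ₁ * W with hε
  -- the time integrals solve the stationary equations approximately
  set Φ : ℝ → ℝ := fun x => ∫ t in Ioo 0 T, r t x 0 with hΦ
  set Ψ : ℝ → ℝ := fun x => ∫ t in Ioo 0 T, r t x 1 with hΨ
  have iΦ : IntervalIntegrable Φ volume 0 S.L := by
    rw [intervalIntegrable_iff_integrableOn_Ioo_of_le S.L_nonneg]
    exact hr0.integral_prod_right
  have iΨ : IntervalIntegrable Ψ volume 0 S.L := by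
    rw [intervalIntegrable_iff_integrableOn_Ioo_of_le S.L_nonneg]
    exact hr1.integral_prod_right
  have srcint : ∀ᵐ y ∂(volume.restrict (Ioo 0 S.L)),
      (∫ t in Ioo 0 T, S.couplePlus y (r t y 0) (r t y 1)) = S.couplePlus y (Φ y) (Ψ y) ∧
      (∫ t in Ioo 0 T, S.coupleMinus y (r t y 0) (r t y 1)) = S.coupleMinus y (Φ y) (Ψ y) := by
    filter_upwards [hr0.prod_left_ae, hr1.prod_left_ae] with y h0 h1
    simp only [couplePlus_eq, coupleMinus_eq]
    have h0' : Integrable (fun t => r t y 0) (volume.restrict (Ioo 0 T)) := h0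
    have h1' : Integrable (fun t => r t y 1) (volume.restrict (Ioo 0 T)) := h1
    rw [integral_add (h0'.const_mul _) (h1'.const_mul _), integral_add (h0'.const_mul _)
      (h1'.const_mul _), integral_const_mul, integral_const_mul, integral_const_mul,
      integral_const_mul]
    exact ⟨rfl, rfl⟩
  have srcint' : ∀ᵐ y : ℝ, y ∈ Ioo 0 S.L →
      (∫ t in Ioo 0 T, S.couplePlus y (r t y 0) (r t y 1)) = S.couplePlus y (Φ y) (Ψ y) ∧
      (∫ t in Ioo 0 T, S.coupleMinus y (r t y 0) (r t y 1)) = S.coupleMinus y (Φ y) (Ψ y) :=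
    (ae_restrict_iff' measurableSet_Ioo).1 srcint
  have hneL : ∀ᵐ y : ℝ, y ≠ S.L := by simp [ae_iff, measure_singleton]
  have ep : ∀ x ∈ Icc 0 S.L, ∫ y in (0 : ℝ)..x, ∫ t in Ioo 0 T, S.sourcePlus r 0 t y
      = ∫ y in (0 : ℝ)..x, S.couplePlus y (Φ y) (Ψ y) := by
    intro x hx
    apply intervalIntegral.integral_congr_ae
    filter_upwards [srcint', hneL] with y hy hyL hyx
    rw [uIoc_of_le hx.1] at hyx
    rw [← (hy ⟨hyx.1, lt_of_le_of_ne (hyx.2.trans hx.2) hyL⟩).1]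
    simp only [sourcePlus, Pi.zero_apply, PiLp.zero_apply, add_zero]
  have em : ∀ x ∈ Icc 0 S.L, ∫ y in (0 : ℝ)..(S.L - x), ∫ t in Ioo 0 T, S.sourceMinus r 0 t y
      = ∫ y in x..S.L, S.coupleMinus y (Φ y) (Ψ y) := by
    intro x hx
    have h1 := intervalIntegral.integral_comp_sub_left (a := x) (b := S.L)
      (fun y => ∫ t in Ioo 0 T, S.sourceMinus r 0 t y) S.L
    rw [sub_self] at h1
    rw [← h1]
    apply intervalIntegral.integral_congr_ae
    filter_upwards [srcint', hneL] with y hy hyL hyx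
    rw [uIoc_of_le hx.2] at hyx
    rw [← (hy ⟨hx.1.trans_lt hyx.1, lt_of_le_of_ne hyx.2 hyL⟩).2]
    simp only [sourceMinus, Pi.zero_apply, PiLp.zero_apply, add_zero, sub_sub_cancel]
  have bp : ∀ x ∈ Icc 0 S.L, |(∫ t in Ioo 0 T, S.broadPlus u 0 r t x)
      - ((∫ t in Ioo 0 T, u t 0) + ∫ y in (0 : ℝ)..x, S.couplePlus y (Φ y) (Ψ y))| ≤ ε := by
    intro x hx
    rw [← ep x hx]
    exact (S.isTravelTime_tauPlus.abs_integral_broad_sub_le S.L_nonneg hx hu0 hgp).trans errp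
  have bm : ∀ x ∈ Icc 0 S.L, |(∫ t in Ioo 0 T, S.broadMinus u 0 r t (S.L - x))
      - ((∫ t in Ioo 0 T, u t 1) + ∫ y in x..S.L, S.coupleMinus y (Φ y) (Ψ y))| ≤ ε := by
    intro x hx
    rw [← em x hx]
    exact (S.isTravelTime_tauMinus.abs_integral_broad_sub_le S.L_nonneg (mirror_mem hx) hu1
      hgm).trans errm
  have swapae : ∀ {P : ℝ × ℝ → Prop}, (∀ᵐ p ∂(rectMeasure T S.L), P p) →
      ∀ᵐ x ∂(volume.restrict (Ioo 0 S.L)), ∀ᵐ t ∂(volume.restrict (Ioo 0 T)), P (t, x) := by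
    intro P hP
    have := Measure.measurePreserving_swap (μ := volume.restrict (Ioo 0 S.L))
      (ν := volume.restrict (Ioo 0 T)) |>.quasiMeasurePreserving.ae hP
    exact Measure.ae_ae_of_ae_prod this
  have key := hH (∫ t in Ioo 0 T, u t 0) (∫ t in Ioo 0 T, u t 1) ε Φ Ψ iΦ iΨ (by
    filter_upwards [swapae hr.plus, swapae hr.minus, ae_restrict_mem measurableSet_Ioo]
      with x h0 h1 hx
    have hx' : x ∈ Icc 0 S.L := Ioo_subset_Icc_self hx
    have f0 : Φ x = ∫ t in Ioo 0 T, S.broadPlus u 0 r t x := integral_congr_ae h0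
    have f1 : Ψ x = ∫ t in Ioo 0 T, S.broadMinus u 0 r t (S.L - x) := integral_congr_ae h1
    rw [f0, f1]
    exact ⟨bp x hx', bm x hx'⟩)
  -- The outflow integral differs by at most `ε` from the stationary formula, and the latter by at
  -- most `C * ε` from the response `H`; this explains the factor `1 + C` in the choice of `δ₁`.
  have k1 := bp S.L hL
  have k2 := bm 0 (left_mem_Icc.2 S.L_nonneg)
  rw [sub_zero] at k2
  have hfin : ε + C * ε ≤ 2 * (1 + C) * E + δ * W := by
    have : (1 + C) * (2 * δ₁ * W) = δ / 2 * W := by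
      rw [hδ₁]; field_simp; norm_num
    have h1 : 0 ≤ δ * W := by positivity
    have h2 : 0 ≤ (1 + C) * E := by positivity
    rw [hε]
    nlinarith
  constructor
  · refine le_trans ?_ hfin
    exact (abs_sub_le _ _ _).trans (add_le_add k1 key.1)
  · refine le_trans ?_ hfin
    exact (abs_sub_le _ _ _).trans (add_le_add k2 key.2)

end HyperbolicSystem

/-! ### Turnpike estimate for a fixed plus-component. -/

/-- The first-order condition of the static problem in the free component is affine in `y`, with
slope at least `lam > 0`. -/
theorem exists_critical_point (H : Matrix (Fin 2) (Fin 2) ℝ) {lam : ℝ} (hlam : lam ∈ Ioo (0 : ℝ) 1)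
    (b : Plane) (a : ℝ) : ∃ y : ℝ,
    (1 - lam) * ((H 0 0 * a + H 0 1 * y - b 0) * H 0 1 + (H 1 0 * a + H 1 1 * y - b 1) * H 1 1)
      + lam * y = 0 := by
  have h1 : 0 < 1 - lam := sub_pos.2 hlam.2
  have h0 : (1 - lam) * (H 0 1 ^ 2 + H 1 1 ^ 2) + lam ≠ 0 := by
    have := hlam.1
    positivity
  refine ⟨(1 - lam) * ((b 0 - H 0 0 * a) * H 0 1 + (b 1 - H 1 0 * a) * H 1 1)
    / ((1 - lam) * (H 0 1 ^ 2 + H 1 1 ^ 2) + lam), ?_⟩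
  have e := div_mul_cancel₀
    ((1 - lam) * ((b 0 - H 0 0 * a) * H 0 1 + (b 1 - H 1 0 * a) * H 1 1)) h0
  linear_combination e

namespace HyperbolicSystem
variable {S : HyperbolicSystem}

theorem staticCost_eq (lam : ℝ) (Rb v : Plane) (R : ℝ → Plane) :
    S.staticCost lam Rb v R = (1 - lam) * ((R S.L 0 - Rb 0) ^ 2 + (R 0 1 - Rb 1) ^ 2)
      + lam * (v 0 ^ 2 + v 1 ^ 2) := by
  simp [staticCost, Plane.norm_sq]

theorem trackingCost_eq (lam : ℝ) (Rb : Plane) {T : ℝ} (hT : 0 ≤ T) (u : ℝ → Plane)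
    (r : ℝ → ℝ → Plane) : S.trackingCost lam Rb T u r = ∫ t in Ioo 0 T,
      ((1 - lam) * ((S.broadPlus u 0 r t S.L - Rb 0) ^ 2 + (S.broadMinus u 0 r t S.L - Rb 1) ^ 2)
        + lam * (u t 0 ^ 2 + u t 1 ^ 2)) := by
  rw [trackingCost, intervalIntegral.integral_of_le hT, integral_Ioc_eq_integral_Ioo]
  simp [outflowTrace_eq, Plane.norm_sq]

/-- The tracking cost, expanded around a stationary state. -/
theorem trackingCost_expansion {lam : ℝ} {Rb : Plane} {T : ℝ} (hT : 0 ≤ T) {u : ℝ → Plane}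
    {r : ℝ → ℝ → Plane} (hr : S.IsBroad T u 0 r) (v : Plane) (R : ℝ → Plane) :
    S.trackingCost lam Rb T u r = T * S.staticCost lam Rb v R
      + (1 - lam) * ((∫ t in Ioo 0 T, (S.broadPlus u 0 r t S.L - R S.L 0) ^ 2)
        + ∫ t in Ioo 0 T, (S.broadMinus u 0 r t S.L - R 0 1) ^ 2)
      + lam * (∫ t in Ioo 0 T, ‖u t - v‖ ^ 2)
      + 2 * (1 - lam) * ((R S.L 0 - Rb 0) * ((∫ t in Ioo 0 T, S.broadPlus u 0 r t S.L) - T * R S.L 0)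
        + (R 0 1 - Rb 1) * ((∫ t in Ioo 0 T, S.broadMinus u 0 r t S.L) - T * R 0 1))
      + 2 * lam * (v 0 * ((∫ t in Ioo 0 T, u t 0) - T * v 0)
        + v 1 * ((∫ t in Ioo 0 T, u t 1) - T * v 1)) := by
  have hL := right_mem_Icc.2 S.L_nonneg
  rw [trackingCost_eq lam Rb hT, staticCost_eq]
  have op := hr.memLp_outPlus hL
  have om := hr.memLp_outMinus hL
  have i1 : Integrable (fun t => (S.broadPlus u 0 r t S.L - R S.L 0) ^ 2)
      (volume.restrict (Ioo 0 T)) := (op.sub (memLp_const _)).integrable_sq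
  have i2 : Integrable (fun t => (S.broadMinus u 0 r t S.L - R 0 1) ^ 2)
      (volume.restrict (Ioo 0 T)) := (om.sub (memLp_const _)).integrable_sq
  have i3 : Integrable (fun t => ‖u t - v‖ ^ 2) (volume.restrict (Ioo 0 T)) :=
    integrable_norm_sub_sq hr.inflow v
  have i4 : Integrable (fun t => S.broadPlus u 0 r t S.L) (volume.restrict (Ioo 0 T)) :=
    op.integrable one_le_two
  have i5 : Integrable (fun t => S.broadMinus u 0 r t S.L) (volume.restrict (Ioo 0 T)) :=
    om.integrable one_le_two
  have i6 : Integrable (fun t => u t 0) (volume.restrict (Ioo 0 T)) :=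
    (hr.inflow.eval_piLp 0).integrable one_le_two
  have i7 : Integrable (fun t => u t 1) (volume.restrict (Ioo 0 T)) :=
    (hr.inflow.eval_piLp 1).integrable one_le_two
  set c := (1 - lam) * ((R S.L 0 - Rb 0) ^ 2 + (R 0 1 - Rb 1) ^ 2) + lam * (v 0 ^ 2 + v 1 ^ 2)
    - 2 * (1 - lam) * ((R S.L 0 - Rb 0) * R S.L 0 + (R 0 1 - Rb 1) * R 0 1)
    - 2 * lam * (v 0 ^ 2 + v 1 ^ 2) with hc
  have i8 : Integrable (fun _ : ℝ => c) (volume.restrict (Ioo 0 T)) := integrable_const c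
  have e : ∀ t, (1 - lam) * ((S.broadPlus u 0 r t S.L - Rb 0) ^ 2
      + (S.broadMinus u 0 r t S.L - Rb 1) ^ 2) + lam * (u t 0 ^ 2 + u t 1 ^ 2)
      = c + (1 - lam) * (S.broadPlus u 0 r t S.L - R S.L 0) ^ 2
        + (1 - lam) * (S.broadMinus u 0 r t S.L - R 0 1) ^ 2 + lam * ‖u t - v‖ ^ 2
        + 2 * (1 - lam) * (R S.L 0 - Rb 0) * S.broadPlus u 0 r t S.L
        + 2 * (1 - lam) * (R 0 1 - Rb 1) * S.broadMinus u 0 r t S.L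
        + 2 * lam * v 0 * u t 0 + 2 * lam * v 1 * u t 1 := fun t => by
    rw [Plane.norm_sq, PiLp.sub_apply, PiLp.sub_apply, hc]
    ring
  simp_rw [e]
  have j1 := i8.add (i1.const_mul (1 - lam))
  have j2 := j1.add (i2.const_mul (1 - lam))
  have j3 := j2.add (i3.const_mul lam)
  have j4 := j3.add (i4.const_mul (2 * (1 - lam) * (R S.L 0 - Rb 0)))
  have j5 := j4.add (i5.const_mul (2 * (1 - lam) * (R 0 1 - Rb 1)))
  have j6 := j5.add (i6.const_mul (2 * lam * v 0))
  have s := integral_add' j6 (i7.const_mul (2 * lam * v 1))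
  rw [integral_add' j5, integral_add' j4, integral_add' j3, integral_add' j2, integral_add' j1,
    integral_add' i8] at s
  rotate_left
  · exact i1.const_mul _
  · exact i2.const_mul _
  · exact i3.const_mul _
  · exact i4.const_mul _
  · exact i5.const_mul _
  · exact i6.const_mul _
  refine Eq.trans s ?_
  simp only [integral_const_mul]
  have e0 : ∫ _ in Ioo 0 T, c = T * c := by simp [hT]
  rw [e0, hc]
  ring

/-- For a prescribed plus-component of the control, the stationary problem has a solution, and the
tracking cost of every control with this plus-component exceeds the stationary cost by the squared
deviation of the control, up to a constant that does not depend on the time horizon. -/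
theorem exists_partial_turnpike (hS : S.ForwardDissipative) {lam : ℝ}
    (hlam : lam ∈ Ioo (0 : ℝ) 1) (Rb : Plane) (k : ℝ) : ∃ (v : Plane) (R : ℝ → Plane),
    v 0 = k ∧ S.IsStaticIntegral v R ∧
    (∀ w Q, w 0 = k → S.IsStaticIntegral w Q →
      S.staticCost lam Rb v R ≤ S.staticCost lam Rb w Q) ∧
    ∃ C > 0, ∀ T ≥ 0,
      (∀ u r, S.IsBroad T u 0 r → (∀ᵐ t ∂(volume.restrict (Ioo 0 T)), u t 0 = k) →
        T * S.staticCost lam Rb v R + lam / 2 * (∫ t in Ioo 0 T, ‖u t - v‖ ^ 2)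
          ≤ S.trackingCost lam Rb T u r + C) ∧
      ∀ r, S.IsBroad T (fun _ => v) 0 r →
        S.trackingCost lam Rb T (fun _ => v) r ≤ T * S.staticCost lam Rb v R + C := by
  obtain ⟨H, hH, hmean⟩ := exists_mean_outflow hS
  obtain ⟨y, hy⟩ := exists_critical_point H hlam Rb k
  have h1 : 0 < 1 - lam := sub_pos.2 hlam.2
  have h0 := hlam.1
  obtain ⟨R, hR⟩ := S.exists_static hS !₂[k, y]
  set v : Plane := !₂[k, y] with hv
  have v0 : v 0 = k := by simp [hv]
  have v1 : v 1 = y := by simp [hv]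
  have hRv := hH v R hR
  rw [v0, v1] at hRv
  rw [← hRv.1, ← hRv.2] at hy
  set c := 2 * (1 - lam) * (|R S.L 0 - Rb 0| + |R 0 1 - Rb 1|) with hc
  have hc0 : 0 ≤ c := by positivity
  -- The tolerance is such that `c` times it is at most `lam / 2`: the error uses up at most half of
  -- the quadratic control term.
  obtain ⟨C, hC, hCb⟩ := hmean v R hR (lam / (2 * (c + 1))) (by positivity)
  obtain ⟨Cd, hCd, hdev⟩ := exists_deviation_estimate hS hR
  have expand : ∀ T ≥ 0, ∀ u r, S.IsBroad T u 0 r →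
      (∀ᵐ t ∂(volume.restrict (Ioo 0 T)), u t 0 = k) →
      |S.trackingCost lam Rb T u r - (T * S.staticCost lam Rb v R
        + (1 - lam) * ((∫ t in Ioo 0 T, (S.broadPlus u 0 r t S.L - R S.L 0) ^ 2)
          + ∫ t in Ioo 0 T, (S.broadMinus u 0 r t S.L - R 0 1) ^ 2)
        + lam * (∫ t in Ioo 0 T, ‖u t - v‖ ^ 2))|
      ≤ c * C + lam / 2 * ∫ t in Ioo 0 T, ‖u t - v‖ ^ 2 := by
    intro T hT u r hr huk
    have hb := hCb T u r hr
    have eU : ∫ t in Ioo 0 T, u t 0 = T * k := by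
      rw [integral_congr_ae huk]; simp [hT]
    rw [trackingCost_expansion hT hr v R]
    rw [eU] at hb ⊢
    set W := ∫ t in Ioo 0 T, ‖u t - v‖ ^ 2 with hW
    have hW0 : 0 ≤ W := integral_nonneg fun _ => sq_nonneg _
    set A := ∫ t in Ioo 0 T, S.broadPlus u 0 r t S.L
    set B := ∫ t in Ioo 0 T, S.broadMinus u 0 r t S.L
    set U := ∫ t in Ioo 0 T, u t 1
    set ε := C + lam / (2 * (c + 1)) * W with hε
    have hε0 : 0 ≤ ε := by positivity
    have hcε : c * ε ≤ c * C + lam / 2 * W := by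
      have : c * (lam / (2 * (c + 1))) ≤ lam / 2 := by
        rw [mul_div_assoc', div_le_div_iff₀ (by positivity) two_pos]
        nlinarith
      have := mul_le_mul_of_nonneg_right this hW0
      rw [hε]
      linarith
    refine le_trans (le_of_eq_of_le ?_ (?_ : |2 * (1 - lam) * ((R S.L 0 - Rb 0)
      * (A - (H 0 0 * (T * k) + H 0 1 * U))
      + (R 0 1 - Rb 1) * (B - (H 1 0 * (T * k) + H 1 1 * U)))| ≤ c * ε)) hcε
    -- Since `∫ u₊ = T * k`, the linear terms see the control only through `U - T * y`, whose
    -- coefficient vanishes by the first-order condition `hy`.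
    · congr 1
      rw [v0, v1]
      have e0 := hRv.1
      have e1 := hRv.2
      linear_combination 2 * (U - T * y) * hy - 2 * (1 - lam) * (R S.L 0 - Rb 0) * T * e0
        - 2 * (1 - lam) * (R 0 1 - Rb 1) * T * e1
    · rw [abs_mul, abs_of_pos (by positivity : 0 < 2 * (1 - lam)), hc,
      mul_assoc (2 * (1 - lam)) _ ε]
      refine mul_le_mul_of_nonneg_left ?_ (by positivity)
      refine (abs_add_le _ _).trans ?_
      rw [abs_mul, abs_mul, add_mul]
      exact add_le_add (mul_le_mul_of_nonneg_left hb.1 (abs_nonneg _))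
        (mul_le_mul_of_nonneg_left hb.2 (abs_nonneg _))
  -- The summand `(1 - lam) * Cd` covers the quadratic outflow terms of the constant control `v`,
  -- whose own deviation is zero.
  refine ⟨v, R, v0, hR, fun w Q hw hQ => ?_, c * C + (1 - lam) * Cd, by positivity,
    fun T hT => ⟨fun u r hr huk => ?_, fun r hr => ?_⟩⟩
  · have hQw := hH w Q hQ
    rw [hw] at hQw
    rw [staticCost_eq, staticCost_eq, v0, v1, hw]
    have e0 : Q S.L 0 = R S.L 0 + H 0 1 * (w 1 - y) := by rw [hQw.1, hRv.1]; ring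
    have e1 : Q 0 1 = R 0 1 + H 1 1 * (w 1 - y) := by rw [hQw.2, hRv.2]; ring
    rw [e0, e1]
    have n : 0 ≤ (1 - lam) * ((H 0 1 * (w 1 - y)) ^ 2 + (H 1 1 * (w 1 - y)) ^ 2)
        + lam * (w 1 - y) ^ 2 := by positivity
    -- The static cost minus its value at the critical point is the nonnegative quadratic `n`, the
    -- linear part being zero by `hy`.
    linear_combination n - 2 * (w 1 - y) * hy
  · have h := (abs_le.1 (expand T hT u r hr huk)).1
    have n : 0 ≤ (1 - lam) * ((∫ t in Ioo 0 T, (S.broadPlus u 0 r t S.L - R S.L 0) ^ 2)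
          + ∫ t in Ioo 0 T, (S.broadMinus u 0 r t S.L - R 0 1) ^ 2) :=
      mul_nonneg h1.le (add_nonneg (integral_nonneg fun _ => sq_nonneg _)
        (integral_nonneg fun _ => sq_nonneg _))
    have n' : 0 ≤ (1 - lam) * Cd := by positivity
    linarith
  · have h := (abs_le.1 (expand T hT _ r hr (ae_of_all _ fun _ => v0))).2
    have d := hdev T _ r hr
    simp only [sub_self, norm_zero, ne_eq, OfNat.ofNat_ne_zero, not_false_eq_true, zero_pow,
      integral_zero, mul_zero, add_zero, mul_one] at h d
    have n : 0 ≤ ∫ p : ℝ × ℝ, ‖r p.1 p.2 - R p.2‖ ^ 2 ∂(rectMeasure T S.L) :=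
      integral_nonneg fun _ => sq_nonneg _
    have := mul_le_mul_of_nonneg_left (le_trans (le_add_of_nonneg_right n) d) h1.le
    linarith

end HyperbolicSystem

/-! ### Effect of the switching cost, and conclusion. -/

namespace IsTravelTime

/-- The inflow is read at the shifted time `t - τ x`, and translations and shears pull null sets
back to null sets. -/
theorem broad_congr_inflow {T L : ℝ} {τ w w' : ℝ → ℝ} (hτ : IsTravelTime L τ)
    (h : w =ᵐ[volume.restrict (Ioo 0 T)] w') (g : ℝ → ℝ → ℝ) :
    (∀ x ∈ Icc 0 L, ∀ᵐ t ∂(volume.restrict (Ioo 0 T)), broad τ w g t x = broad τ w' g t x) ∧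
    ∀ᵐ p : ℝ × ℝ ∂(rectMeasure T L), broad τ w g p.1 p.2 = broad τ w' g p.1 p.2 := by
  have h' : ∀ᵐ s : ℝ, s ∈ Ioo 0 T → w s = w' s := (ae_restrict_iff' measurableSet_Ioo).1 h
  have key : ∀ t ∈ Ioo 0 T, ∀ x ∈ Icc 0 L, (t - τ x ∈ Ioo 0 T → w (t - τ x) = w' (t - τ x)) →
      broad τ w g t x = broad τ w' g t x := by
    intro t ht x hx hw
    unfold broad
    congr 1
    split_ifs with hlt
    · exact hw ⟨sub_pos.2 hlt, by linarith [ht.2, hτ.nonneg hx]⟩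
    · rfl
  constructor
  · intro x hx
    rw [ae_restrict_iff' measurableSet_Ioo]
    filter_upwards [(measurePreserving_sub_right volume (τ x)).quasiMeasurePreserving.ae h']
      with t ht htT
    exact key t htT x hx ht
  · rw [rectMeasure_eq, ae_restrict_iff' (measurableSet_rect T L)]
    have hs := (measurePreserving_shear
      (τ := fun x => -τ x) hτ.continuous.measurable.neg).quasiMeasurePreserving.ae
      (Measure.quasiMeasurePreserving_fst.ae h')
    filter_upwards [hs] with p hp hpT
    exact key p.1 hpT.1 p.2 (Ioo_subset_Icc_self hpT.2) (by simpa [shear, sub_eq_add_neg] using hp)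

end IsTravelTime

namespace HyperbolicSystem
variable {S : HyperbolicSystem}

theorem IsBroad.congr_inflow {T : ℝ} {u w : ℝ → Plane} {f q : ℝ → ℝ → Plane}
    (hq : S.IsBroad T u f q) (h : u =ᵐ[volume.restrict (Ioo 0 T)] w) : S.IsBroad T w f q := by
  have h0 : (fun t => u t 0) =ᵐ[volume.restrict (Ioo 0 T)] fun t => w t 0 :=
    h.mono fun t ht => by simp only [ht]
  have h1 : (fun t => u t 1) =ᵐ[volume.restrict (Ioo 0 T)] fun t => w t 1 :=
    h.mono fun t ht => by simp only [ht]
  refine ⟨(memLp_congr_ae h).1 hq.inflow, hq.source, hq.state, ?_, ?_⟩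
  · filter_upwards [hq.plus,
      (S.isTravelTime_tauPlus.broad_congr_inflow h0 (S.sourcePlus q f)).2] with p hp hp'
    exact hp.trans hp'
  · filter_upwards [hq.minus, (measurePreserving_mirror T S.L).quasiMeasurePreserving.ae
      (S.isTravelTime_tauMinus.broad_congr_inflow h1 (S.sourceMinus q f)).2] with p hp hp'
    exact hp.trans hp'

theorem trackingCost_congr {lam : ℝ} {Rb : Plane} {T : ℝ} (hT : 0 ≤ T) {u w : ℝ → Plane}
    {r : ℝ → ℝ → Plane} (h : u =ᵐ[volume.restrict (Ioo 0 T)] w) :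
    S.trackingCost lam Rb T u r = S.trackingCost lam Rb T w r := by
  have h0 : (fun t => u t 0) =ᵐ[volume.restrict (Ioo 0 T)] fun t => w t 0 :=
    h.mono fun t ht => by simp only [ht]
  have h1 : (fun t => u t 1) =ᵐ[volume.restrict (Ioo 0 T)] fun t => w t 1 :=
    h.mono fun t ht => by simp only [ht]
  have hL := right_mem_Icc.2 S.L_nonneg
  rw [trackingCost_eq lam Rb hT, trackingCost_eq lam Rb hT]
  refine integral_congr_ae ?_
  filter_upwards [h0, h1,
    (S.isTravelTime_tauPlus.broad_congr_inflow h0 (S.sourcePlus r 0)).1 S.L hL,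
    (S.isTravelTime_tauMinus.broad_congr_inflow h1 (S.sourceMinus r 0)).1 S.L hL] with t e0 e1 e2 e3
  simp only [broadPlus, broadMinus]
  rw [e0, e1, e2, e3]

theorem trackingCost_nonneg {lam : ℝ} (hlam : lam ∈ Ioo (0 : ℝ) 1) (Rb : Plane) {T : ℝ}
    (hT : 0 ≤ T) (u : ℝ → Plane) (r : ℝ → ℝ → Plane) : 0 ≤ S.trackingCost lam Rb T u r := by
  have h1 : 0 ≤ 1 - lam := (sub_pos.2 hlam.2).le
  have h0 := hlam.1.le
  exact intervalIntegral.integral_nonneg hT fun t _ => by positivity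

theorem broadPlus_zero (t x : ℝ) : S.broadPlus 0 0 0 t x = 0 := by
  simp [broadPlus, broad, sourcePlus, couplePlus_eq]

theorem broadMinus_zero (t x : ℝ) : S.broadMinus 0 0 0 t x = 0 := by
  simp [broadMinus, broad, sourceMinus, coupleMinus_eq]

theorem isBroad_zero (T : ℝ) : S.IsBroad T 0 0 0 :=
  ⟨MemLp.zero, MemLp.zero, MemLp.zero, ae_of_all _ fun _ => (broadPlus_zero _ _).symm,
    ae_of_all _ fun _ => (broadMinus_zero _ _).symm⟩

theorem trackingCost_zero (lam : ℝ) (Rb : Plane) {T : ℝ} (hT : 0 ≤ T) :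
    S.trackingCost lam Rb T 0 0 = T * ((1 - lam) * ‖Rb‖ ^ 2) := by
  rw [trackingCost_eq lam Rb hT, Plane.norm_sq]
  simp only [broadPlus_zero, broadMinus_zero]
  simp [hT]

theorem IsBroad.isDynamicFeasible {F : Finset ℤ} {T : ℝ} {u : ℝ → Plane} {r : ℝ → ℝ → Plane}
    (h : S.IsBroad T u 0 r) {k : ℤ} (hk : k ∈ F)
    (hu : ∀ᵐ t ∂(volume.restrict (Ioo 0 T)), u t 0 = k) : S.IsDynamicFeasible F T u r :=
  ⟨h.inflow, hu.mono fun _ ht => ⟨k, hk, ht⟩, (S.isState_iff h.inflow).2 h⟩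

theorem IsDynamicFeasible.isBroad {F : Finset ℤ} {T : ℝ} {u : ℝ → Plane} {r : ℝ → ℝ → Plane}
    (h : S.IsDynamicFeasible F T u r) : S.IsBroad T u 0 r :=
  (S.isState_iff h.memLp).1 h.state

theorem switchingCost_of_constant (lam ν : ℝ) (Rb : Plane) {T k : ℝ} {u : ℝ → Plane}
    (r : ℝ → ℝ → Plane) (hu : ∀ t ∈ Icc 0 T, u t 0 = k) :
    S.switchingCost lam ν Rb T u r = ENNReal.ofReal (S.trackingCost lam Rb T u r) := by
  have h : eVariationOn (fun t => u t 0) (Icc 0 T) = 0 :=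
    eVariationOn.constant_on <| by
      rintro _ ⟨s, hs, rfl⟩ _ ⟨t, ht, rfl⟩
      exact (hu s hs).trans (hu t ht).symm
  rw [switchingCost, h, mul_zero, add_zero]

/-- With an expensive switching cost the optimal integer control does not switch. -/
theorem IsDynamicOptimal.plus_constant {F : Finset ℤ} (hF : (0 : ℤ) ∈ F) {lam : ℝ}
    (hlam : lam ∈ Ioo (0 : ℝ) 1) {Rb : Plane} {ν : ℝ} (hν : (1 - lam) * ‖Rb‖ ^ 2 < ν)
    {T : ℝ} (hT : 0 < T) {u : ℝ → Plane} {r : ℝ → ℝ → Plane}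
    (h : S.IsDynamicOptimal F lam ν Rb T u r) : ∃ k ∈ F, ∀ t ∈ Icc 0 T, u t 0 = (k : ℝ) := by
  obtain ⟨hfeas, hopt⟩ := h
  have h1 : 0 ≤ (1 - lam) * ‖Rb‖ ^ 2 := mul_nonneg (sub_pos.2 hlam.2).le (sq_nonneg _)
  have hνT : 0 < ν * T := mul_pos (h1.trans_lt hν) hT
  set V := eVariationOn (fun t => u t 0) (Icc 0 T) with hV
  have hdist : ∀ s ∈ Icc 0 T, ∀ t ∈ Icc 0 T, edist (u s 0) (u t 0) ≤ V := fun s hs t ht =>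
    eVariationOn.edist_le (fun t => u t 0) hs ht
  -- Comparison with the zero control: its total cost is below `ν * T`, so the switching part alone
  -- must be.
  have hV1 : V < 1 := by
    have h0 := hopt 0 0 ((S.isBroad_zero T).isDynamicFeasible hF (ae_of_all _ fun t => by simp))
    rw [S.switchingCost_of_constant lam ν Rb (k := 0) 0 (fun t _ => by simp),
      trackingCost_zero lam Rb hT.le] at h0
    have h2 : ENNReal.ofReal (ν * T) * V < ENNReal.ofReal (ν * T) :=
      (le_add_self.trans h0).trans_lt
        ((ENNReal.ofReal_lt_ofReal_iff hνT).2 (by rw [mul_comm]; exact mul_lt_mul_of_pos_right hν hT))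
    by_contra hc
    exact h2.not_ge (le_mul_of_one_le_right' (not_lt.1 hc))
  have hmem : ∀ᵐ t ∂(volume.restrict (Ioo 0 T)), t ∈ Ioo 0 T := ae_restrict_mem measurableSet_Ioo
  have : NeBot (ae (volume.restrict (Ioo 0 T))) := by
    rw [ae_neBot, Ne, Measure.restrict_eq_zero, Real.volume_Ioo]
    simp [hT]
  obtain ⟨t₀, ⟨k, hk, hkt⟩, ht₀⟩ := (hfeas.integer.and hmem).exists
  -- Integers at distance less than one coincide; `t₀` serves as the reference time.
  have hae : ∀ᵐ t ∂(volume.restrict (Ioo 0 T)), u t 0 = (k : ℝ) := by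
    filter_upwards [hfeas.integer, hmem] with t ⟨j, _, hj⟩ ht
    have hd := (hdist t (Ioo_subset_Icc_self ht) t₀ (Ioo_subset_Icc_self ht₀)).trans_lt hV1
    rw [hj, hkt, edist_dist, ENNReal.ofReal_lt_one, Int.dist_cast_real, Int.dist_eq] at hd
    rw [hj]
    have : |j - k| < 1 := by exact_mod_cast hd
    rw [sub_eq_zero.1 (Int.abs_lt_one_iff.1 this)]
  -- A competitor equal to `u` almost everywhere, hence with the same state and tracking cost, but
  -- without variation.
  set w : ℝ → Plane := fun t => !₂[(k : ℝ), u t 1] with hw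
  have huw : u =ᵐ[volume.restrict (Ioo 0 T)] w := by
    filter_upwards [hae] with t ht
    ext i
    fin_cases i
    · simpa [hw] using ht
    · simp [hw]
  have hwk : ∀ t, w t 0 = k := fun t => by simp [hw]
  have hcomp := hopt w r ((hfeas.isBroad.congr_inflow huw).isDynamicFeasible hk (ae_of_all _ hwk))
  rw [S.switchingCost_of_constant lam ν Rb r (fun t _ => hwk t), switchingCost,
    trackingCost_congr hT.le huw] at hcomp
  -- The equal tracking costs are finite and cancel, so the switching cost of `u` is zero.
  have hV0 : V = 0 := by
    have h3 : ENNReal.ofReal (ν * T) * V ≤ 0 := by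
      refine (ENNReal.add_le_add_iff_left (ENNReal.ofReal_ne_top
        (r := S.trackingCost lam Rb T w r))).1 ?_
      rw [add_zero]
      exact hcomp
    exact (mul_eq_zero.1 (nonpos_iff_eq_zero.1 h3)).resolve_left (by simpa using hνT)
  refine ⟨k, hk, fun t ht => ?_⟩
  have := hdist t ht t₀ (Ioo_subset_Icc_self ht₀)
  rw [hV0, nonpos_iff_eq_zero, edist_eq_zero] at this
  exact this.trans hkt

end HyperbolicSystem

theorem theorem2 (S : HyperbolicSystem)
    (hforward : S.ForwardDissipative) (hbackward : S.BackwardDissipative)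
    (F : Finset ℤ) (hF : (0 : ℤ) ∈ F)
    (lam : ℝ) (hlam : lam ∈ Set.Ioo (0 : ℝ) 1) (Rb : Plane)
    (ν : ℝ) (hν : (1 - lam) * ‖Rb‖ ^ 2 < ν) :
    ∃ C > 0, ∃ K > 0, ∃ T₀ > 0, ∀ T ≥ T₀, ∀ (u : ℝ → Plane) (r : ℝ → ℝ → Plane),
      S.IsDynamicOptimal F lam ν Rb T u r →
      ∃ (v : Plane) (R : ℝ → Plane), S.IsStaticOptimal F lam Rb v R ∧
        (∀ t ∈ Set.Icc 0 T, u t 0 = v 0) ∧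
        1 / T * (∫ t in (0 : ℝ)..T, ‖u t - v‖ ^ 2) ≤ C / T ∧
        (∫ t in (0 : ℝ)..T, ∫ x in (0 : ℝ)..S.L, ‖r t x - R x‖ ^ 2) ≤ K := by
  have hlam0 := hlam.1
  choose v R hvk hR hmin Ck hCk hturn using
    fun k : ℤ => HyperbolicSystem.exists_partial_turnpike hforward hlam Rb (k : ℝ)
  choose Dk hDk hdev using fun k : ℤ => HyperbolicSystem.exists_deviation_estimate hforward (hR k)
  set c : ℤ → ℝ := fun k => S.staticCost lam Rb (v k) (R k) with hc
  obtain ⟨m, hmF, hm⟩ := Finset.exists_min_image F c ⟨0, hF⟩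
  set B := ∑ k ∈ F, Ck k with hB
  have hBk : ∀ k ∈ F, Ck k ≤ B := fun k hk =>
    Finset.single_le_sum (f := Ck) (fun j _ => (hCk j).le) hk
  have hB0 : 0 < B := Finset.sum_pos (fun j _ => hCk j) ⟨0, hF⟩
  have hDsum : ∀ k ∈ F, Dk k ≤ ∑ k ∈ F, Dk k := fun k hk =>
    Finset.single_le_sum (f := Dk) (fun j _ => (hDk j).le) hk
  have hDpos : 0 < ∑ k ∈ F, Dk k := Finset.sum_pos (fun j _ => hDk j) ⟨0, hF⟩
  have hgap : ∀ k ∈ F, 0 ≤ 2 * B / (c k - c m) := fun k hk =>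
    div_nonneg (by positivity) (sub_nonneg.2 (hm k hk))
  -- In `T₀`, integers that attain the minimum contribute `2 * B / 0 = 0`; every other summand is
  -- the horizon beyond which that integer cannot be optimal.
  refine ⟨4 * B / lam, by positivity, (∑ k ∈ F, Dk k) * (1 + 4 * B / lam), by positivity,
    1 + ∑ k ∈ F, 2 * B / (c k - c m),
    add_pos_of_pos_of_nonneg one_pos (Finset.sum_nonneg hgap), fun T hT u r hopt => ?_⟩
  have hT0 : 0 < T := lt_of_lt_of_le
    (add_pos_of_pos_of_nonneg one_pos (Finset.sum_nonneg hgap)) hT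
  obtain ⟨k, hk, huk⟩ := hopt.plus_constant hF hlam hν hT0
  have hr := hopt.1.isBroad
  -- The competitor is the constant control with the best integer `m`; neither control pays for
  -- switching.
  have hcost : S.trackingCost lam Rb T u r ≤ T * c m + B := by
    obtain ⟨s, hs⟩ := S.exists_state (v m)
    have h := hopt.2 _ s ((hs T).isDynamicFeasible hmF (ae_of_all _ fun _ => hvk m))
    rw [S.switchingCost_of_constant lam ν Rb r huk,
      S.switchingCost_of_constant lam ν Rb s (fun _ _ => hvk m),
      ENNReal.ofReal_le_ofReal_iff (S.trackingCost_nonneg hlam Rb hT0.le _ _)] at h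
    linarith [(hturn m T hT0.le).2 s (hs T), hBk m hmF]
  have hlow := (hturn k T hT0.le).1 u r hr
    ((ae_restrict_iff' measurableSet_Ioo).2
      (ae_of_all _ fun t ht => huk t (Ioo_subset_Icc_self ht)))
  set W := ∫ t in Ioo 0 T, ‖u t - v k‖ ^ 2 with hW
  have hW0 : 0 ≤ W := integral_nonneg fun _ => sq_nonneg _
  have hck : c m ≤ c k := hm k hk
  have hsum : T * (c k - c m) + lam / 2 * W ≤ 2 * B := by
    have : T * c k + lam / 2 * W ≤ S.trackingCost lam Rb T u r + Ck k := hlow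
    linarith [hBk k hk]
  have hWle : W ≤ 4 * B / lam := by
    rw [le_div_iff₀ hlam0]
    linarith [mul_nonneg hT0.le (sub_nonneg.2 hck)]
  -- A positive gap would bound `T` by a single summand of `T₀ - 1`.
  have hceq : c k = c m := by
    by_contra hne
    have hpos : 0 < c k - c m := sub_pos.2 (lt_of_le_of_ne hck (Ne.symm hne))
    have h1 : T ≤ 2 * B / (c k - c m) := by
      rw [le_div_iff₀ hpos]
      linarith [mul_nonneg hlam0.le hW0]
    have h2 := Finset.single_le_sum (f := fun k => 2 * B / (c k - c m)) hgap hk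
    linarith
  refine ⟨v k, R k, ⟨⟨⟨k, hk, hvk k⟩, (hR k).isStaticState⟩, ?_⟩, fun t ht => ?_, ?_, ?_⟩
  · rintro w Q ⟨j, hj, hwj⟩ hQ
    exact (hceq.le.trans (hm j hj)).trans (hmin j w Q hwj hQ.isStaticIntegral)
  · rw [huk t ht, hvk k]
  · rw [one_div_mul_eq_div, intervalIntegral.integral_of_le hT0.le, integral_Ioc_eq_integral_Ioo]
    exact div_le_div_of_nonneg_right hWle hT0.le
  -- Fubini turns the iterated integral into the one over the rectangle, which the deviation
  -- estimate bounds in terms of `W`.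
  · have hi := HyperbolicSystem.integrable_norm_sub_profile_sq hr.state (hR k).continuousOn
    have e := integral_prod _ hi
    have h := hdev k T u r hr
    rw [intervalIntegral.integral_of_le hT0.le, integral_Ioc_eq_integral_Ioo]
    simp_rw [intervalIntegral.integral_of_le S.L_nonneg, integral_Ioc_eq_integral_Ioo]
    have n1 : 0 ≤ ∫ t in Ioo 0 T, (S.broadPlus u 0 r t S.L - R k S.L 0) ^ 2 :=
      integral_nonneg fun _ => sq_nonneg _
    have n2 : 0 ≤ ∫ t in Ioo 0 T, (S.broadMinus u 0 r t S.L - R k 0 1) ^ 2 :=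
      integral_nonneg fun _ => sq_nonneg _
    have h3 : Dk k * (1 + W) ≤ (∑ k ∈ F, Dk k) * (1 + 4 * B / lam) :=
      mul_le_mul (hDsum k hk) (by linarith) (by linarith) hDpos.le
    refine le_trans ?_ h3
    refine le_trans (le_of_eq e.symm) ?_
    linarith
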